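/- A *weighted constraint with default value* $c=(f,\delta)$ on a finite set $\mathrm{var}(c)$ of variables and a finite domain $D$ consists of a function $f:\mathrm{supp}(c)\to\mathbb{Q}_{\ge 0}$ with $\mathrm{supp}(c)\subseteq D^{\mathrm{var}(c)}$ and a default value $\delta\in\mathbb{Q}_{\ge 0}$; it induces the total function on $D^{\mathrm{var}(c)}$ with $c(a)=f(a)$ for $a\in\mathrm{supp}(c)$ and $c(a)=\delta$ otherwise. An instance $I$ of $\#\mathrm{CSP}_{\mathrm{def}}$ is a finite set of such constraints on a common domain $D$; put $\mathrm{var}(I)=\bigcup_{c\in I}\mathrm{var}(c)$ and $$w(I)=\sum_{a\in D^{\mathrm{var}(I)}}\ \prod_{c\in I}c\bigl(a|_{\mathrm{var}(c)}\bigr).$$ The hypergraph of $I$ has vertex set $\mathrm{var}(I)$ and the non-empty sets among the $\mathrm{var}(c)$, $c\in I$, as edges. A vertex $x$ of a hypergraph is a *nest point* if the edges containing $x$ form a chain under inclusion, and a hypergraph is *$\beta$-acyclic* if it has a $\beta$-elimination order, that is, its vertices can be ordered $x_1,\dots,x_n$ so that each $x_i$ is a nest point of the hypergraph obtained by deleting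 $x_1,\dots,x_{i-1}$ from the vertex set and from all edges (and discarding the empty edge). $I$ is $\beta$-acyclic if its hypergraph is. An instance whose variables are natural numbers and whose domain is $D=\{0,\dots,N-1\}$ is encoded by listing, with all numbers in binary, $N$, the number of constraints, and for every constraint its variables, its default value, and a table with all assignments in its support and their weights; rationals are given by numerator and denominator in lowest terms. **Theorem.** There exist an algorithm (a program of a random access machine with logarithmic cost) and a polynomial $q$ such that, for every $\beta$-acyclic instance $I$ of $\#\mathrm{CSP}_{\mathrm{def}}$ and every encoding of $I$ of bit length $L$, the algorithm started on this encoding halts with the value $w(I)$ (numerator and denominator in lowest terms) as its output, after a run of cost at most $q(L)$ in which every number that it stores has at most $q(L)$ bits. -/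

import Mathlib

/-! ### Weighted constraints with default values and the partition function -/

/-- A weighted constraint with default value on a finite set `vars` of variables and domain `D`:
a function `f` from a finite set `supp` of assignments of `vars` to the non-negative rationals,
and a non-negative rational default value `dflt`. -/
structure WeightedConstraint (V D : Type) where
  vars : Finset V
  supp : Finset (vars → D)
  f : supp → ℚ≥0
  dflt : ℚ≥0

namespace WeightedConstraint

variable {V D : Type}

open Classical in
/-- The total function on the assignments of `c.vars` induced by the constraint `c`. -/
noncomputable def val (c : WeightedConstraint V D) (a : c.vars → D) : ℚ≥0 :=
  if h : a ∈ c.supp then c.f ⟨a, h⟩ else c.dflt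

end WeightedConstraint

section Instances

variable {V D : Type}

/-- The variables of an instance (a finite set of weighted constraints): the union of the sets of
variables of its constraints. -/
def instanceVars [DecidableEq V] (I : Finset (WeightedConstraint V D)) : Finset V :=
  I.biUnion fun c => c.vars

theorem vars_subset_instanceVars [DecidableEq V] {I : Finset (WeightedConstraint V D)}
    {c : WeightedConstraint V D} (hc : c ∈ I) : c.vars ⊆ instanceVars I :=
  Finset.subset_biUnion_of_mem (fun c : WeightedConstraint V D => c.vars) hc

/-- The partition function `w(I) = ∑_{a : var(I) → D} ∏_{c ∈ I} c(a|_{var(c)})`. -/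
noncomputable def partitionFunction [DecidableEq V] [Fintype D]
    (I : Finset (WeightedConstraint V D)) : ℚ≥0 :=
  ∑ a : instanceVars I → D, ∏ c : {c // c ∈ I},
    c.1.val fun x => a ⟨x.1, vars_subset_instanceVars c.2 x.2⟩

end Instances

/-! ### Hypergraphs and `β`-acyclicity -/

section BetaAcyclicity

variable {V D : Type}

/-- The hypergraph of an instance: its vertices are the variables of the instance, its edges the
(non-empty) sets of variables of the constraints. -/
def instanceHypergraph [DecidableEq V] (I : Finset (WeightedConstraint V D)) : Hypergraph V where
  vertexSet := ↑(instanceVars I)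
  edgeSet := {e | e.Nonempty ∧ ∃ c ∈ I, e = ↑c.vars}
  subset_vertexSet_of_mem_edgeSet' := by
    rintro e ⟨-, c, hc, rfl⟩
    exact Finset.coe_subset.2 (vars_subset_instanceVars hc)

namespace Hypergraph

/-- The hypergraph `H \ x`: the vertex `x` is removed from the vertex set and from every edge, and
the empty edge is discarded. -/
def eraseVertex (H : Hypergraph V) (x : V) : Hypergraph V where
  vertexSet := H.vertexSet \ {x}
  edgeSet := {e | e.Nonempty ∧ ∃ e' ∈ H.edgeSet, e = e' \ {x}}
  subset_vertexSet_of_mem_edgeSet' := by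
    rintro e ⟨-, e', he', rfl⟩
    exact Set.sdiff_subset_sdiff_left (H.subset_vertexSet_of_mem_edgeSet' he')

/-- `x` is a nest point of `H` if the edges that contain `x` form a chain for inclusion. -/
def IsNestPoint (H : Hypergraph V) (x : V) : Prop :=
  x ∈ H.vertexSet ∧ IsChain (· ⊆ ·) {e | e ∈ H.edgeSet ∧ x ∈ e}

/-- `β`-elimination orders: every vertex in turn is a nest point of the hypergraph that remains
after the removal of its predecessors. -/
inductive IsBetaEliminationOrder : Hypergraph V → List V → Prop
  | nil {H : Hypergraph V} : H.vertexSet = ∅ → IsBetaEliminationOrder H []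
  | cons {H : Hypergraph V} {x : V} {xs : List V} : H.IsNestPoint x →
      IsBetaEliminationOrder (H.eraseVertex x) xs → IsBetaEliminationOrder H (x :: xs)

/-- A hypergraph is `β`-acyclic if it has a `β`-elimination order. -/
def BetaAcyclic (H : Hypergraph V) : Prop :=
  ∃ xs : List V, IsBetaEliminationOrder H xs

end Hypergraph

end BetaAcyclicity

/-! ### Random access machines with logarithmic cost -/

namespace Ram

/-- The state of a random access machine: registers, which a program addresses by fixed indices
(so that a program uses finitely many of them), and an indirectly addressed memory. Both hold
natural numbers. -/
structure State where
  reg : ℕ → ℕ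
  mem : ℕ → ℕ

/-- Expressions: constants, contents of a register, contents of the memory cell whose address is
the value of an expression, and arithmetic (truncated subtraction, division rounded down). -/
inductive Expr
  | const (k : ℕ)
  | reg (i : ℕ)
  | mem (e : Expr)
  | add (e₁ e₂ : Expr)
  | sub (e₁ e₂ : Expr)
  | mul (e₁ e₂ : Expr)
  | div (e₁ e₂ : Expr)

namespace Expr

/-- The value of an expression. -/
def eval (s : State) : Expr → ℕ
  | const k => k
  | reg i => s.reg i
  | mem e => s.mem (e.eval s)
  | add e₁ e₂ => e₁.eval s + e₂.eval s
  | sub e₁ e₂ => e₁.eval s - e₂.eval s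
  | mul e₁ e₂ => e₁.eval s * e₂.eval s
  | div e₁ e₂ => e₁.eval s / e₂.eval s

/-- The logarithmic cost of the evaluation of an expression: each number that occurs in it
(operand, address or result) is charged one plus its bit length. -/
def cost (s : State) : Expr → ℕ
  | const k => k.size + 1
  | reg i => (s.reg i).size + 1
  | mem e => e.cost s + (s.mem (e.eval s)).size + 1
  | add e₁ e₂ => e₁.cost s + e₂.cost s + (e₁.eval s + e₂.eval s).size + 1
  | sub e₁ e₂ => e₁.cost s + e₂.cost s + (e₁.eval s - e₂.eval s).size + 1
  | mul e₁ e₂ => e₁.cost s + e₂.cost s + (e₁.eval s * e₂.eval s).size + 1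
  | div e₁ e₂ => e₁.cost s + e₂.cost s + (e₁.eval s / e₂.eval s).size + 1

end Expr

/-- Programs. A condition `e` holds if the value of `e` is not zero. -/
inductive Program
  | skip
  | setReg (i : ℕ) (e : Expr)
  | setMem (address e : Expr)
  | seq (p q : Program)
  | ifThenElse (e : Expr) (p q : Program)
  | whileLoop (e : Expr) (p : Program)

/-- `Exec B p s t s'`: the program `p`, started in the state `s`, halts in the state `s'` at
logarithmic cost `t`, and each number that it stores during the run has at most `B` bits. -/
inductive Exec (B : ℕ) : Program → State → ℕ → State → Prop
  | skip (s : State) : Exec B .skip s 1 s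
  | setReg (i : ℕ) (e : Expr) (s : State) : (e.eval s).size ≤ B →
      Exec B (.setReg i e) s (e.cost s + 1) ⟨Function.update s.reg i (e.eval s), s.mem⟩
  | setMem (address e : Expr) (s : State) : (e.eval s).size ≤ B →
      Exec B (.setMem address e) s (address.cost s + e.cost s + 1)
        ⟨s.reg, Function.update s.mem (address.eval s) (e.eval s)⟩
  | seq {p q : Program} {s s' s'' : State} {t t' : ℕ} : Exec B p s t s' → Exec B q s' t' s'' →
      Exec B (.seq p q) s (t + t') s''
  | ifTrue {e : Expr} {p q : Program} {s s' : State} {t : ℕ} : e.eval s ≠ 0 → Exec B p s t s' →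
      Exec B (.ifThenElse e p q) s (e.cost s + 1 + t) s'
  | ifFalse {e : Expr} {p q : Program} {s s' : State} {t : ℕ} : e.eval s = 0 → Exec B q s t s' →
      Exec B (.ifThenElse e p q) s (e.cost s + 1 + t) s'
  | whileTrue {e : Expr} {p : Program} {s s' s'' : State} {t t' : ℕ} : e.eval s ≠ 0 →
      Exec B p s t s' → Exec B (.whileLoop e p) s' t' s'' →
      Exec B (.whileLoop e p) s (e.cost s + 1 + t + t') s''
  | whileFalse {e : Expr} {p : Program} {s : State} : e.eval s = 0 →
      Exec B (.whileLoop e p) s (e.cost s + 1) s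

/-- The initial state on an input, a list of natural numbers: register `0` holds the length of the
list, the memory cells `0, 1, …` hold its entries, everything else is zero. -/
def init (input : List ℕ) : State where
  reg i := if i = 0 then input.length else 0
  mem i := input.getD i 0

end Ram

/-! ### Encoding of instances -/

/-- The number of bits of a list of natural numbers written in binary, with one additional symbol
for each entry. -/
def bitLength (code : List ℕ) : ℕ :=
  (code.map fun k => k.size + 1).sum

/-- `code` encodes the constraint `c` with variables in `ℕ` on domain `{0, …, n - 1}`: for some
listings `xs` of its variables and `as` of its support, `code` consists of the number of variables,
the variables, the default value, the size of the support, and the table that has for each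
assignment in the support a row with the values of the variables and the weight. Rationals are
given by numerator and denominator in lowest terms. -/
def IsConstraintCode {n : ℕ} (c : WeightedConstraint ℕ (Fin n)) (code : List ℕ) : Prop :=
  ∃ (xs : List c.vars) (as : List c.supp),
    (xs.Nodup ∧ ∀ x, x ∈ xs) ∧ (as.Nodup ∧ ∀ a, a ∈ as) ∧
    code = [xs.length] ++ xs.map (fun x => (x : ℕ)) ++ [c.dflt.num, c.dflt.den, as.length] ++
      as.flatMap fun a => xs.map (fun x => (a.1 x : ℕ)) ++ [(c.f a).num, (c.f a).den]

/-- `code` encodes the instance `I` with variables in `ℕ` on domain `{0, …, n - 1}`: it consists of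
`n`, the number of constraints, and codes of the constraints in some order. -/
def IsInstanceCode {n : ℕ} (I : Finset (WeightedConstraint ℕ (Fin n))) (code : List ℕ) : Prop :=
  ∃ (cs : List (WeightedConstraint ℕ (Fin n))) (codes : List (List ℕ)),
    (cs.Nodup ∧ ∀ c, c ∈ cs ↔ c ∈ I) ∧ List.Forall₂ IsConstraintCode cs codes ∧
    code = [n, cs.length] ++ codes.flatten

/-! Let `x 0, x 1, …` be a β-elimination order. When `x k` is eliminated, the constraints containing
it have remaining scopes that form a chain. Write them as c_1, …, c_p with growing scopes and put
S_i(a) = ∑_d ∏_{j ≤ i} c_j(a[x_k := d]), so that S_0 = N. Replace each c_i by S_i / S_{i-1}. The new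
product telescopes to S_p / N, so the partition function survives up to a factor N
(`prod_elim_succ`). The quotient depends only on the scope of c_i without x_k (`elim_local`). If `a`
agrees with no row of c_i on the remaining variables, then c_i(a[x_k := d]) is the default δ for
every d, hence S_i = δ S_{i-1} and the quotient is δ again (`elim_default`). Default values
therefore never change and the old rows, read on the remaining variables, still describe the
supports: the tables do not grow. After the last elimination a product of constants is left
(`total_eq`).

Five points remain to be settled.

Division by zero. Denominators are cleared; then a nonzero weight is multiplied by a huge K and a
zero weight is replaced by 1. Assignments of nonzero weight contribute multiples of K^m, all others
together less than K^m, so integer division by K^m returns the true sum (`sum_div_eq`,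
`Reads.partitionFunction_eq`).

Size of the numbers. A single ranking of the constraints sorts the chains of all steps at once
(`IsOrder.chainOrder`). For each threshold t, the product of the functions of rank below t after k
steps is N^(-k) times the sum of the original product over the eliminated variables. So each
function is a quotient of two positive integers at most N^k B^m, where B bounds the weights
(`elim_num_den_le`), and in lowest terms it has polynomially many bits.

Size of the domain. N is given in binary and may be exponential, but all values that do not occur in
the input give the same summand (`domSum_eq`).

Finding the order. In a β-acyclic hypergraph a nest point exists after the removal of any proper set
of vertices (`exists_nestPoint`), so a greedy choice succeeds (`isOrder_of_next`).

The machine. `Comp` is a class of functions closed under arithmetic, case distinction and loops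
whose accumulator has polynomially many bits. Its programs never write to the memory, so the input
stays readable; lists and tables are kept as the digits of a single number. -/

namespace BetaCount

open Ram

/-! ### Polynomial-time computability on the random access machine -/

theorem exec_mono {B B' : ℕ} (h : B ≤ B') {p : Program} {s s' : State} {t : ℕ}
    (he : Exec B p s t s') : Exec B' p s t s' := by
  induction he with
  | skip s => exact .skip s
  | setReg i e s hs => exact .setReg i e s (hs.trans h)
  | setMem a e s hs => exact .setMem a e s (hs.trans h)
  | seq _ _ h₁ h₂ => exact .seq h₁ h₂
  | ifTrue hc _ h₁ => exact .ifTrue hc h₁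
  | ifFalse hc _ h₁ => exact .ifFalse hc h₁
  | whileTrue hc _ _ h₁ h₂ => exact .whileTrue hc h₁ h₂
  | whileFalse hc => exact .whileFalse hc

theorem size_add_le (a b : ℕ) : (a + b).size ≤ a.size + b.size + 1 := by
  rw [Nat.size_le, pow_succ, pow_add]
  have ha := Nat.lt_size_self a
  have hb := Nat.lt_size_self b
  nlinarith [Nat.one_le_two_pow (n := a.size), Nat.one_le_two_pow (n := b.size)]

theorem size_mul_le (a b : ℕ) : (a * b).size ≤ a.size + b.size := by
  rw [Nat.size_le, pow_add]
  exact Nat.mul_lt_mul'' (Nat.lt_size_self a) (Nat.lt_size_self b)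

theorem size_le_self (a : ℕ) : a.size ≤ a := by
  rw [Nat.size_le]; exact Nat.lt_two_pow_self

/-- Types whose elements carry an input, a list of natural numbers. -/
class HasCode (X : Type) where
  code : X → List ℕ

/-- The body of a loop is a computation on pairs of an argument and a counter. Its resources are
still measured by the input of the argument, so polynomial bounds are uniform over the rounds. -/
instance {X : Type} [HasCode X] : HasCode (X × ℕ) := ⟨fun y => HasCode.code y.1⟩

/-! ### Polynomial bounds for values and for bit lengths. -/

section Bounds

variable {X : Type} [HasCode X] {D D' : Set X} {f g : X → ℕ}

/-- `f` is bounded on `D` by a polynomial in the length of the input. -/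
def PolyBdd (D : Set X) (f : X → ℕ) : Prop :=
  ∃ q : Polynomial ℕ, ∀ x ∈ D, f x ≤ q.eval (bitLength (HasCode.code x))

/-- The number of bits of `f` is bounded on `D` by a polynomial in the length of the input. -/
def SizeBdd (D : Set X) (f : X → ℕ) : Prop := PolyBdd D fun x => (f x).size

theorem PolyBdd.const (c : ℕ) : PolyBdd D fun _ => c := ⟨Polynomial.C c, by simp⟩

theorem PolyBdd.bitLength : PolyBdd D fun x => bitLength (HasCode.code x) :=
  ⟨Polynomial.X, by simp⟩

theorem PolyBdd.add (hf : PolyBdd D f) (hg : PolyBdd D g) : PolyBdd D fun x => f x + g x := by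
  obtain ⟨p, hp⟩ := hf
  obtain ⟨q, hq⟩ := hg
  exact ⟨p + q, fun x hx => by simpa using add_le_add (hp x hx) (hq x hx)⟩

theorem PolyBdd.mul (hf : PolyBdd D f) (hg : PolyBdd D g) : PolyBdd D fun x => f x * g x := by
  obtain ⟨p, hp⟩ := hf
  obtain ⟨q, hq⟩ := hg
  exact ⟨p * q, fun x hx => by simpa using Nat.mul_le_mul (hp x hx) (hq x hx)⟩

theorem PolyBdd.mono (hg : PolyBdd D g) (h : ∀ x ∈ D, f x ≤ g x) : PolyBdd D f := by
  obtain ⟨q, hq⟩ := hg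
  exact ⟨q, fun x hx => (h x hx).trans (hq x hx)⟩

theorem PolyBdd.subset (hf : PolyBdd D f) (h : D' ⊆ D) : PolyBdd D' f := by
  obtain ⟨q, hq⟩ := hf
  exact ⟨q, fun x hx => hq x (h hx)⟩

theorem PolyBdd.sizeBdd (hf : PolyBdd D f) : SizeBdd D f :=
  PolyBdd.mono hf fun _ _ => size_le_self _

theorem SizeBdd.mono (hg : SizeBdd D g) (h : ∀ x ∈ D, f x ≤ g x) : SizeBdd D f :=
  PolyBdd.mono hg fun x hx => Nat.size_le_size (h x hx)

theorem SizeBdd.of_le_two_pow (hg : PolyBdd D g) (h : ∀ x ∈ D, f x ≤ 2 ^ g x) : SizeBdd D f :=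
  PolyBdd.mono (hg.add (.const 1)) fun x hx =>
    (Nat.size_le_size (h x hx)).trans (by rw [Nat.size_pow])

theorem SizeBdd.add (hf : SizeBdd D f) (hg : SizeBdd D g) : SizeBdd D fun x => f x + g x :=
  PolyBdd.mono ((PolyBdd.add hf hg).add (.const 1)) fun _ _ => size_add_le _ _

theorem SizeBdd.mul (hf : SizeBdd D f) (hg : SizeBdd D g) : SizeBdd D fun x => f x * g x :=
  PolyBdd.mono (PolyBdd.add hf hg) fun _ _ => size_mul_le _ _

theorem SizeBdd.pow (hf : SizeBdd D f) (hg : PolyBdd D g) : SizeBdd D fun x => f x ^ g x := by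
  refine SizeBdd.of_le_two_pow (PolyBdd.mul hf hg) fun x _ => ?_
  rw [pow_mul]
  exact Nat.pow_le_pow_left (Nat.lt_size_self _).le _

end Bounds

/-- The memory that holds the input. -/
def inputMem (w : List ℕ) : ℕ → ℕ := fun i => w.getD i 0

/-! ### Straight-line computations and case distinctions. -/

section Comp

variable {X : Type} [HasCode X]

/-- On the domain `D`, started with the values of the functions `gs` in the registers `ρ i`, the
program `p` stores the value of `f` in register `d` and preserves the memory and the registers
below `d`, with polynomial resources. -/
def Computes (D : Set X) (gs : List (X → ℕ)) (ρ : ℕ → ℕ) (d : ℕ) (p : Program) (f : X → ℕ) :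
    Prop :=
  ∃ q : Polynomial ℕ, ∀ x ∈ D, ∀ s : State, s.mem = inputMem (HasCode.code x) →
    (∀ (i : ℕ) (h : i < gs.length), s.reg (ρ i) = gs[i] x) →
    ∃ (t : ℕ) (s' : State), Exec (q.eval (bitLength (HasCode.code x))) p s t s' ∧
      t ≤ q.eval (bitLength (HasCode.code x)) ∧ s'.mem = s.mem ∧
      (∀ j < d, s'.reg j = s.reg j) ∧ s'.reg d = f x

/-- On the domain `D`, the function `f` can be computed with polynomial resources from the input and
the values of the functions `gs`. -/
def Comp (D : Set X) (gs : List (X → ℕ)) (f : X → ℕ) : Prop :=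
  SizeBdd D f ∧ ∀ (ρ : ℕ → ℕ) (d : ℕ), (∀ i < gs.length, ρ i < d) → ∃ p, Computes D gs ρ d p f

variable {D D' : Set X} {gs : List (X → ℕ)} {f f₁ f₂ g : X → ℕ}

theorem Comp.congr (hf : Comp D gs f) (h : ∀ x ∈ D, f x = g x) : Comp D gs g := by
  refine ⟨SizeBdd.mono hf.1 fun x hx => (h x hx).ge, fun ρ d hd => ?_⟩
  obtain ⟨p, q, hp⟩ := hf.2 ρ d hd
  refine ⟨p, q, fun x hx s hm hs => ?_⟩
  obtain ⟨t, s', h1, h2, h3, h4, h5⟩ := hp x hx s hm hs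
  exact ⟨t, s', h1, h2, h3, h4, h5.trans (h x hx)⟩

theorem Comp.subset (hf : Comp D gs f) (h : D' ⊆ D) : Comp D' gs f := by
  refine ⟨PolyBdd.subset hf.1 h, fun ρ d hd => ?_⟩
  obtain ⟨p, q, hp⟩ := hf.2 ρ d hd
  exact ⟨p, q, fun x hx => hp x (h hx)⟩

/-- Evaluation of an expression in registers that have been computed. -/
theorem exec_setReg {B d : ℕ} {e : Expr} {s : State} {v : ℕ} (hv : e.eval s = v)
    (hB : v.size ≤ B) : ∃ s', Exec B (.setReg d e) s (e.cost s + 1) s' ∧ s'.mem = s.mem ∧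
      (∀ j, j ≠ d → s'.reg j = s.reg j) ∧ s'.reg d = v := by
  subst hv
  exact ⟨_, .setReg d e s hB, rfl, fun j hj => by simp [hj], by simp⟩

theorem Comp.const (c : ℕ) : Comp D gs fun _ => c := by
  refine ⟨PolyBdd.const _, fun ρ d _ => ⟨.setReg d (.const c), .C (c.size + 2), ?_⟩⟩
  intro x _ s _ _
  obtain ⟨s', h1, h2, h3, h4⟩ := exec_setReg (B := c.size + 2) (d := d) (e := .const c) (s := s)
    (v := c) rfl (by omega)
  exact ⟨_, s', by simpa using h1, by simp [Expr.cost], h2, fun j hj => h3 j hj.ne, h4⟩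

theorem Comp.getElem (i : ℕ) (h : i < gs.length) (hb : SizeBdd D gs[i]) : Comp D gs gs[i] := by
  refine ⟨hb, fun ρ d _ => ⟨.setReg d (.reg (ρ i)), ?_⟩⟩
  obtain ⟨q, hq⟩ := hb
  refine ⟨q + 2, fun x hx s _ hs => ?_⟩
  have hx' := hq x hx
  beta_reduce at hx'
  obtain ⟨s', h1, h2, h3, h4⟩ := exec_setReg (B := (q + 2).eval (bitLength (HasCode.code x)))
    (d := d) (e := .reg (ρ i)) (s := s) (hs i h) (by simp; omega)
  refine ⟨_, s', h1, ?_, h2, fun j hj => h3 j hj.ne, h4⟩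
  simp [Expr.cost, hs i h]
  omega

/-- A unary operation that an expression performs. -/
theorem Comp.unary {e : ℕ → Expr} (hf : Comp D gs f) (hg : SizeBdd D g)
    (he : ∀ x ∈ D, ∀ s : State, ∀ d, s.mem = inputMem (HasCode.code x) → s.reg d = f x →
      (e d).eval s = g x ∧ (e d).cost s ≤ 4 * ((f x).size + (g x).size) + 4) : Comp D gs g := by
  refine ⟨hg, fun ρ d hd => ?_⟩
  obtain ⟨p, q, hp⟩ := hf.2 ρ d hd
  obtain ⟨r, hr⟩ := (PolyBdd.add hf.1 hg)
  refine ⟨.seq p (.setReg d (e d)), q + 4 * r + 5, fun x hx s hm hs => ?_⟩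
  obtain ⟨t, s', h1, h2, h3, h4, h5⟩ := hp x hx s hm hs
  obtain ⟨he1, he2⟩ := he x hx s' d (h3.trans hm) h5
  have hrx := hr x hx
  beta_reduce at hrx
  obtain ⟨s'', g1, g2, g3, g4⟩ := exec_setReg
    (B := (q + 4 * r + 5).eval (bitLength (HasCode.code x))) (d := d) he1 (by simp; omega)
  refine ⟨_, s'', .seq (exec_mono ?_ h1) g1, ?_, g2.trans h3,
    fun j hj => (g3 j hj.ne).trans (h4 j hj), g4⟩
  · simp; omega
  · simp; omega

/-- A binary operation that an expression performs. -/
theorem Comp.binary {e : ℕ → ℕ → Expr} (hf₁ : Comp D gs f₁) (hf₂ : Comp D gs f₂) (hg : SizeBdd D g)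
    (he : ∀ x ∈ D, ∀ s : State, ∀ d d', s.reg d = f₁ x → s.reg d' = f₂ x →
      (e d d').eval s = g x ∧
        (e d d').cost s ≤ 4 * ((f₁ x).size + (f₂ x).size + (g x).size) + 4) : Comp D gs g := by
  refine ⟨hg, fun ρ d hd => ?_⟩
  obtain ⟨p₁, q₁, hp₁⟩ := hf₁.2 ρ d hd
  -- With target `d + 1`, the second program preserves register `d`, which holds the first operand.
  obtain ⟨p₂, q₂, hp₂⟩ := hf₂.2 ρ (d + 1) fun i hi => (hd i hi).trans d.lt_succ_self
  obtain ⟨r, hr⟩ := (PolyBdd.add (PolyBdd.add hf₁.1 hf₂.1) hg)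
  refine ⟨.seq (.seq p₁ p₂) (.setReg d (e d (d + 1))), q₁ + q₂ + 4 * r + 5, fun x hx s hm hs => ?_⟩
  obtain ⟨t, s', h1, h2, h3, h4, h5⟩ := hp₁ x hx s hm hs
  obtain ⟨t', s'', k1, k2, k3, k4, k5⟩ := hp₂ x hx s' (h3.trans hm)
    fun i hi => (h4 _ (hd i hi)).trans (hs i hi)
  obtain ⟨he1, he2⟩ := he x hx s'' d (d + 1) ((k4 d d.lt_succ_self).trans h5) k5
  have hrx := hr x hx
  beta_reduce at hrx
  obtain ⟨s''', g1, g2, g3, g4⟩ := exec_setReg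
    (B := (q₁ + q₂ + 4 * r + 5).eval (bitLength (HasCode.code x))) (d := d) he1 (by simp; omega)
  refine ⟨_, s''', .seq (.seq (exec_mono ?_ h1) (exec_mono ?_ k1)) g1, ?_, (g2.trans k3).trans h3,
    fun j hj => ((g3 j hj.ne).trans (k4 j (hj.trans d.lt_succ_self))).trans (h4 j hj), g4⟩
  · simp; omega
  · simp; omega
  · simp; omega

theorem Comp.add (hf : Comp D gs f) (hg : Comp D gs g) : Comp D gs fun x => f x + g x :=
  .binary (e := fun d d' => .add (.reg d) (.reg d')) hf hg (.add hf.1 hg.1)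
    fun x _ s d d' h h' => by simp [Expr.eval, Expr.cost, h, h']; omega

theorem Comp.sub (hf : Comp D gs f) (hg : Comp D gs g) : Comp D gs fun x => f x - g x :=
  .binary (e := fun d d' => .sub (.reg d) (.reg d')) hf hg (.mono hf.1 fun _ _ => Nat.sub_le _ _)
    fun x _ s d d' h h' => by simp [Expr.eval, Expr.cost, h, h']; omega

theorem Comp.mul (hf : Comp D gs f) (hg : Comp D gs g) : Comp D gs fun x => f x * g x :=
  .binary (e := fun d d' => .mul (.reg d) (.reg d')) hf hg (.mul hf.1 hg.1)
    fun x _ s d d' h h' => by simp [Expr.eval, Expr.cost, h, h']; omega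

theorem Comp.div (hf : Comp D gs f) (hg : Comp D gs g) : Comp D gs fun x => f x / g x :=
  .binary (e := fun d d' => .div (.reg d) (.reg d')) hf hg (.mono hf.1 fun _ _ => Nat.div_le_self _ _)
    fun x _ s d d' h h' => by simp [Expr.eval, Expr.cost, h, h']; omega

theorem Comp.mod (hf : Comp D gs f) (hg : Comp D gs g) : Comp D gs fun x => f x % g x :=
  (hf.sub ((hf.div hg).mul hg)).congr fun x _ => by
    have := Nat.div_add_mod (f x) (g x)
    rw [mul_comm] at this
    omega

theorem size_add_one_le_bitLength {w : List ℕ} {k : ℕ} (h : k ∈ w) : k.size + 1 ≤ bitLength w :=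
  List.single_le_sum (by simp) _ (List.mem_map_of_mem h)

theorem size_getD_le_bitLength (w : List ℕ) (i : ℕ) : (w.getD i 0).size ≤ bitLength w := by
  rcases lt_or_ge i w.length with h | h
  · rw [List.getD_eq_getElem _ _ h]
    have := size_add_one_le_bitLength (List.getElem_mem h)
    omega
  · rw [List.getD_eq_default _ _ h]
    simp

theorem length_le_bitLength (w : List ℕ) : w.length ≤ bitLength w := by
  induction w with
  | nil => simp
  | cons a w ih =>
    simp only [bitLength, List.map_cons, List.sum_cons, List.length_cons] at *
    omega

theorem Comp.getD (hf : Comp D gs f) : Comp D gs fun x => (HasCode.code x).getD (f x) 0 :=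
  .unary (e := fun d => .mem (.reg d)) hf
    (PolyBdd.bitLength.mono fun _ _ => size_getD_le_bitLength _ _)
    fun x _ s d hm h => by simp [Expr.eval, Expr.cost, h, hm, inputMem]; omega

/-- Each branch need only be computable where it is taken. This matters because many size bounds,
such as those for table entries, hold only under the guard. -/
theorem Comp.cond {c : X → ℕ} (hc : Comp D gs c) (hf : Comp (D ∩ {x | c x ≠ 0}) gs f)
    (hg : Comp (D ∩ {x | c x = 0}) gs g) : Comp D gs fun x => if c x ≠ 0 then f x else g x := by
  constructor
  · obtain ⟨p, hp⟩ := hf.1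
    obtain ⟨q, hq⟩ := hg.1
    refine ⟨p + q, fun x hx => ?_⟩
    by_cases h : c x = 0
    · have := hq x ⟨hx, h⟩
      beta_reduce at this
      simp [h]; omega
    · have := hp x ⟨hx, h⟩
      beta_reduce at this
      simp [h]; omega
  intro ρ d hd
  obtain ⟨p₀, q₀, hp₀⟩ := hc.2 ρ d hd
  obtain ⟨p₁, q₁, hp₁⟩ := hf.2 ρ d hd
  obtain ⟨p₂, q₂, hp₂⟩ := hg.2 ρ d hd
  obtain ⟨r, hr⟩ := hc.1
  refine ⟨.seq p₀ (.ifThenElse (.reg d) p₁ p₂), q₀ + q₁ + q₂ + r + 2, fun x hx s hm hs => ?_⟩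
  obtain ⟨t, s', h1, h2, h3, h4, h5⟩ := hp₀ x hx s hm hs
  have hrx := hr x hx
  beta_reduce at hrx
  by_cases h : c x = 0
  · obtain ⟨t', s'', k1, k2, k3, k4, k5⟩ := hp₂ x ⟨hx, h⟩ s' (h3.trans hm)
      fun i hi => (h4 _ (hd i hi)).trans (hs i hi)
    refine ⟨_, s'', .seq (exec_mono ?_ h1) (.ifFalse (h5.trans h) (exec_mono ?_ k1)), ?_,
      k3.trans h3, fun j hj => (k4 j hj).trans (h4 j hj), by simp [h, k5]⟩
    · simp; omega
    · simp; omega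
    · simp [Expr.cost, h5] at *; omega
  · obtain ⟨t', s'', k1, k2, k3, k4, k5⟩ := hp₁ x ⟨hx, h⟩ s' (h3.trans hm)
      fun i hi => (h4 _ (hd i hi)).trans (hs i hi)
    refine ⟨_, s'', .seq (exec_mono ?_ h1) (.ifTrue (by simpa [Expr.eval, h5]) (exec_mono ?_ k1)),
      ?_, k3.trans h3, fun j hj => (k4 j hj).trans (h4 j hj), by simp [h, k5]⟩
    · simp; omega
    · simp; omega
    · simp [Expr.cost, h5] at *; omega

end Comp

end BetaCount

namespace BetaCount

open Ram

/-! ### Loops -/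

section LoopEnv

variable {X : Type} {gs : List (X → ℕ)}

/-- The functions available in the body of a loop: the counter, one more function and the functions
available outside. -/
def loopEnv (gs : List (X → ℕ)) (b : X × ℕ → ℕ) : List (X × ℕ → ℕ) :=
  (fun y => y.2) :: b :: gs.map fun g y => g y.1

/-- The functions available in the body of a loop without accumulator. -/
abbrev roundEnv (gs : List (X → ℕ)) : List (X × ℕ → ℕ) := loopEnv gs fun y => y.2

@[simp] theorem loopEnv_length (b : X × ℕ → ℕ) : (loopEnv gs b).length = gs.length + 2 := by
  simp [loopEnv]

theorem loopEnv_getElem (b : X × ℕ → ℕ) (i : ℕ) (h : i < gs.length) (y : X × ℕ) :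
    ((loopEnv gs b)[i + 2]'(by simpa using h)) y = gs[i] y.1 := by
  change ((gs.map fun (g : X → ℕ) (y : X × ℕ) => g y.1)[i]'(by simpa using h)) y = gs[i] y.1
  simp

end LoopEnv

section Loop

variable {X : Type} [HasCode X] {D D' : Set X} {gs : List (X → ℕ)} {f g n : X → ℕ}

/-- The domain of the body of a loop with `n x` rounds. -/
def roundDomain (D : Set X) (n : X → ℕ) : Set (X × ℕ) := {y | y.1 ∈ D ∧ y.2 < n y.1}

theorem SizeBdd.lift (hf : SizeBdd D f) {E : Set (X × ℕ)} (h : ∀ y ∈ E, y.1 ∈ D) :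
    SizeBdd E fun y => f y.1 := by
  obtain ⟨q, hq⟩ := hf
  exact ⟨q, fun y hy => hq y.1 (h y hy)⟩

theorem PolyBdd.lift (hf : PolyBdd D f) {E : Set (X × ℕ)} (h : ∀ y ∈ E, y.1 ∈ D) :
    PolyBdd E fun y => f y.1 := by
  obtain ⟨q, hq⟩ := hf
  exact ⟨q, fun y hy => hq y.1 (h y hy)⟩

theorem Comp.lift (hf : Comp D gs f) {b : X × ℕ → ℕ} :
    Comp (roundDomain D n) (loopEnv gs b) fun y => f y.1 := by
  refine ⟨hf.1.lift fun y hy => hy.1, fun ρ d hd => ?_⟩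
  obtain ⟨p, q, hp⟩ := hf.2 (fun i => ρ (i + 2)) d fun i hi => hd (i + 2) (by simpa using hi)
  refine ⟨p, q, fun y hy s hm hs => hp y.1 hy.1 s hm fun i hi => ?_⟩
  have := hs (i + 2) (by simpa using hi)
  exact this.trans (loopEnv_getElem b i hi y)

theorem Comp.counter (hnb : PolyBdd D n) {b : X × ℕ → ℕ} :
    Comp (roundDomain D n) (loopEnv gs b) fun y => y.2 :=
  .getElem (gs := (fun y => y.2) :: b :: _) 0 (by simp)
    (((hnb.lift fun _ hy => hy.1).mono fun _ hy => hy.2.le).sizeBdd)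

/-- A sum or product body does not look at its accumulator. `roundEnv` expresses this by repeating
the counter in slot 1, so its programs run in any loop environment once slot 1 is redirected to the
register of the counter. -/
theorem Comp.weaken {h b : X × ℕ → ℕ} {E : Set (X × ℕ)} (hh : Comp E (roundEnv gs) h) :
    Comp E (loopEnv gs b) h := by
  refine ⟨hh.1, fun ρ d hd => ?_⟩
  obtain ⟨p, q, hp⟩ := hh.2 (fun i => if i = 1 then ρ 0 else ρ i) d (by
    intro i hi
    split_ifs
    · exact hd 0 (by simp)
    · exact hd i (by simpa using hi))
  refine ⟨p, q, fun y hy s hm hs => hp y hy s hm fun i hi => ?_⟩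
  rcases i with _ | _ | i
  · exact hs 0 (by simp)
  · exact hs 0 (by simp)
  · exact hs (i + 2) (by simpa using hi)

theorem exec_while {B T K : ℕ} {e : Expr} {p : Program} {n : ℕ} {P : ℕ → State → Prop}
    (hstep : ∀ k < n, ∀ s, P k s → ∃ t s', Exec B p s t s' ∧ t ≤ T ∧ P (k + 1) s')
    (hcond : ∀ k ≤ n, ∀ s, P k s → (e.eval s = 0 ↔ k = n) ∧ e.cost s ≤ K) {s : State} (hs : P 0 s) :
    ∃ t s', Exec B (.whileLoop e p) s t s' ∧ t ≤ n * (K + 1 + T) + K + 1 ∧ P n s' := by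
  -- Induction on the number `r` of remaining rounds, since execution peels off the first round.
  suffices h : ∀ r k, r + k = n → ∀ s, P k s → ∃ t s', Exec B (.whileLoop e p) s t s' ∧
      t ≤ r * (K + 1 + T) + K + 1 ∧ P n s' from h n 0 rfl s hs
  intro r
  induction r with
  | zero =>
    intro k hk s hs
    obtain ⟨h1, h2⟩ := hcond k (by omega) s hs
    obtain rfl : k = n := by omega
    exact ⟨_, s, .whileFalse (h1.2 rfl), by omega, hs⟩
  | succ r ih =>
    intro k hk s hs
    obtain ⟨h1, h2⟩ := hcond k (by omega) s hs
    obtain ⟨t, s', h3, h4, h5⟩ := hstep k (by omega) s hs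
    obtain ⟨t', s'', h6, h7, h8⟩ := ih (k + 1) (by omega) s' h5
    refine ⟨_, s'', .whileTrue (fun h => ?_) h3 h6, ?_, h8⟩
    · have := h1.1 h
      omega
    · rw [add_one_mul]
      omega

/-- Register `d` holds the number of rounds, `d + 1` the accumulator, `d + 2` the counter and `d +
3` the result of a round; the truncated difference of `d` and `d + 2` vanishes exactly at the end.
The bound `hB` is an assumption because iterating a size estimate for one round would not give a
polynomial. -/
theorem Comp.loopAux {F : X → ℕ → ℕ} (hn : Comp D gs n) (hnb : PolyBdd D n)
    (h0 : Comp D gs fun x => F x 0)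
    (hB : SizeBdd {y : X × ℕ | y.1 ∈ D ∧ y.2 ≤ n y.1} fun y => F y.1 y.2)
    (hstep : Comp (roundDomain D n) (loopEnv gs fun y => F y.1 y.2) fun y => F y.1 (y.2 + 1)) :
    Comp D gs fun x => F x (n x) := by
  obtain ⟨qB, hqB⟩ := hB
  obtain ⟨qn, hqn⟩ := hnb
  refine ⟨⟨qB, fun x hx => hqB (x, n x) ⟨hx, le_rfl⟩⟩, fun ρ d hd => ?_⟩
  obtain ⟨p₁, q₁, hp₁⟩ := hn.2 ρ d hd
  obtain ⟨p₂, q₂, hp₂⟩ := h0.2 ρ (d + 1) fun i hi => (hd i hi).trans d.lt_succ_self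
  obtain ⟨p₃, q₃, hp₃⟩ := hstep.2
    (fun i => if i = 0 then d + 2 else if i = 1 then d + 1 else ρ (i - 2)) (d + 3) (by
      intro i hi
      rcases i with _ | _ | i
      · simp
      · simp
      · have := hd i (by simpa using hi)
        simp
        omega)
  let body : Program := .seq p₃ (.seq (.setReg (d + 1) (.reg (d + 3)))
    (.setReg (d + 2) (.add (.reg (d + 2)) (.const 1))))
  refine ⟨.seq (.seq (.seq p₁ p₂) (.setReg (d + 2) (.const 0)))
    (.seq (.whileLoop (.sub (.reg d) (.reg (d + 2))) body) (.setReg d (.reg (d + 1)))),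
    q₁ + q₂ + 2 * qB + qn * (3 * qn + 3 + 1 + (q₃ + 2 * qB + 3 * qn + 20)) + 3 * qn + q₃ + 20,
    fun x hx s hm hs => ?_⟩
  set b := bitLength (HasCode.code x) with hb
  set Q : Polynomial ℕ :=
    q₁ + q₂ + 2 * qB + qn * (3 * qn + 3 + 1 + (q₃ + 2 * qB + 3 * qn + 20)) + 3 * qn + q₃ + 20
    with hQ
  have hQe : Q.eval b = q₁.eval b + q₂.eval b + 2 * qB.eval b + qn.eval b * (3 * qn.eval b + 3 + 1 +
      (q₃.eval b + 2 * qB.eval b + 3 * qn.eval b + 20)) + 3 * qn.eval b + q₃.eval b + 20 := by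
    simp [hQ]
  have hnx : n x ≤ qn.eval b := hqn x hx
  have hFx : ∀ k ≤ n x, (F x k).size ≤ qB.eval b := fun k hk => hqB (x, k) ⟨hx, hk⟩
  obtain ⟨t₁, s₁, a1, a2, a3, a4, a5⟩ := hp₁ x hx s hm hs
  obtain ⟨t₂, s₂, b1, b2, b3, b4, b5⟩ := hp₂ x hx s₁ (a3.trans hm)
    fun i hi => (a4 _ (hd i hi)).trans (hs i hi)
  obtain ⟨s₃, c1, c2, c3, c4⟩ := exec_setReg (B := Q.eval b) (d := d + 2) (e := .const 0) (s := s₂)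
    (v := 0) rfl (by simp)
  let P : ℕ → State → Prop := fun k s' => s'.mem = s.mem ∧ (∀ j < d, s'.reg j = s.reg j) ∧
    s'.reg d = n x ∧ s'.reg (d + 1) = F x k ∧ s'.reg (d + 2) = k ∧ k ≤ n x
  have hP0 : P 0 s₃ := ⟨(c2.trans b3).trans a3, fun j hj => (((c3 j (by omega)).trans
    (b4 j (by omega))).trans (a4 j hj)), ((c3 d (by omega)).trans (b4 d (by omega))).trans a5,
    (c3 (d + 1) (by omega)).trans b5, c4, Nat.zero_le _⟩
  have hPs : ∀ k < n x, ∀ s', P k s' → ∃ t s'', Exec (Q.eval b) body s' t s'' ∧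
      t ≤ q₃.eval b + 2 * qB.eval b + 3 * qn.eval b + 20 ∧ P (k + 1) s'' := by
    rintro k hk s' ⟨g1, g2, g3, g4, g5, -⟩
    obtain ⟨t₄, s₄, d1, d2, d3, d4, d5⟩ := hp₃ (x, k) ⟨hx, hk⟩ s' (g1.trans hm) (by
      intro i hi
      rcases i with _ | _ | i
      · exact g5
      · exact g4
      · have hi' : i < gs.length := by simpa using hi
        exact ((g2 _ (hd i hi')).trans (hs i hi')).trans (loopEnv_getElem _ i hi' (x, k)).symm)
    have hF1 := hFx (k + 1) hk
    obtain ⟨s₅, e1, e2, e3, e4⟩ := exec_setReg (B := Q.eval b) (d := d + 1) (e := .reg (d + 3))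
      (s := s₄) (v := F x (k + 1)) d5 (by omega)
    have hk1 : s₅.reg (d + 2) = k :=
      ((e3 _ (by omega)).trans (d4 _ (by omega))).trans g5
    have hks : (k + 1).size ≤ qn.eval b := (size_le_self _).trans (by omega)
    obtain ⟨s₆, f1, f2, f3, f4⟩ := exec_setReg (B := Q.eval b) (d := d + 2)
      (e := .add (.reg (d + 2)) (.const 1)) (s := s₅) (v := k + 1) (by simp [Expr.eval, hk1])
      (by omega)
    refine ⟨_, s₆, .seq (exec_mono ?_ d1) (.seq e1 f1), ?_, (f2.trans e2).trans (d3.trans g1),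
      fun j hj => ((f3 j (by omega)).trans (e3 j (by omega))).trans ((d4 j (by omega)).trans
      (g2 j hj)), ((f3 d (by omega)).trans (e3 d (by omega))).trans ((d4 d (by omega)).trans g3),
      (f3 (d + 1) (by omega)).trans e4, f4, hk⟩
    · change q₃.eval b ≤ _
      omega
    · change t₄ ≤ q₃.eval b at d2
      have h1 : s₄.reg (d + 3) = F x (k + 1) := d5
      have hk2 : k.size ≤ qn.eval b := (size_le_self _).trans (by omega)
      have h2 : (s₄.reg (d + 3)).size ≤ qB.eval b := by rw [h1]; exact hF1
      have h3 : Nat.size 1 = 1 := Nat.size_one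
      simp only [Expr.cost, Expr.eval, hk1]
      omega
  obtain ⟨t₇, s₇, w1, w2, w3, w4, w5, w6, w7, -⟩ := exec_while (K := 3 * qn.eval b + 3)
    (e := .sub (.reg d) (.reg (d + 2))) hPs (fun k hk s' hP => by
      obtain ⟨-, -, g3, -, g5, -⟩ := hP
      simp only [Expr.eval, Expr.cost, g3, g5]
      have h1 := size_le_self (n x)
      have h2 := size_le_self k
      have h3 := size_le_self (n x - k)
      omega) hP0
  have hFn := hFx (n x) le_rfl
  obtain ⟨s₈, v1, v2, v3, v4⟩ := exec_setReg (B := Q.eval b) (d := d) (e := .reg (d + 1))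
    (s := s₇) (v := F x (n x)) w6 (by omega)
  refine ⟨_, s₈, .seq (.seq (.seq (exec_mono ?_ a1) (exec_mono ?_ b1)) c1) (.seq w1 v1), ?_,
    v2.trans w3, fun j hj => (v3 j hj.ne).trans (w4 j hj), v4⟩
  · change q₁.eval b ≤ _
    omega
  · change q₂.eval b ≤ _
    omega
  · change t₁ ≤ q₁.eval b at a2
    change t₂ ≤ q₂.eval b at b2
    have h2 : (s₇.reg (d + 1)).size ≤ qB.eval b := by rw [w6]; exact hFn
    have h3 : Nat.size 0 = 0 := Nat.size_zero
    have h4 := Nat.mul_le_mul_right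
      (3 * qn.eval b + 3 + 1 + (q₃.eval b + 2 * qB.eval b + 3 * qn.eval b + 20)) hnx
    simp only [Expr.cost]
    omega

/-- Iteration: in round `y.2`, the counter and the accumulator `F y.1 y.2` are available. -/
theorem Comp.loop {F : X → ℕ → ℕ} (hn : Comp D gs n) (hnb : PolyBdd D n)
    (h0 : Comp D gs fun x => F x 0)
    (hB : SizeBdd {y : X × ℕ | y.1 ∈ D ∧ y.2 ≤ n y.1} fun y => F y.1 y.2)
    (hstep : Comp (roundDomain D n) (loopEnv gs fun y => F y.1 y.2) (fun y => F y.1 y.2) →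
      Comp (roundDomain D n) (loopEnv gs fun y => F y.1 y.2) fun y => F y.1 (y.2 + 1)) :
    Comp D gs fun x => F x (n x) :=
  .loopAux hn hnb h0 hB <| hstep <|
    .getElem (gs := _ :: _ :: _) 1 (by simp) (PolyBdd.subset hB fun _ hy => ⟨hy.1, hy.2.le⟩)

/-! ### Sums, products and maxima over polynomially many indices. -/

theorem SizeBdd.rangeSum {F : X → ℕ → ℕ} (hnb : PolyBdd D n)
    (hF : SizeBdd (roundDomain D n) fun y => F y.1 y.2) :
    SizeBdd {y : X × ℕ | y.1 ∈ D ∧ y.2 ≤ n y.1} fun y => ∑ i ∈ Finset.range y.2, F y.1 i := by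
  obtain ⟨q, hq⟩ := hF
  have h1 : PolyBdd {y : X × ℕ | y.1 ∈ D ∧ y.2 ≤ n y.1} fun y => n y.1 := hnb.lift fun y hy => hy.1
  refine SizeBdd.mono (g := fun y => n y.1 * 2 ^ (q.eval (bitLength (HasCode.code y))))
    (.mul h1.sizeBdd (.of_le_two_pow ⟨q, fun _ _ => le_rfl⟩ fun _ _ => le_rfl)) fun y hy => ?_
  refine (Finset.sum_le_card_nsmul _ _ (2 ^ (q.eval (bitLength (HasCode.code y)))) fun i hi => ?_).trans ?_
  · exact (Nat.size_le.1 (hq (y.1, i) ⟨hy.1, (Finset.mem_range.1 hi).trans_le hy.2⟩)).le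
  · rw [Finset.card_range, smul_eq_mul]
    exact Nat.mul_le_mul_right _ hy.2

theorem SizeBdd.rangeProd {F : X → ℕ → ℕ} (hnb : PolyBdd D n)
    (hF : SizeBdd (roundDomain D n) fun y => F y.1 y.2) :
    SizeBdd {y : X × ℕ | y.1 ∈ D ∧ y.2 ≤ n y.1} fun y => ∏ i ∈ Finset.range y.2, F y.1 i := by
  obtain ⟨q, hq⟩ := hF
  have h1 : PolyBdd {y : X × ℕ | y.1 ∈ D ∧ y.2 ≤ n y.1} fun y => n y.1 := hnb.lift fun y hy => hy.1
  refine SizeBdd.of_le_two_pow (g := fun y => q.eval (bitLength (HasCode.code y)) * n y.1)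
    (PolyBdd.mul ⟨q, fun _ _ => le_rfl⟩ h1) fun y hy => ?_
  refine (Finset.prod_le_pow_card _ _ (2 ^ (q.eval (bitLength (HasCode.code y)))) fun i hi => ?_).trans
    ?_
  · exact (Nat.size_le.1 (hq (y.1, i) ⟨hy.1, (Finset.mem_range.1 hi).trans_le hy.2⟩)).le
  · rw [Finset.card_range, ← pow_mul]
    exact Nat.pow_le_pow_right two_pos (Nat.mul_le_mul_left _ hy.2)

theorem SizeBdd.rangeSup {F : X → ℕ → ℕ} (hF : SizeBdd (roundDomain D n) fun y => F y.1 y.2) :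
    SizeBdd {y : X × ℕ | y.1 ∈ D ∧ y.2 ≤ n y.1} fun y => (Finset.range y.2).sup (F y.1) := by
  obtain ⟨q, hq⟩ := hF
  refine SizeBdd.of_le_two_pow (g := fun y => q.eval (bitLength (HasCode.code y)))
    ⟨q, fun _ _ => le_rfl⟩ fun y hy => Finset.sup_le fun i hi => ?_
  exact (Nat.size_le.1 (hq (y.1, i) ⟨hy.1, (Finset.mem_range.1 hi).trans_le hy.2⟩)).le

theorem Comp.rangeSum {F : X → ℕ → ℕ} (hn : Comp D gs n) (hnb : PolyBdd D n)
    (hF : Comp (roundDomain D n) (roundEnv gs) fun y => F y.1 y.2) :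
    Comp D gs fun x => ∑ i ∈ Finset.range (n x), F x i := by
  refine .loop (F := fun x k => ∑ i ∈ Finset.range k, F x i) hn hnb (by simpa using .const 0)
    (.rangeSum hnb hF.1) fun ha => ?_
  simp only [Finset.sum_range_succ]
  exact ha.add hF.weaken

theorem Comp.rangeProd {F : X → ℕ → ℕ} (hn : Comp D gs n) (hnb : PolyBdd D n)
    (hF : Comp (roundDomain D n) (roundEnv gs) fun y => F y.1 y.2) :
    Comp D gs fun x => ∏ i ∈ Finset.range (n x), F x i := by
  refine .loop (F := fun x k => ∏ i ∈ Finset.range k, F x i) hn hnb (by simpa using .const 1)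
    (.rangeProd hnb hF.1) fun ha => ?_
  simp only [Finset.prod_range_succ]
  exact ha.mul hF.weaken

/-- Computable predicates. -/
def CompPred (D : Set X) (gs : List (X → ℕ)) (P : X → Prop) : Prop :=
  ∃ c : X → ℕ, Comp D gs c ∧ ∀ x ∈ D, c x ≠ 0 ↔ P x

theorem CompPred.congr {P Q : X → Prop} (hP : CompPred D gs P) (h : ∀ x ∈ D, P x ↔ Q x) :
    CompPred D gs Q := by
  obtain ⟨c, hc, hcP⟩ := hP
  exact ⟨c, hc, fun x hx => (hcP x hx).trans (h x hx)⟩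

theorem Comp.ite {P : X → Prop} [∀ x, Decidable (P x)] (hP : CompPred D gs P)
    (hf : Comp (D ∩ {x | P x}) gs f) (hg : Comp (D ∩ {x | ¬ P x}) gs g) :
    Comp D gs fun x => if P x then f x else g x := by
  obtain ⟨c, hc, hcP⟩ := hP
  refine (Comp.cond hc (hf.subset ?_) (hg.subset ?_)).congr fun x hx => ?_
  · exact fun x hx => ⟨hx.1, (hcP x hx.1).1 hx.2⟩
  · exact fun x hx => ⟨hx.1, fun h => (hcP x hx.1).2 h hx.2⟩
  · simp only [hcP x hx]

theorem Comp.ite' {P : X → Prop} [∀ x, Decidable (P x)] (hP : CompPred D gs P)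
    (hf : Comp D gs f) (hg : Comp D gs g) : Comp D gs fun x => if P x then f x else g x :=
  .ite hP (hf.subset Set.inter_subset_left) (hg.subset Set.inter_subset_left)

theorem CompPred.lt (hf : Comp D gs f) (hg : Comp D gs g) : CompPred D gs fun x => f x < g x :=
  ⟨_, hg.sub hf, fun x _ => by omega⟩

theorem CompPred.le (hf : Comp D gs f) (hg : Comp D gs g) : CompPred D gs fun x => f x ≤ g x :=
  ⟨_, (hg.add (.const 1)).sub hf, fun x _ => by omega⟩

theorem CompPred.not {P : X → Prop} (hP : CompPred D gs P) : CompPred D gs fun x => ¬ P x := by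
  obtain ⟨c, hc, hcP⟩ := hP
  exact ⟨_, (Comp.const 1).sub hc, fun x hx => by beta_reduce; rw [← hcP x hx]; omega⟩

theorem CompPred.and {P Q : X → Prop} (hP : CompPred D gs P) (hQ : CompPred D gs Q) :
    CompPred D gs fun x => P x ∧ Q x := by
  obtain ⟨c, hc, hcP⟩ := hP
  obtain ⟨c', hc', hcQ⟩ := hQ
  exact ⟨_, hc.mul hc', fun x hx => by beta_reduce; rw [← hcP x hx, ← hcQ x hx]; exact mul_ne_zero_iff⟩

theorem CompPred.or {P Q : X → Prop} (hP : CompPred D gs P) (hQ : CompPred D gs Q) :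
    CompPred D gs fun x => P x ∨ Q x := by
  obtain ⟨c, hc, hcP⟩ := hP
  obtain ⟨c', hc', hcQ⟩ := hQ
  exact ⟨_, hc.add hc', fun x hx => by beta_reduce; rw [← hcP x hx, ← hcQ x hx]; omega⟩

theorem CompPred.imp {P Q : X → Prop} (hP : CompPred D gs P) (hQ : CompPred D gs Q) :
    CompPred D gs fun x => P x → Q x :=
  (hP.not.or hQ).congr fun _ _ => imp_iff_not_or.symm

theorem CompPred.eq (hf : Comp D gs f) (hg : Comp D gs g) : CompPred D gs fun x => f x = g x :=
  ((CompPred.le hf hg).and (.le hg hf)).congr fun _ _ => by omega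

theorem CompPred.ne (hf : Comp D gs f) (hg : Comp D gs g) : CompPred D gs fun x => f x ≠ g x :=
  (CompPred.eq hf hg).not

open Classical in
theorem CompPred.indicator {P : X → Prop} (hP : CompPred D gs P) :
    Comp D gs fun x => if P x then 1 else 0 := .ite' hP (.const 1) (.const 0)

theorem CompPred.exists_lt {P : X → ℕ → Prop} (hn : Comp D gs n) (hnb : PolyBdd D n)
    (hP : CompPred (roundDomain D n) (roundEnv gs) fun y => P y.1 y.2) :
    CompPred D gs fun x => ∃ i < n x, P x i := by
  classical
  refine ⟨fun x => ∑ i ∈ Finset.range (n x), if P x i then 1 else 0,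
    .rangeSum hn hnb hP.indicator, fun x _ => ?_⟩
  simp

theorem CompPred.forall_lt {P : X → ℕ → Prop} (hn : Comp D gs n) (hnb : PolyBdd D n)
    (hP : CompPred (roundDomain D n) (roundEnv gs) fun y => P y.1 y.2) :
    CompPred D gs fun x => ∀ i < n x, P x i :=
  (CompPred.exists_lt (P := fun x i => ¬ P x i) hn hnb hP.not).not.congr fun x _ => by
    push Not; rfl

theorem Comp.rangeSup {F : X → ℕ → ℕ} (hn : Comp D gs n) (hnb : PolyBdd D n)
    (hF : Comp (roundDomain D n) (roundEnv gs) fun y => F y.1 y.2) :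
    Comp D gs fun x => (Finset.range (n x)).sup (F x) := by
  refine .loop (F := fun x k => (Finset.range k).sup (F x)) hn hnb (by simpa using .const 0)
    (.rangeSup hF.1) fun ha => ?_
  simp only [Finset.range_add_one, Finset.sup_insert]
  refine (Comp.ite' (CompPred.le hF.weaken ha) ha hF.weaken).congr fun y _ => ?_
  split_ifs with h
  · exact (sup_eq_right.2 h).symm
  · exact (sup_eq_left.2 (not_le.1 h).le).symm

theorem Comp.pow (hf : Comp D gs f) (hn : Comp D gs n) (hnb : PolyBdd D n) :
    Comp D gs fun x => f x ^ n x :=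
  (Comp.rangeProd (F := fun x _ => f x) hn hnb hf.lift).congr fun x _ => by simp

end Loop

end BetaCount

namespace BetaCount

open Ram

/-! ### Greatest common divisors and rational numbers -/

section Rational

variable {X : Type} [HasCode X] {D D' : Set X} {gs : List (X → ℕ)} {f g n : X → ℕ}

/-- Euclid's algorithm on the registers `d` and `d + 1`. -/
def euclid (d : ℕ) : Program :=
  .whileLoop (.reg (d + 1)) (.seq (.setReg (d + 2) (.sub (.reg d)
    (.mul (.div (.reg d) (.reg (d + 1))) (.reg (d + 1)))))
    (.seq (.setReg d (.reg (d + 1))) (.setReg (d + 1) (.reg (d + 2)))))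

/-- A round replaces (a, b) by (b, a mod b). Since b ≤ a, twice the remainder is at most a, so the
product of the two registers at least halves and `r` rounds suffice for a product below `2 ^ r`. -/
theorem exec_euclid (d S : ℕ) : ∀ (r : ℕ) (s : State), s.reg (d + 1) ≤ s.reg d →
    s.reg d * s.reg (d + 1) < 2 ^ r → (s.reg d).size ≤ S →
    ∃ t s', Exec S (euclid d) s t s' ∧ t ≤ (r + 1) * (12 * S + 20) ∧ s'.mem = s.mem ∧
      (∀ j < d, s'.reg j = s.reg j) ∧ s'.reg d = (s.reg d).gcd (s.reg (d + 1)) := by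
  intro r
  induction r with
  | zero =>
    intro s hle hr hS
    have h0 : s.reg (d + 1) = 0 := by
      by_contra h
      have : 1 ≤ s.reg d * s.reg (d + 1) := Nat.mul_pos (by omega) (by omega)
      omega
    exact ⟨_, s, .whileFalse h0, by simp [Expr.cost, h0], rfl, fun _ _ => rfl, by simp [h0]⟩
  | succ r ih =>
    intro s hle hr hS
    by_cases h0 : s.reg (d + 1) = 0
    · exact ⟨_, s, .whileFalse h0, by simp [Expr.cost, h0]; nlinarith, rfl, fun _ _ => rfl, by simp [h0]⟩
    obtain ⟨a, ha⟩ : ∃ a, s.reg d = a := ⟨_, rfl⟩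
    obtain ⟨b, hb⟩ : ∃ b, s.reg (d + 1) = b := ⟨_, rfl⟩
    rw [ha, hb] at hle hr
    rw [ha] at hS
    rw [hb] at h0
    have hmod : a - a / b * b = a % b := by
      have := Nat.div_add_mod a b
      rw [mul_comm] at this
      omega
    have hmb : a % b < b := Nat.mod_lt _ (Nat.pos_of_ne_zero h0)
    have hS' : ∀ c ≤ a, c.size ≤ S := fun c hc => (Nat.size_le_size hc).trans hS
    obtain ⟨s₁, a1, a2, a3, a4⟩ := exec_setReg (B := S) (d := d + 2) (s := s) (v := a % b)
      (e := .sub (.reg d) (.mul (.div (.reg d) (.reg (d + 1))) (.reg (d + 1))))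
      (by simp [Expr.eval, ha, hb, hmod]) (hS' _ (by omega))
    have a3d : s₁.reg d = a := (a3 d (by omega)).trans ha
    have a3b : s₁.reg (d + 1) = b := (a3 (d + 1) (by omega)).trans hb
    obtain ⟨s₂, b1, b2, b3, b4⟩ := exec_setReg (B := S) (d := d) (s := s₁) (v := b)
      (e := .reg (d + 1)) a3b (hS' _ hle)
    have b3m : s₂.reg (d + 2) = a % b := (b3 _ (by omega)).trans a4
    obtain ⟨s₃, c1, c2, c3, c4⟩ := exec_setReg (B := S) (d := d + 1) (s := s₂) (v := a % b)
      (e := .reg (d + 2)) b3m (hS' _ (by omega))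
    have c3d : s₃.reg d = b := (c3 d (by omega)).trans b4
    obtain ⟨t, s', e1, e2, e3, e4, e5⟩ := ih s₃ (by rw [c3d, c4]; exact hmb.le) (by
      rw [c3d, c4]
      have h2 : 2 * (a % b) ≤ a := by
        have := Nat.mod_add_div a b
        have : b * 1 ≤ b * (a / b) := Nat.mul_le_mul_left _ (Nat.div_pos hle (Nat.pos_of_ne_zero h0))
        omega
      have h3 := Nat.mul_le_mul_left b h2
      rw [pow_succ] at hr
      have h4 : b * (2 * (a % b)) = 2 * (b * (a % b)) := by ring
      rw [mul_comm a b] at hr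
      omega) (by rw [c3d]; exact hS' _ hle)
    refine ⟨_, s', .whileTrue (by simpa [Expr.eval, hb]) (.seq a1 (.seq b1 c1)) e1, ?_,
      ((e3.trans c2).trans b2).trans a2, fun j hj => (((e4 j hj).trans (c3 j (by omega))).trans
      (b3 j (by omega))).trans (a3 j (by omega)), ?_⟩
    · have h1 := hS' b hle
      have h2 := hS' (a % b) (by omega)
      have h3 := hS' (a / b) (Nat.div_le_self _ _)
      have h4 := hS' (a / b * b) (Nat.div_mul_le_self _ _)
      rw [add_one_mul]
      simp only [Expr.cost, Expr.eval, ha, hb, a3b, b3m, hmod]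
      omega
    · rw [e5, c3d, c4, ha, hb, Nat.gcd_comm a b, Nat.gcd_rec b a, Nat.gcd_comm]

theorem Comp.gcd (hf : Comp D gs f) (hg : Comp D gs g) : Comp D gs fun x => (f x).gcd (g x) := by
  -- The algorithm is run on f + g and g, which have the same gcd as f and g and are in the order
  -- that `exec_euclid` requires.
  have hfg := hf.add hg
  constructor
  · exact SizeBdd.mono hfg.1 fun x _ => by
      rcases Nat.eq_zero_or_pos (f x) with h | h
      · simp [h]
      · exact (Nat.gcd_le_left _ h).trans (Nat.le_add_right _ _)
  intro ρ d hd
  obtain ⟨p₁, q₁, hp₁⟩ := hfg.2 ρ d hd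
  obtain ⟨p₂, q₂, hp₂⟩ := hg.2 ρ (d + 1) fun i hi => (hd i hi).trans d.lt_succ_self
  obtain ⟨r, hr⟩ := hfg.1
  refine ⟨.seq (.seq p₁ p₂) (euclid d), q₁ + q₂ + r + (2 * r + 1) * (12 * r + 20),
    fun x hx s hm hs => ?_⟩
  obtain ⟨t, s', h1, h2, h3, h4, h5⟩ := hp₁ x hx s hm hs
  obtain ⟨t', s'', k1, k2, k3, k4, k5⟩ := hp₂ x hx s' (h3.trans hm)
    fun i hi => (h4 _ (hd i hi)).trans (hs i hi)
  have hrx := hr x hx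
  beta_reduce at hrx
  have k4d := (k4 d (by omega)).trans h5
  obtain ⟨t₃, s₃, e1, e2, e3, e4, e5⟩ := exec_euclid d (r.eval (bitLength (HasCode.code x)))
    (2 * r.eval (bitLength (HasCode.code x))) s'' (by rw [k5, k4d]; exact Nat.le_add_left _ _) (by
      rw [k5, k4d, two_mul, pow_add]
      have h1 := Nat.size_le.1 hrx
      exact Nat.mul_lt_mul'' h1 (lt_of_le_of_lt (Nat.le_add_left _ _) h1)) (by rw [k4d]; exact hrx)
  refine ⟨_, s₃, .seq (.seq (exec_mono ?_ h1) (exec_mono ?_ k1)) (exec_mono ?_ e1), ?_,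
    (e3.trans k3).trans h3, fun j hj => ((e4 j hj).trans (k4 j (by omega))).trans (h4 j hj), ?_⟩
  · simp; omega
  · simp; omega
  · simp; omega
  · simp; omega
  · rw [e5, k5, k4d, Nat.gcd_add_self_left]

/-- Rational functions that are computable as fractions, not necessarily in lowest terms. -/
def CompQ (D : Set X) (gs : List (X → ℕ)) (u : X → ℚ≥0) : Prop :=
  ∃ p q : X → ℕ, Comp D gs p ∧ Comp D gs q ∧ ∀ x ∈ D, q x ≠ 0 ∧ u x = p x / q x

variable {u v : X → ℚ≥0}

theorem CompQ.congr (hu : CompQ D gs u) (h : ∀ x ∈ D, u x = v x) : CompQ D gs v := by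
  obtain ⟨p, q, hp, hq, hpq⟩ := hu
  exact ⟨p, q, hp, hq, fun x hx => ⟨(hpq x hx).1, (h x hx).symm.trans (hpq x hx).2⟩⟩

theorem CompQ.subset (hu : CompQ D gs u) (h : D' ⊆ D) : CompQ D' gs u := by
  obtain ⟨p, q, hp, hq, hpq⟩ := hu
  exact ⟨p, q, hp.subset h, hq.subset h, fun x hx => hpq x (h hx)⟩

theorem CompQ.natCast (hf : Comp D gs f) : CompQ D gs fun x => (f x : ℚ≥0) :=
  ⟨f, fun _ => 1, hf, .const 1, by simp⟩

theorem CompQ.mul (hu : CompQ D gs u) (hv : CompQ D gs v) : CompQ D gs fun x => u x * v x := by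
  obtain ⟨p, q, hp, hq, hpq⟩ := hu
  obtain ⟨p', q', hp', hq', hpq'⟩ := hv
  refine ⟨_, _, hp.mul hp', hq.mul hq', fun x hx => ⟨mul_ne_zero (hpq x hx).1 (hpq' x hx).1, ?_⟩⟩
  beta_reduce
  rw [(hpq x hx).2, (hpq' x hx).2, Nat.cast_mul, Nat.cast_mul, div_mul_div_comm]

theorem CompQ.inv (hu : CompQ D gs u) : CompQ D gs fun x => (u x)⁻¹ := by
  obtain ⟨p, q, hp, hq, hpq⟩ := hu
  -- For `p x = 0` the fraction 0 / 1 realizes the convention that the inverse of zero is zero.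
  refine ⟨fun x => if p x ≠ 0 then q x else 0, fun x => if p x ≠ 0 then p x else 1,
    .ite' (.ne hp (.const 0)) hq (.const 0), .ite' (.ne hp (.const 0)) hp (.const 1), fun x hx => ?_⟩
  beta_reduce
  rw [(hpq x hx).2]
  by_cases h : p x = 0 <;> simp [h]

theorem CompQ.div (hu : CompQ D gs u) (hv : CompQ D gs v) : CompQ D gs fun x => u x / v x :=
  (hu.mul hv.inv).congr fun _ _ => (div_eq_mul_inv _ _).symm

theorem CompQ.add (hu : CompQ D gs u) (hv : CompQ D gs v) : CompQ D gs fun x => u x + v x := by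
  obtain ⟨p, q, hp, hq, hpq⟩ := hu
  obtain ⟨p', q', hp', hq', hpq'⟩ := hv
  refine ⟨_, _, (hp.mul hq').add (hq.mul hp'), hq.mul hq',
    fun x hx => ⟨mul_ne_zero (hpq x hx).1 (hpq' x hx).1, ?_⟩⟩
  beta_reduce
  rw [(hpq x hx).2, (hpq' x hx).2, div_add_div _ _ (Nat.cast_ne_zero.2 (hpq x hx).1)
    (Nat.cast_ne_zero.2 (hpq' x hx).1)]
  push_cast
  rfl

theorem CompQ.ite {P : X → Prop} [∀ x, Decidable (P x)] (hP : CompPred D gs P)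
    (hu : CompQ (D ∩ {x | P x}) gs u) (hv : CompQ (D ∩ {x | ¬ P x}) gs v) :
    CompQ D gs fun x => if P x then u x else v x := by
  obtain ⟨p, q, hp, hq, hpq⟩ := hu
  obtain ⟨p', q', hp', hq', hpq'⟩ := hv
  refine ⟨_, _, .ite hP hp hp', .ite hP hq hq', fun x hx => ?_⟩
  by_cases h : P x
  · simpa [h] using hpq x ⟨hx, h⟩
  · simpa [h] using hpq' x ⟨hx, h⟩

theorem CompQ.ite' {P : X → Prop} [∀ x, Decidable (P x)] (hP : CompPred D gs P)
    (hu : CompQ D gs u) (hv : CompQ D gs v) : CompQ D gs fun x => if P x then u x else v x :=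
  .ite hP (hu.subset Set.inter_subset_left) (hv.subset Set.inter_subset_left)

theorem CompQ.rangeProd {F : X → ℕ → ℚ≥0} (hn : Comp D gs n) (hnb : PolyBdd D n)
    (hF : CompQ (roundDomain D n) (roundEnv gs) fun y => F y.1 y.2) :
    CompQ D gs fun x => ∏ i ∈ Finset.range (n x), F x i := by
  obtain ⟨p, q, hp, hq, hpq⟩ := hF
  refine ⟨fun x => ∏ i ∈ Finset.range (n x), p (x, i), fun x => ∏ i ∈ Finset.range (n x), q (x, i),
    .rangeProd hn hnb hp, .rangeProd hn hnb hq, fun x hx => ⟨?_, ?_⟩⟩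
  · exact Finset.prod_ne_zero_iff.2 fun i hi => (hpq (x, i) ⟨hx, Finset.mem_range.1 hi⟩).1
  · push_cast
    rw [← Finset.prod_div_distrib]
    exact Finset.prod_congr rfl fun i hi => (hpq (x, i) ⟨hx, Finset.mem_range.1 hi⟩).2

theorem CompQ.rangeSum {F : X → ℕ → ℚ≥0} (hn : Comp D gs n) (hnb : PolyBdd D n)
    (hF : CompQ (roundDomain D n) (roundEnv gs) fun y => F y.1 y.2) :
    CompQ D gs fun x => ∑ i ∈ Finset.range (n x), F x i := by
  obtain ⟨p, q, hp, hq, hpq⟩ := hF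
  -- The product of all denominators serves as common denominator, so loops over natural numbers
  -- suffice.
  have hQ : Comp D gs fun x => ∏ i ∈ Finset.range (n x), q (x, i) := .rangeProd hn hnb hq
  refine ⟨fun x => ∑ i ∈ Finset.range (n x), p (x, i) * ((∏ i ∈ Finset.range (n x), q (x, i)) /
    q (x, i)), fun x => ∏ i ∈ Finset.range (n x), q (x, i),
    .rangeSum hn hnb (hp.mul (hQ.lift.div hq)), hQ, fun x hx => ⟨?_, ?_⟩⟩
  · exact Finset.prod_ne_zero_iff.2 fun i hi => (hpq (x, i) ⟨hx, Finset.mem_range.1 hi⟩).1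
  · have h0 : ∏ i ∈ Finset.range (n x), q (x, i) ≠ 0 :=
      Finset.prod_ne_zero_iff.2 fun i hi => (hpq (x, i) ⟨hx, Finset.mem_range.1 hi⟩).1
    rw [eq_div_iff (Nat.cast_ne_zero.2 h0), Finset.sum_mul, Nat.cast_sum]
    refine Finset.sum_congr rfl fun i hi => ?_
    obtain ⟨h1, h2⟩ := hpq (x, i) ⟨hx, Finset.mem_range.1 hi⟩
    beta_reduce at h2
    rw [h2, Nat.cast_mul, Nat.cast_div (Finset.dvd_prod_of_mem _ hi) (Nat.cast_ne_zero.2 h1),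
      div_mul_eq_mul_div, mul_div_assoc]

theorem Comp.floor (hu : CompQ D gs u) : Comp D gs fun x => ⌊u x⌋₊ := by
  obtain ⟨p, q, hp, hq, hpq⟩ := hu
  exact (hp.div hq).congr fun x hx => by rw [(hpq x hx).2, Nat.floor_div_eq_div]

theorem num_natCast_div (p q : ℕ) (hq : q ≠ 0) :
    ((p : ℚ≥0) / q).num = p / p.gcd q ∧ ((p : ℚ≥0) / q).den = q / p.gcd q := by
  obtain ⟨u, hu⟩ : ∃ u : ℚ≥0, u = p / q := ⟨_, rfl⟩
  rw [← hu]
  have h1 : u.num * q = p * u.den := by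
    have h2 : (p : ℚ≥0) / q = u.num / u.den := hu.symm.trans (NNRat.num_div_den u).symm
    rw [div_eq_div_iff (Nat.cast_ne_zero.2 hq) (Nat.cast_ne_zero.2 u.den_ne_zero)] at h2
    exact_mod_cast h2.symm
  -- Cross multiplication and coprimality make p / q an expansion of the reduced fraction by a
  -- factor `k`, which is then the gcd.
  obtain ⟨k, rfl⟩ : u.den ∣ q := u.coprime_num_den.symm.dvd_of_dvd_mul_left ⟨p, by rw [h1, mul_comm]⟩
  obtain rfl : u.num * k = p := by
    apply Nat.eq_of_mul_eq_mul_right u.den_pos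
    rw [← h1]
    ring
  have hk : 0 < k := Nat.pos_of_ne_zero fun h => hq (by simp [h])
  rw [Nat.gcd_mul_right, u.coprime_num_den, one_mul]
  exact ⟨(Nat.mul_div_cancel _ hk).symm, (Nat.mul_div_cancel _ hk).symm⟩

theorem Comp.num (hu : CompQ D gs u) : Comp D gs fun x => (u x).num := by
  obtain ⟨p, q, hp, hq, hpq⟩ := hu
  exact (hp.div (hp.gcd hq)).congr fun x hx => by
    rw [(hpq x hx).2, (num_natCast_div _ _ (hpq x hx).1).1]

theorem Comp.den (hu : CompQ D gs u) : Comp D gs fun x => (u x).den := by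
  obtain ⟨p, q, hp, hq, hpq⟩ := hu
  exact (hq.div (hp.gcd hq)).congr fun x hx => by
    rw [(hpq x hx).2, (num_natCast_div _ _ (hpq x hx).1).2]

end Rational

end BetaCount

namespace BetaCount

open Function (update)

/-! ### Elimination of variables from weighted constraints -/

section Elimination

variable (N m : ℕ) (vs : ℕ → Finset ℕ) (κ : ℕ → ℕ) (x : ℕ → ℕ)

/-- The sum over the values of the variable `z` of the product of the functions `u j` whose scope
contains `z` and whose rank is less than `t`. -/
def chainSum (u : ℕ → (ℕ → ℕ) → ℚ≥0) (z t : ℕ) (a : ℕ → ℕ) : ℚ≥0 :=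
  ∑ d ∈ Finset.range N, ∏ j ∈ (Finset.range m).filter fun j => z ∈ vs j ∧ κ j < t,
    u j (update a z d)

/-- The functions that remain after the elimination of the first `k` variables `x 0, x 1, …`. -/
def elim (c : ℕ → (ℕ → ℕ) → ℚ≥0) : ℕ → ℕ → (ℕ → ℕ) → ℚ≥0
  | 0 => c
  | k + 1 => fun i a => if x k ∈ vs i then
      chainSum N m vs κ (elim c k) (x k) (κ i + 1) a / chainSum N m vs κ (elim c k) (x k) (κ i) a
    else elim c k i a

/-- The sum over all values of the variables `x 0, …, x (k - 1)`. -/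
def total : ℕ → ((ℕ → ℕ) → ℚ≥0) → (ℕ → ℕ) → ℚ≥0
  | 0, g => g
  | k + 1, g => fun a => ∑ d ∈ Finset.range N, total k g (update a (x k) d)

/-- The variable `z` is not among the first `k` eliminated variables. -/
def Alive (k z : ℕ) : Prop := ∀ k' < k, x k' ≠ z

variable {N m vs κ x}

theorem Alive.of_succ {k z : ℕ} (h : Alive x (k + 1) z) : Alive x k z :=
  fun k' hk' => h k' (hk'.trans k.lt_succ_self)

theorem Alive.succ {k z : ℕ} (h : Alive x k z) (hz : z ≠ x k) : Alive x (k + 1) z := by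
  intro k' hk'
  rcases Nat.lt_succ_iff_lt_or_eq.1 hk' with h' | rfl
  · exact h k' h'
  · exact hz.symm

variable {c u : ℕ → (ℕ → ℕ) → ℚ≥0} {n : ℕ}

theorem elim_succ (k i : ℕ) (a : ℕ → ℕ) : elim N m vs κ x c (k + 1) i a = if x k ∈ vs i then
      chainSum N m vs κ (elim N m vs κ x c k) (x k) (κ i + 1) a /
        chainSum N m vs κ (elim N m vs κ x c k) (x k) (κ i) a
    else elim N m vs κ x c k i a := rfl

theorem total_succ (k : ℕ) (g : (ℕ → ℕ) → ℚ≥0) (a : ℕ → ℕ) :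
    total N x (k + 1) g a = ∑ d ∈ Finset.range N, total N x k g (update a (x k) d) := rfl

theorem chainSum_pos (hN : 0 < N) (hu : ∀ i < m, ∀ a, 0 < u i a) (z t : ℕ) (a : ℕ → ℕ) :
    0 < chainSum N m vs κ u z t a := by
  refine Finset.sum_pos (fun d _ => Finset.prod_pos fun j hj => hu j ?_ _) ⟨0, by simpa⟩
  exact Finset.mem_range.1 (Finset.mem_filter.1 hj).1

theorem elim_pos (hN : 0 < N) (hc : ∀ i < m, ∀ a, 0 < c i a) (k : ℕ) :
    ∀ i < m, ∀ a, 0 < elim N m vs κ x c k i a := by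
  induction k with
  | zero => exact hc
  | succ k ih =>
    intro i hi a
    rw [elim_succ]
    split_ifs
    · exact div_pos (chainSum_pos hN ih _ _ _) (chainSum_pos hN ih _ _ _)
    · exact ih i hi a

/-- For constraints that share the variable `x k`, the remaining scopes are ordered by the rank. -/
def ChainOrder (m : ℕ) (vs : ℕ → Finset ℕ) (κ x : ℕ → ℕ) (n : ℕ) : Prop :=
  ∀ k < n, ∀ i < m, ∀ j < m, x k ∈ vs i → x k ∈ vs j → κ i ≤ κ j →
    ∀ z ∈ vs i, Alive x k z → z ∈ vs j

theorem chainSum_congr {z t : ℕ} {a b : ℕ → ℕ}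
    (h : ∀ j < m, z ∈ vs j → κ j < t → ∀ d < N, u j (update a z d) = u j (update b z d)) :
    chainSum N m vs κ u z t a = chainSum N m vs κ u z t b := by
  refine Finset.sum_congr rfl fun d hd => Finset.prod_congr rfl fun j hj => ?_
  obtain ⟨h1, h2, h3⟩ := Finset.mem_filter.1 hj
  exact h j (Finset.mem_range.1 h1) h2 h3 d (Finset.mem_range.1 hd)

/-- Only functions of rank at most `κ i` enter the two chain sums for `i`. By `ChainOrder` their
remaining scopes lie in that of `i`, and the variable `x k` is overwritten by the summation. -/
theorem elim_local (hch : ChainOrder m vs κ x n)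
    (hc : ∀ i < m, ∀ a b : ℕ → ℕ, (∀ z ∈ vs i, a z = b z) → c i a = c i b) :
    ∀ k ≤ n, ∀ i < m, ∀ a b : ℕ → ℕ, (∀ z ∈ vs i, Alive x k z → a z = b z) →
      elim N m vs κ x c k i a = elim N m vs κ x c k i b := by
  intro k
  induction k with
  | zero => exact fun _ i hi a b h => hc i hi a b fun z hz => h z hz fun k' hk' => by omega
  | succ k ih =>
    intro hk i hi a b h
    rw [elim_succ, elim_succ]
    have key : ∀ t ≤ κ i + 1, x k ∈ vs i → chainSum N m vs κ (elim N m vs κ x c k) (x k) t a =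
        chainSum N m vs κ (elim N m vs κ x c k) (x k) t b := by
      intro t ht hxi
      refine chainSum_congr fun j hj hxj hjt d _ => ih (by omega) j hj _ _ fun z hz hza => ?_
      by_cases hzk : z = x k
      · simp [hzk]
      · rw [Function.update_of_ne hzk, Function.update_of_ne hzk]
        exact h z (hch k (by omega) j hj i hi hxj hxi (by omega) z hz hza) (hza.succ hzk)
    split_ifs with hx
    · rw [key _ le_rfl hx, key _ (by omega) hx]
    · refine ih (by omega) i hi a b fun z hz hza => h z hz (hza.succ ?_)
      rintro rfl
      exact hx hz

theorem filter_lt_succ_of_forall {p : ℕ → Prop} [DecidablePred p] {t : ℕ}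
    (h : ∀ j < m, p j → κ j ≠ t) :
    (Finset.range m).filter (fun j => p j ∧ κ j < t + 1) =
      (Finset.range m).filter fun j => p j ∧ κ j < t := by
  refine Finset.filter_congr fun j hj => and_congr_right fun hp => ?_
  have := h j (Finset.mem_range.1 hj) hp
  omega

theorem filter_lt_succ_of_eq {p : ℕ → Prop} [DecidablePred p] {i : ℕ}
    (hκ : Set.InjOn κ (Set.Iio m)) (hi : i < m) (hp : p i) :
    (Finset.range m).filter (fun j => p j ∧ κ j < κ i + 1) =
      insert i ((Finset.range m).filter fun j => p j ∧ κ j < κ i) := by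
  ext j
  simp only [Finset.mem_filter, Finset.mem_range, Finset.mem_insert]
  constructor
  · rintro ⟨h1, h2, h3⟩
    rcases Nat.lt_succ_iff_lt_or_eq.1 h3 with h | h
    · exact .inr ⟨h1, h2, h⟩
    · exact .inl (hκ h1 hi h)
  · rintro (rfl | ⟨h1, h2, h3⟩)
    · exact ⟨hi, hp, by omega⟩
    · exact ⟨h1, h2, by omega⟩

/-- The mismatch with each row is at a surviving variable, so it persists for every value of `x k`.
By induction the factor of `i` is then δ in every summand; it comes out of the numerator and leaves
the denominator. -/
theorem elim_default (hκ : Set.InjOn κ (Set.Iio m)) (hN : 0 < N) (hc0 : ∀ i < m, ∀ a, 0 < c i a)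
    {i : ℕ} (hi : i < m) {rows : Set (ℕ → ℕ)} {δ : ℚ≥0}
    (hc : ∀ a : ℕ → ℕ, (∀ r ∈ rows, ∃ z ∈ vs i, r z ≠ a z) → c i a = δ) :
    ∀ k, ∀ a : ℕ → ℕ, (∀ r ∈ rows, ∃ z ∈ vs i, Alive x k z ∧ r z ≠ a z) →
      elim N m vs κ x c k i a = δ := by
  intro k
  induction k with
  | zero =>
    intro a ha
    refine hc a fun r hr => ?_
    obtain ⟨z, h1, -, h2⟩ := ha r hr
    exact ⟨z, h1, h2⟩
  | succ k ih =>
    intro a ha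
    rw [elim_succ]
    split_ifs with hx
    · have hpos := chainSum_pos (vs := vs) (κ := κ) hN (elim_pos (vs := vs) (κ := κ) (x := x) hN hc0 k)
        (x k) (κ i) a
      rw [div_eq_iff hpos.ne', chainSum, chainSum, Finset.mul_sum]
      refine Finset.sum_congr rfl fun d _ => ?_
      rw [filter_lt_succ_of_eq (p := fun j => x k ∈ vs j) hκ hi hx,
        Finset.prod_insert (by simp), ih]
      intro r hr
      obtain ⟨z, h1, h2, h3⟩ := ha r hr
      refine ⟨z, h1, h2.of_succ, ?_⟩
      rwa [Function.update_of_ne (h2 k k.lt_succ_self).symm]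
    · refine ih a fun r hr => ?_
      obtain ⟨z, h1, h2, h3⟩ := ha r hr
      exact ⟨z, h1, h2.of_succ, h3⟩

/-- The quotients telescope: the denominator for `i` is the numerator of its predecessor in the
chain. The factor `N` is the chain sum of the empty product. -/
theorem prod_elim_succ_chain (hκ : Set.InjOn κ (Set.Iio m)) (hN : 0 < N)
    (hc0 : ∀ i < m, ∀ a, 0 < c i a) (k t : ℕ) (a : ℕ → ℕ) :
    N * ∏ j ∈ (Finset.range m).filter (fun j => x k ∈ vs j ∧ κ j < t),
      elim N m vs κ x c (k + 1) j a = chainSum N m vs κ (elim N m vs κ x c k) (x k) t a := by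
  induction t with
  | zero => simp [chainSum]
  | succ t ih =>
    by_cases h : ∃ i < m, x k ∈ vs i ∧ κ i = t
    · obtain ⟨i, hi, hx, rfl⟩ := h
      rw [filter_lt_succ_of_eq (p := fun j => x k ∈ vs j) hκ hi hx,
        Finset.prod_insert (by simp), mul_left_comm, ih, elim_succ, if_pos hx, div_mul_cancel₀]
      exact (chainSum_pos hN (elim_pos hN hc0 k) _ _ _).ne'
    · have h' : ∀ j < m, x k ∈ vs j → κ j ≠ t := fun j hj hx e => h ⟨j, hj, hx, e⟩
      rw [filter_lt_succ_of_forall h', ih, chainSum, chainSum, filter_lt_succ_of_forall h']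

/-- The functions whose scope misses `x k` do not feel the update and factor out of the sum; the
rest is the telescoping product. -/
theorem prod_elim_succ (hκ : Set.InjOn κ (Set.Iio m)) (hN : 0 < N)
    (hc0 : ∀ i < m, ∀ a, 0 < c i a) (hch : ChainOrder m vs κ x n)
    (hc : ∀ i < m, ∀ a b : ℕ → ℕ, (∀ z ∈ vs i, a z = b z) → c i a = c i b) {k : ℕ} (hk : k < n)
    (t : ℕ) (a : ℕ → ℕ) :
    N * ∏ j ∈ (Finset.range m).filter (fun j => κ j < t), elim N m vs κ x c (k + 1) j a =
      ∑ d ∈ Finset.range N, ∏ j ∈ (Finset.range m).filter (fun j => κ j < t),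
        elim N m vs κ x c k j (update a (x k) d) := by
  have split : ∀ g : ℕ → ℚ≥0, ∏ j ∈ (Finset.range m).filter (fun j => κ j < t), g j =
      (∏ j ∈ (Finset.range m).filter (fun j => x k ∈ vs j ∧ κ j < t), g j) *
        ∏ j ∈ (Finset.range m).filter (fun j => x k ∉ vs j ∧ κ j < t), g j := by
    intro g
    rw [← Finset.prod_filter_mul_prod_filter_not _ (fun j => x k ∈ vs j), Finset.filter_filter,
      Finset.filter_filter]
    simp only [and_comm]
  rw [split, ← mul_assoc, prod_elim_succ_chain hκ hN hc0, chainSum, Finset.sum_mul]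
  refine Finset.sum_congr rfl fun d _ => ?_
  rw [split]
  congr 1
  refine Finset.prod_congr rfl fun j hj => ?_
  obtain ⟨h1, h2, -⟩ := Finset.mem_filter.1 hj
  rw [elim_succ, if_neg h2]
  refine elim_local hch hc k hk.le j (Finset.mem_range.1 h1) _ _ fun z hz _ => ?_
  rw [Function.update_of_ne]
  rintro rfl
  exact h2 hz

/-- The identity is needed for every threshold `t`, not only for the full product: consecutive
thresholds isolate a single function. This works because the ranking `κ` is the same in all steps.
-/
theorem total_eq (hκ : Set.InjOn κ (Set.Iio m)) (hc0 : ∀ i < m, ∀ a, 0 < c i a)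
    (hch : ChainOrder m vs κ x n)
    (hc : ∀ i < m, ∀ a b : ℕ → ℕ, (∀ z ∈ vs i, a z = b z) → c i a = c i b) (t : ℕ) :
    ∀ k ≤ n, ∀ a, total N x k
        (fun a => ∏ j ∈ (Finset.range m).filter (fun j => κ j < t), c j a) a =
      N ^ k * ∏ j ∈ (Finset.range m).filter (fun j => κ j < t), elim N m vs κ x c k j a := by
  intro k
  induction k with
  | zero => intro _ a; simp [total, elim]
  | succ k ih =>
    intro hk a
    rcases Nat.eq_zero_or_pos N with rfl | hN
    · simp [total]
    rw [total_succ, Finset.sum_congr rfl fun d _ => ih (by omega) _, ← Finset.mul_sum,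
      ← prod_elim_succ hκ hN hc0 hch hc (by omega), pow_succ, mul_assoc]

/-! ### Numerators and denominators of the eliminated functions. -/

theorem total_natCast (G : (ℕ → ℕ) → ℕ) (B : ℕ) (hG : ∀ a, 0 < G a ∧ G a ≤ B) (hN : 0 < N) (k : ℕ) :
    ∀ a, ∃ T : ℕ, total N x k (fun a => (G a : ℚ≥0)) a = T ∧ 0 < T ∧ T ≤ N ^ k * B := by
  induction k with
  | zero => exact fun a => ⟨G a, rfl, by simpa using hG a⟩
  | succ k ih =>
    intro a
    choose T h1 h2 h3 using ih
    refine ⟨∑ d ∈ Finset.range N, T (update a (x k) d), ?_, ?_, ?_⟩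
    · simp [total, h1]
    · exact Finset.sum_pos (fun d _ => h2 _) ⟨0, by simpa⟩
    · refine (Finset.sum_le_card_nsmul _ _ _ fun d _ => h3 _).trans ?_
      rw [Finset.card_range, smul_eq_mul, pow_succ]
      exact le_of_eq (by ring)

theorem num_le_den_le_of_eq {u : ℚ≥0} {p q B : ℕ} (hu : u = p / q) (hq : 0 < q) (hpB : p ≤ B)
    (hqB : q ≤ B) : u.num ≤ B ∧ u.den ≤ B := by
  obtain ⟨h1, h2⟩ := num_natCast_div p q hq.ne'
  rw [hu, h1, h2]
  exact ⟨(Nat.div_le_self _ _).trans hpB, (Nat.div_le_self _ _).trans hqB⟩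

/-- By `total_eq`, the function is the quotient of the totals for the thresholds `κ i + 1` and `κ
i`. Both are positive integers at most `N ^ k * B ^ m`, and reduction to lowest terms only shrinks
them. Unfolding the recursion would not give such a bound. -/
theorem elim_num_den_le (hκ : Set.InjOn κ (Set.Iio m)) (hN : 0 < N) (hch : ChainOrder m vs κ x n)
    (hc : ∀ i < m, ∀ a b : ℕ → ℕ, (∀ z ∈ vs i, a z = b z) → c i a = c i b) (G : ℕ → (ℕ → ℕ) → ℕ)
    {B : ℕ} (hG : ∀ i < m, ∀ a, c i a = G i a ∧ 0 < G i a ∧ G i a ≤ B) {k : ℕ} (hk : k ≤ n) {i : ℕ}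
    (hi : i < m) (a : ℕ → ℕ) :
    (elim N m vs κ x c k i a).num ≤ N ^ k * B ^ m ∧
      (elim N m vs κ x c k i a).den ≤ N ^ k * B ^ m := by
  have hc0 : ∀ i < m, ∀ a, 0 < c i a := fun i hi a => by
    rw [(hG i hi a).1]
    exact Nat.cast_pos.2 (hG i hi a).2.1
  have hB : 1 ≤ B := (hG i hi a).2.1.trans_le (hG i hi a).2.2
  have hprod : ∀ t a, 0 < ∏ j ∈ (Finset.range m).filter (fun j => κ j < t), G j a ∧
      ∏ j ∈ (Finset.range m).filter (fun j => κ j < t), G j a ≤ B ^ m := by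
    intro t a
    constructor
    · exact Finset.prod_pos fun j hj => (hG j (Finset.mem_range.1 (Finset.mem_filter.1 hj).1) a).2.1
    · refine (Finset.prod_le_pow_card _ _ B fun j hj =>
        (hG j (Finset.mem_range.1 (Finset.mem_filter.1 hj).1) a).2.2).trans ?_
      exact Nat.pow_le_pow_right hB ((Finset.card_filter_le _ _).trans (by simp))
  have hcast : ∀ t, (fun a => ((∏ j ∈ (Finset.range m).filter (fun j => κ j < t), G j a : ℕ) : ℚ≥0)) =
      fun a => ∏ j ∈ (Finset.range m).filter (fun j => κ j < t), c j a := by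
    intro t
    ext1 a
    rw [Nat.cast_prod]
    exact Finset.prod_congr rfl fun j hj =>
      (hG j (Finset.mem_range.1 (Finset.mem_filter.1 hj).1) a).1.symm
  obtain ⟨T, t1, t2, t3⟩ := total_natCast (x := x) _ _ (hprod (κ i + 1)) hN k a
  obtain ⟨T', t1', t2', t3'⟩ := total_natCast (x := x) _ _ (hprod (κ i)) hN k a
  refine num_le_den_le_of_eq (p := T) (q := T') ?_ t2' t3 t3'
  rw [← t1, ← t1', hcast, hcast, total_eq hκ hc0 hch hc _ k hk, total_eq hκ hc0 hch hc _ k hk]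
  have hsplit : (Finset.range m).filter (fun j => κ j < κ i + 1) =
      insert i ((Finset.range m).filter fun j => κ j < κ i) := by
    simpa using filter_lt_succ_of_eq (p := fun _ => True) hκ hi trivial
  rw [hsplit, Finset.prod_insert (by simp), mul_left_comm, mul_div_assoc, div_self, mul_one]
  refine mul_ne_zero (pow_ne_zero _ (Nat.cast_ne_zero.2 hN.ne')) (Finset.prod_ne_zero_iff.2 ?_)
  exact fun j hj => (elim_pos hN hc0 k j (Finset.mem_range.1 (Finset.mem_filter.1 hj).1) a).ne'

end Elimination

end BetaCount

namespace BetaCount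

open Function (update)

/-! ### Weighted constraints as tables -/

/-- Tables of weighted constraints with natural numbers as weights: the domain is `{0, …, N - 1}`,
the constraint `i < m` has the variables `var i t` for `t < nv i`, the rows `r < nr i` with the
entries `cell i r t` and the weight `wt i r`, and the default value `df i`. The values that occur in
the rows are among the numbers `val p` for `p < P`. -/
structure Tables where
  N : ℕ
  m : ℕ
  P : ℕ
  val : ℕ → ℕ
  nv : ℕ → ℕ
  nr : ℕ → ℕ
  var : ℕ → ℕ → ℕ
  cell : ℕ → ℕ → ℕ → ℕ
  wt : ℕ → ℕ → ℕ
  df : ℕ → ℕ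

/-- The properties of tables that come from instances, with a bound for the weights. -/
structure Tables.Valid (T : Tables) (B : ℕ) : Prop where
  var_inj : ∀ i < T.m, ∀ t < T.nv i, ∀ t' < T.nv i, T.var i t = T.var i t' → t = t'
  row_inj : ∀ i < T.m, ∀ r < T.nr i, ∀ r' < T.nr i,
    (∀ t < T.nv i, T.cell i r t = T.cell i r' t) → r = r'
  cell_lt : ∀ i < T.m, ∀ r < T.nr i, ∀ t < T.nv i, T.cell i r t < T.N
  cell_val : ∀ i < T.m, ∀ r < T.nr i, ∀ t < T.nv i, ∃ p < T.P, T.val p = T.cell i r t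
  wt_pos : ∀ i < T.m, ∀ r < T.nr i, 0 < T.wt i r
  df_pos : ∀ i < T.m, 0 < T.df i
  wt_le : ∀ i < T.m, ∀ r < T.nr i, T.wt i r ≤ B
  df_le : ∀ i < T.m, T.df i ≤ B

namespace Tables

variable (T : Tables) (κ x : ℕ → ℕ)

/-- The set of variables of a constraint. -/
def scope (i : ℕ) : Finset ℕ := (Finset.range (T.nv i)).image (T.var i)

/-- The assignment in row `r` of constraint `i`. -/
def row (i r z : ℕ) : ℕ := ∑ t ∈ Finset.range (T.nv i), if T.var i t = z then T.cell i r t else 0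

open Classical in
/-- One plus the index of a row that agrees with `a` on the variables in `A`, zero if there is
none. -/
noncomputable def findRow (A : ℕ → Prop) (i : ℕ) (a : ℕ → ℕ) : ℕ :=
  (Finset.range (T.nr i)).sup fun r =>
    if ∀ t < T.nv i, A (T.var i t) → T.cell i r t = a (T.var i t) then r + 1 else 0

/-- The entry of `v` for the row found by `findRow`, or the default value. -/
noncomputable def look {R : Type} [NatCast R] (v : ℕ → ℕ → R) (A : ℕ → Prop) (i : ℕ) (a : ℕ → ℕ) :
    R :=
  if T.findRow A i a = 0 then (T.df i : R) else v i (T.findRow A i a - 1)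

/-- The weight function of a constraint. -/
noncomputable def weight (i : ℕ) (a : ℕ → ℕ) : ℕ := T.look T.wt (fun _ => True) i a

/-- The number `val p` is an element of the domain that has not been listed before. -/
def NewVal (p : ℕ) : Prop := T.val p < T.N ∧ ∀ p' < p, T.val p' ≠ T.val p

open Classical in
/-- The number of domain elements that are listed. -/
noncomputable def numVals : ℕ := ∑ p ∈ Finset.range T.P, if T.NewVal p then 1 else 0

open Classical in
/-- The sum of a function over the domain, if the function is constant on the values that are not
listed. -/
noncomputable def domSum (g : ℕ → ℚ≥0) : ℚ≥0 :=
  (∑ p ∈ Finset.range T.P, if T.NewVal p then g (T.val p) else 0) + (T.N - T.numVals : ℕ) * g T.N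

open Classical in
/-- The evaluation of `chainSum` from a table. -/
noncomputable def tableSum (v : ℕ → ℕ → ℚ≥0) (A : ℕ → Prop) (z t : ℕ) (a : ℕ → ℕ) : ℚ≥0 :=
  T.domSum fun d => ∏ j ∈ Finset.range T.m,
    if z ∈ T.scope j ∧ κ j < t then T.look v A j (update a z d) else 1

/-- The weights of the rows after the elimination of `k` variables. -/
noncomputable def table : ℕ → ℕ → ℕ → ℚ≥0
  | 0 => fun i r => T.wt i r
  | k + 1 => fun i r => if x k ∈ T.scope i then
      T.tableSum κ (table k) (Alive x k) (x k) (κ i + 1) (T.row i r) /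
        T.tableSum κ (table k) (Alive x k) (x k) (κ i) (T.row i r)
    else table k i r

variable {T κ x} {B : ℕ}

theorem mem_scope {i z : ℕ} : z ∈ T.scope i ↔ ∃ t < T.nv i, T.var i t = z := by
  simp [scope]

theorem Valid.row_var (hT : T.Valid B) {i : ℕ} (hi : i < T.m) (r : ℕ) {t : ℕ} (ht : t < T.nv i) :
    T.row i r (T.var i t) = T.cell i r t := by
  rw [row, Finset.sum_eq_single t]
  · simp
  · intro t' ht' hne
    rw [if_neg]
    exact fun h => hne (hT.var_inj i hi t' (Finset.mem_range.1 ht') t ht h)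
  · simp [ht]

theorem findRow_spec (A : ℕ → Prop) (i : ℕ) (a : ℕ → ℕ) :
    (T.findRow A i a = 0 ∧ ∀ r < T.nr i, ∃ t < T.nv i, A (T.var i t) ∧ T.cell i r t ≠ a (T.var i t)) ∨
      ∃ r < T.nr i, T.findRow A i a = r + 1 ∧
        ∀ t < T.nv i, A (T.var i t) → T.cell i r t = a (T.var i t) := by
  classical
  rcases (Finset.range (T.nr i)).eq_empty_or_nonempty with he | he
  · refine .inl ⟨by simp [findRow, he], fun r hr => ?_⟩
    have := Finset.mem_range.2 hr
    simp [he] at this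
  obtain ⟨r, hr, hr'⟩ := Finset.exists_mem_eq_sup _ he fun r =>
    if ∀ t < T.nv i, A (T.var i t) → T.cell i r t = a (T.var i t) then r + 1 else 0
  rw [Finset.mem_range] at hr
  by_cases h : ∀ t < T.nv i, A (T.var i t) → T.cell i r t = a (T.var i t)
  · rw [if_pos h] at hr'
    exact .inr ⟨r, hr, hr', h⟩
  · rw [if_neg h] at hr'
    refine .inl ⟨hr', fun r' hr'' => ?_⟩
    have := (Finset.sup_eq_bot_iff _ _).1 hr' r' (Finset.mem_range.2 hr'')
    by_contra hcon
    push Not at hcon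
    rw [if_pos hcon] at this
    simp at this

theorem findRow_congr {A : ℕ → Prop} {i : ℕ} {a b : ℕ → ℕ}
    (h : ∀ z ∈ T.scope i, A z → a z = b z) : T.findRow A i a = T.findRow A i b := by
  unfold findRow
  refine Finset.sup_congr rfl fun r _ => ?_
  have : (∀ t < T.nv i, A (T.var i t) → T.cell i r t = a (T.var i t)) ↔
      ∀ t < T.nv i, A (T.var i t) → T.cell i r t = b (T.var i t) :=
    forall₃_congr fun t ht hA => by rw [h _ (mem_scope.2 ⟨t, ht, rfl⟩) hA]
  by_cases hb : ∀ t < T.nv i, A (T.var i t) → T.cell i r t = b (T.var i t)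
  · rw [if_pos (this.2 hb), if_pos hb]
  · rw [if_neg (mt this.1 hb), if_neg hb]

theorem weight_congr {i : ℕ} {a b : ℕ → ℕ} (h : ∀ z ∈ T.scope i, a z = b z) :
    T.weight i a = T.weight i b := by
  unfold weight look
  rw [findRow_congr fun z hz _ => h z hz]

theorem Valid.weight_bounds (hT : T.Valid B) {i : ℕ} (hi : i < T.m) (a : ℕ → ℕ) :
    0 < T.weight i a ∧ T.weight i a ≤ B := by
  unfold weight look
  rcases T.findRow_spec (fun _ => True) i a with ⟨h, -⟩ | ⟨r, hr, h, -⟩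
  · rw [if_pos h]
    exact ⟨hT.df_pos i hi, hT.df_le i hi⟩
  · rw [h, if_neg (by simp)]
    exact ⟨hT.wt_pos i hi r hr, hT.wt_le i hi r hr⟩

theorem Valid.weight_row (hT : T.Valid B) {i r : ℕ} (hi : i < T.m) (hr : r < T.nr i) {a : ℕ → ℕ}
    (ha : ∀ t < T.nv i, T.cell i r t = a (T.var i t)) : T.weight i a = T.wt i r := by
  unfold weight look
  rcases T.findRow_spec (fun _ => True) i a with ⟨-, h⟩ | ⟨r', hr', h, h'⟩
  · obtain ⟨t, ht, -, hne⟩ := h r hr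
    exact absurd (ha t ht) hne
  · rw [h, if_neg (by simp), Nat.add_sub_cancel,
      hT.row_inj i hi r hr r' hr' fun t ht => (ha t ht).trans (h' t ht trivial).symm]

theorem weight_default {i : ℕ} {a : ℕ → ℕ}
    (h : ∀ r < T.nr i, ∃ t < T.nv i, T.cell i r t ≠ a (T.var i t)) : T.weight i a = T.df i := by
  unfold weight look
  rcases T.findRow_spec (fun _ => True) i a with ⟨h, -⟩ | ⟨r, hr, -, h'⟩
  · rw [if_pos h]
    rfl
  · obtain ⟨t, ht, hne⟩ := h r hr
    exact absurd (h' t ht trivial) hne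

/-- `NewVal` selects the first position of each domain element that is listed, so every listed
element is counted once. The number `T.N` lies outside the domain and represents all unlisted
elements. -/
theorem domSum_eq {g : ℕ → ℚ≥0} (hg : ∀ d < T.N, (∀ p < T.P, T.val p ≠ d) → g d = g T.N) :
    T.domSum g = ∑ d ∈ Finset.range T.N, g d := by
  classical
  set F := (Finset.range T.P).filter T.NewVal with hF
  have hinj : Set.InjOn T.val F := by
    intro p hp p' hp' h
    obtain ⟨-, -, h1⟩ := Finset.mem_filter.1 (Finset.mem_coe.1 hp)
    obtain ⟨-, -, h2⟩ := Finset.mem_filter.1 (Finset.mem_coe.1 hp')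
    rcases lt_trichotomy p p' with hlt | heq | hlt
    · exact absurd h (h2 p hlt)
    · exact heq
    · exact absurd h.symm (h1 p' hlt)
  have hmem : ∀ d, d ∈ F.image T.val ↔ d < T.N ∧ ∃ p < T.P, T.val p = d := by
    intro d
    simp only [Finset.mem_image, hF, Finset.mem_filter, Finset.mem_range, NewVal]
    constructor
    · rintro ⟨p, ⟨h1, h2, -⟩, rfl⟩
      exact ⟨h2, p, h1, rfl⟩
    · rintro ⟨h1, h2⟩
      have hfind := Nat.find_spec h2
      refine ⟨Nat.find h2, ⟨hfind.1, by rw [hfind.2]; exact h1, fun p' hp' he => ?_⟩, hfind.2⟩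
      exact Nat.find_min h2 hp' ⟨hp'.trans hfind.1, he.trans hfind.2⟩
  have hsub : F.image T.val ⊆ Finset.range T.N := fun d hd => Finset.mem_range.2 ((hmem d).1 hd).1
  have hcard : T.numVals = (F.image T.val).card := by
    rw [Finset.card_image_of_injOn hinj, numVals, ← Finset.sum_filter, Finset.card_eq_sum_ones]
  rw [domSum, ← Finset.sum_filter, ← hF, ← Finset.sum_image hinj, hcard,
    ← Finset.sum_sdiff hsub, add_comm]
  congr 1
  rw [Finset.sum_congr rfl fun d hd => ?_, Finset.sum_const, Finset.card_sdiff_of_subset hsub,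
    Finset.card_range, nsmul_eq_mul]
  obtain ⟨h1, h2⟩ := Finset.mem_sdiff.1 hd
  have h1' := Finset.mem_range.1 h1
  exact hg d h1' fun p hp hpd => h2 ((hmem d).2 ⟨h1', p, hp, hpd⟩)

/-- The functions that the tables represent after the elimination of variables. -/
noncomputable abbrev elim (T : Tables) (κ x : ℕ → ℕ) : ℕ → ℕ → (ℕ → ℕ) → ℚ≥0 :=
  BetaCount.elim T.N T.m T.scope κ x fun i a => T.weight i a

variable {n : ℕ}

theorem elim_congr (hch : ChainOrder T.m T.scope κ x n) {k : ℕ} (hk : k ≤ n) {i : ℕ} (hi : i < T.m)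
    {a b : ℕ → ℕ} (h : ∀ z ∈ T.scope i, Alive x k z → a z = b z) :
    T.elim κ x k i a = T.elim κ x k i b :=
  elim_local hch (fun _ _ _ _ h => by rw [weight_congr h]) k hk i hi a b h

theorem Valid.elim_default (hT : T.Valid B) (hκ : Set.InjOn κ (Set.Iio T.m)) (hN : 0 < T.N) {i : ℕ}
    (hi : i < T.m) {k : ℕ} {a : ℕ → ℕ}
    (h : ∀ r < T.nr i, ∃ t < T.nv i, Alive x k (T.var i t) ∧ T.cell i r t ≠ a (T.var i t)) :
    T.elim κ x k i a = T.df i := by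
  refine BetaCount.elim_default hκ hN
    (fun _ hj a => Nat.cast_pos.2 (hT.weight_bounds hj a).1) hi
    (rows := T.row i '' Set.Iio (T.nr i)) (fun b hb => ?_) k a ?_
  · rw [weight_default]
    intro r hr
    obtain ⟨z, hz, hne⟩ := hb _ ⟨r, hr, rfl⟩
    obtain ⟨t, ht, rfl⟩ := mem_scope.1 hz
    exact ⟨t, ht, by rwa [hT.row_var hi r ht] at hne⟩
  · rintro _ ⟨r, hr, rfl⟩
    obtain ⟨t, ht, h1, h2⟩ := h r hr
    exact ⟨_, mem_scope.2 ⟨t, ht, rfl⟩, h1, by rwa [hT.row_var hi r ht]⟩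

/-- Several rows may agree with `a` on the surviving variables. It does not matter which one is
found, because the function depends on those variables only. -/
theorem Valid.look_eq_elim (hT : T.Valid B) (hκ : Set.InjOn κ (Set.Iio T.m)) (hN : 0 < T.N)
    (hch : ChainOrder T.m T.scope κ x n) {k : ℕ} (hk : k ≤ n) {v : ℕ → ℕ → ℚ≥0} {i : ℕ} (hi : i < T.m)
    (hv : ∀ r < T.nr i, v i r = T.elim κ x k i (T.row i r)) (a : ℕ → ℕ) :
    T.look v (Alive x k) i a = T.elim κ x k i a := by
  unfold look
  rcases T.findRow_spec (Alive x k) i a with ⟨h, h'⟩ | ⟨r, hr, h, h'⟩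
  · rw [if_pos h, hT.elim_default hκ hN hi h']
  · rw [h, if_neg (by simp), Nat.add_sub_cancel, hv r hr]
    refine elim_congr hch hk hi fun z hz hza => ?_
    obtain ⟨t, ht, rfl⟩ := mem_scope.1 hz
    rw [hT.row_var hi r ht]
    exact h' t ht hza

theorem Valid.tableSum_eq (hT : T.Valid B) (hκ : Set.InjOn κ (Set.Iio T.m)) (hN : 0 < T.N)
    (hch : ChainOrder T.m T.scope κ x n) {k : ℕ} (hk : k < n) {v : ℕ → ℕ → ℚ≥0}
    (hv : ∀ i < T.m, ∀ r < T.nr i, v i r = T.elim κ x k i (T.row i r)) (hx : Alive x k (x k))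
    (t : ℕ) (a : ℕ → ℕ) :
    T.tableSum κ v (Alive x k) (x k) t a =
      chainSum T.N T.m T.scope κ (T.elim κ x k) (x k) t a := by
  classical
  have key : ∀ d, (∏ j ∈ Finset.range T.m, if x k ∈ T.scope j ∧ κ j < t then
      T.look v (Alive x k) j (update a (x k) d) else 1) =
      ∏ j ∈ (Finset.range T.m).filter fun j => x k ∈ T.scope j ∧ κ j < t,
        T.elim κ x k j (update a (x k) d) := by
    intro d
    rw [Finset.prod_filter]
    refine Finset.prod_congr rfl fun j hj => ?_
    have hj' := Finset.mem_range.1 hj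
    rw [hT.look_eq_elim hκ hN hch hk.le hj' (hv j hj')]
  rw [tableSum, chainSum, domSum_eq]
  · exact Finset.sum_congr rfl fun d _ => by convert key d
  · intro d hd hdv
    -- The condition on `e` covers both an unlisted element of the domain and `T.N`. No row has such
    -- an entry at `x k`, so every constraint containing `x k` takes its default value.
    have h1 : ∀ e, (∀ p < T.P, T.val p = e → T.N ≤ e) → ∀ j < T.m, x k ∈ T.scope j →
        T.elim κ x k j (update a (x k) e) = T.df j := by
      intro e he j hj hxj
      refine hT.elim_default hκ hN hj fun r hr => ?_
      obtain ⟨s, hs, hsx⟩ := mem_scope.1 hxj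
      refine ⟨s, hs, hsx ▸ hx, fun heq => ?_⟩
      rw [hsx, Function.update_self] at heq
      obtain ⟨p, hp, hpv⟩ := hT.cell_val j hj r hr s hs
      have := he p hp (hpv.trans heq)
      have := hT.cell_lt j hj r hr s hs
      omega
    have h2 := h1 d fun p hp hpd => absurd hpd (hdv p hp)
    have h3 := h1 T.N fun p hp hpd => le_rfl
    convert (key d).trans (Eq.trans ?_ (key T.N).symm)
    refine Finset.prod_congr rfl fun j hj => ?_
    obtain ⟨hj1, hj2, -⟩ := Finset.mem_filter.1 hj
    rw [h2 j (Finset.mem_range.1 hj1) hj2, h3 j (Finset.mem_range.1 hj1) hj2]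

theorem table_succ (k i r : ℕ) : T.table κ x (k + 1) i r = if x k ∈ T.scope i then
      T.tableSum κ (T.table κ x k) (Alive x k) (x k) (κ i + 1) (T.row i r) /
        T.tableSum κ (T.table κ x k) (Alive x k) (x k) (κ i) (T.row i r)
    else T.table κ x k i r := rfl

theorem Valid.table_eq (hT : T.Valid B) (hκ : Set.InjOn κ (Set.Iio T.m)) (hN : 0 < T.N)
    (hch : ChainOrder T.m T.scope κ x n) (hx : ∀ k < n, Alive x k (x k)) :
    ∀ k ≤ n, ∀ i < T.m, ∀ r < T.nr i, T.table κ x k i r = T.elim κ x k i (T.row i r) := by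
  intro k
  induction k with
  | zero =>
    intro _ i hi r hr
    change (T.wt i r : ℚ≥0) = T.weight i (T.row i r)
    rw [hT.weight_row hi hr fun t ht => (hT.row_var hi r ht).symm]
  | succ k ih =>
    intro hk i hi r hr
    have ih' := ih (by omega)
    refine (table_succ k i r).trans (Eq.trans ?_ (elim_succ k i _).symm)
    rw [hT.tableSum_eq hκ hN hch hk ih' (hx k hk),
      hT.tableSum_eq hκ hN hch hk ih' (hx k hk), ih' i hi r hr]

theorem Valid.table_num_den_le (hT : T.Valid B) (hκ : Set.InjOn κ (Set.Iio T.m))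
    (hch : ChainOrder T.m T.scope κ x n) (hx : ∀ k < n, Alive x k (x k)) {k : ℕ} (hk : k ≤ n) {i r : ℕ}
    (hi : i < T.m) (hr : r < T.nr i) :
    (T.table κ x k i r).num ≤ (T.N + 1) ^ k * B ^ T.m ∧
      (T.table κ x k i r).den ≤ (T.N + 1) ^ k * B ^ T.m := by
  rcases Nat.eq_zero_or_pos T.N with hN | hN
  -- Over the empty domain, a constraint with a row has no variables and is never changed. The bound
  -- has `N + 1` in place of `N` because `N ^ k` would vanish here.
  · have hnv : T.nv i = 0 := by
      by_contra h
      have := hT.cell_lt i hi r hr 0 (Nat.pos_of_ne_zero h)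
      omega
    have h0 : T.table κ x k i r = T.wt i r := by
      clear hk
      induction k with
      | zero => rfl
      | succ k ih => rw [table_succ, if_neg (by simp [mem_scope, hnv]), ih]
    have hB : 1 ≤ B := (hT.wt_pos i hi r hr).trans_le (hT.wt_le i hi r hr)
    have h1 : B ≤ B ^ T.m := Nat.le_self_pow (by omega) B
    rw [h0, hN, zero_add, one_pow, one_mul]
    exact ⟨(hT.wt_le i hi r hr).trans h1, hB.trans h1⟩
  · rw [hT.table_eq hκ hN hch hx k hk i hi r hr]
    obtain ⟨h1, h2⟩ := elim_num_den_le hκ hN hch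
      (fun _ _ _ _ h => by rw [weight_congr h]) T.weight
      (fun i hi a => ⟨rfl, hT.weight_bounds hi a⟩) hk hi (T.row i r)
    have h3 : T.N ^ k * B ^ T.m ≤ (T.N + 1) ^ k * B ^ T.m :=
      Nat.mul_le_mul_right _ (Nat.pow_le_pow_left (Nat.le_succ _) _)
    exact ⟨h1.trans h3, h2.trans h3⟩

/-- The partition function from the final tables. -/
theorem Valid.total_eq (hT : T.Valid B) (hκ : Set.InjOn κ (Set.Iio T.m))
    (hch : ChainOrder T.m T.scope κ x n) (hx : ∀ k < n, Alive x k (x k)) (a : ℕ → ℕ) :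
    total T.N x n (fun a => ∏ i ∈ Finset.range T.m, (T.weight i a : ℚ≥0)) a =
      T.N ^ n * ∏ i ∈ Finset.range T.m, T.look (T.table κ x n) (Alive x n) i a := by
  -- A threshold above all ranks turns the restricted product into the full one.
  obtain ⟨t, ht⟩ : ∃ t, ∀ i < T.m, κ i < t :=
    ⟨(Finset.range T.m).sup κ + 1, fun i hi =>
      Nat.lt_succ_of_le (Finset.le_sup (f := κ) (Finset.mem_range.2 hi))⟩
  have hf : (Finset.range T.m).filter (fun i => κ i < t) = Finset.range T.m :=
    Finset.filter_true_of_mem fun i hi => ht i (Finset.mem_range.1 hi)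
  have := BetaCount.total_eq (N := T.N) (c := fun i a => (T.weight i a : ℚ≥0)) hκ
    (fun i hi a => Nat.cast_pos.2 (hT.weight_bounds hi a).1) hch
    (fun _ _ _ _ h => by rw [weight_congr h]) t n le_rfl a
  rw [hf] at this
  rw [this]
  rcases Nat.eq_zero_or_pos T.N with hN | hN
  · rcases Nat.eq_zero_or_pos n with rfl | hn
    -- With empty domain and no variables, `table_eq` is not available, but nothing has been
    -- eliminated and both sides unfold to the same lookup.
    · congr 1
      refine Finset.prod_congr rfl fun i hi => ?_
      have hi' := Finset.mem_range.1 hi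
      change (T.weight i a : ℚ≥0) = _
      have hA : Alive x 0 = fun _ => True := by
        ext z
        simp [Alive]
      unfold weight look
      rw [hA]
      split_ifs <;> rfl
    · simp [hN, hn.ne']
  · congr 1
    refine Finset.prod_congr rfl fun i hi => ?_
    have hi' := Finset.mem_range.1 hi
    rw [hT.look_eq_elim hκ hN hch le_rfl hi' (hT.table_eq hκ hN hch hx n le_rfl i hi')]

end Tables

end BetaCount

namespace BetaCount

/-! ### Elimination orders -/

namespace Tables

variable (T : Tables)

/-- The variable `z` is a nest point of the hypergraph of the scopes, restricted to `A`. -/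
def IsNest (A : ℕ → Prop) (z : ℕ) : Prop :=
  ∀ i < T.m, ∀ j < T.m, z ∈ T.scope i → z ∈ T.scope j →
    (∀ z' ∈ T.scope i, A z' → z' ∈ T.scope j) ∨ ∀ z' ∈ T.scope j, A z' → z' ∈ T.scope i

open Classical in
/-- One plus a nest point in `A`, zero if there is none. -/
noncomputable def next (A : ℕ → Prop) : ℕ :=
  (Finset.range T.m).sup fun i => (Finset.range (T.nv i)).sup fun t =>
    if A (T.var i t) ∧ T.IsNest A (T.var i t) then T.var i t + 1 else 0

/-- The rank of a constraint for the elimination order `x 0, …, x (n - 1)`: constraints are compared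
by their last variables in which they differ, and then by their indices. -/
def rank (x : ℕ → ℕ) (n i : ℕ) : ℕ :=
  (∑ k ∈ Finset.range n, if x k ∈ T.scope i then 2 ^ k else 0) * T.m + i

/-- Whenever some variable is not in `S`, the hypergraph of the scopes has a nest point after the
removal of `S`. -/
def HasNestPoints : Prop :=
  ∀ S : Set ℕ, (∃ i < T.m, ∃ z ∈ T.scope i, z ∉ S) →
    ∃ z, z ∉ S ∧ (∃ i < T.m, z ∈ T.scope i) ∧ T.IsNest (fun z' => z' ∉ S) z

variable {T}

theorem next_spec (A : ℕ → Prop) :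
    (T.next A = 0 ∧ ∀ i < T.m, ∀ z ∈ T.scope i, ¬ (A z ∧ T.IsNest A z)) ∨
      ∃ z, T.next A = z + 1 ∧ A z ∧ T.IsNest A z ∧ ∃ i < T.m, z ∈ T.scope i := by
  classical
  by_cases h : T.next A = 0
  · refine .inl ⟨h, fun i hi z hz hA => ?_⟩
    obtain ⟨t, ht, rfl⟩ := mem_scope.1 hz
    have h1 := (Finset.sup_eq_bot_iff _ _).1 h i (Finset.mem_range.2 hi)
    have h2 := (Finset.sup_eq_bot_iff _ _).1 h1 t (Finset.mem_range.2 ht)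
    rw [if_pos hA] at h2
    simp at h2
  · right
    have key : ∀ (s : Finset ℕ) (f : ℕ → ℕ), s.sup f ≠ 0 → ∃ i ∈ s, s.sup f = f i ∧ f i ≠ 0 := by
      intro s f hf
      obtain ⟨i, hi, hfi⟩ := Finset.exists_mem_eq_sup s (by
        by_contra he
        rw [Finset.not_nonempty_iff_eq_empty.1 he] at hf
        simp at hf) f
      exact ⟨i, hi, hfi, hfi ▸ hf⟩
    obtain ⟨i, hi, h1, h2⟩ := key _ _ h
    obtain ⟨t, ht, h3, h4⟩ := key _ _ h2
    have h5 : A (T.var i t) ∧ T.IsNest A (T.var i t) := by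
      by_contra hcon
      rw [if_neg hcon] at h4
      exact h4 rfl
    rw [if_pos h5] at h3
    exact ⟨T.var i t, h1.trans h3, h5.1, h5.2, i, Finset.mem_range.1 hi,
      mem_scope.2 ⟨t, Finset.mem_range.1 ht, rfl⟩⟩

theorem next_congr {A A' : ℕ → Prop} (h : ∀ z, A z ↔ A' z) : T.next A = T.next A' := by
  rw [show A = A' from funext fun z => propext (h z)]

/-- The properties of an elimination order `x 0, …, x (n - 1)`. -/
structure IsOrder (T : Tables) (x : ℕ → ℕ) (n : ℕ) : Prop where
  alive : ∀ k < n, Alive x k (x k)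
  nest : ∀ k < n, T.IsNest (Alive x k) (x k)
  mem : ∀ k < n, ∃ i < T.m, x k ∈ T.scope i
  exhausts : ∀ i < T.m, ∀ z ∈ T.scope i, ∃ k < n, x k = z

/-- The greedy choice of nest points yields an elimination order. -/
theorem isOrder_of_next (hT : T.HasNestPoints) {y : ℕ → ℕ}
    (hy : ∀ k, y k = T.next fun z => ∀ k' < k, y k' ≠ z + 1) {P : ℕ}
    (hP : ((Finset.range T.m).biUnion T.scope).card ≤ P) :
    T.IsOrder (fun k => y k - 1) (∑ k ∈ Finset.range P, if y k ≠ 0 then 1 else 0) := by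
  set x : ℕ → ℕ := fun k => y k - 1 with hx
  set V := (Finset.range T.m).biUnion T.scope with hV
  have hmemV : ∀ z, z ∈ V ↔ ∃ i < T.m, z ∈ T.scope i := by simp [hV]
  have halive : ∀ k, (∀ k' < k, y k' ≠ 0) → ∀ z, (∀ k' < k, y k' ≠ z + 1) ↔ Alive x k z := by
    refine fun k hk z => forall₂_congr fun k' hk' => not_congr ?_
    have := hk k' hk'
    simp only [hx]
    omega
  have hstep : ∀ k, (∀ k' ≤ k, y k' ≠ 0) → Alive x k (x k) ∧ T.IsNest (Alive x k) (x k) ∧ x k ∈ V := by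
    intro k hk
    have h1 := hy k
    rw [next_congr (halive k fun k' hk' => hk k' hk'.le)] at h1
    rcases T.next_spec (Alive x k) with ⟨h2, -⟩ | ⟨z, h2, h3, h4, h5⟩
    · exact absurd (h1.trans h2) (hk k le_rfl)
    · have hz : x k = z := by
        change y k - 1 = z
        rw [h1, h2, Nat.add_sub_cancel]
      rw [hz]
      exact ⟨h3, h4, (hmemV z).2 h5⟩
  -- The choices are distinct elements of the finite set `V`, so the greedy procedure stops.
  have hex : ∃ k, y k = 0 := by
    by_contra hcon
    push Not at hcon
    have hinj : Function.Injective x := by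
      intro k k' he
      rcases lt_trichotomy k k' with hlt | heq | hlt
      · exact absurd he ((hstep k' fun _ _ => hcon _).1 k hlt)
      · exact heq
      · exact absurd he.symm ((hstep k fun _ _ => hcon _).1 k' hlt)
    exact Set.infinite_of_injective_forall_mem hinj (s := (V : Set ℕ))
      (fun k => (hstep k fun _ _ => hcon _).2.2) V.finite_toSet
  classical
  obtain ⟨n, hn0, hn⟩ : ∃ n, y n = 0 ∧ ∀ k < n, y k ≠ 0 :=
    ⟨Nat.find hex, Nat.find_spec hex, fun k hk => Nat.find_min hex hk⟩
  have hstep' : ∀ k < n, Alive x k (x k) ∧ T.IsNest (Alive x k) (x k) ∧ x k ∈ V :=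
    fun k hk => hstep k fun k' hk' => hn k' (by omega)
  -- A leftover variable would yield another nest point, contrary to the stop at `n`.
  have hdead : ∀ i < T.m, ∀ z ∈ T.scope i, ∃ k < n, x k = z := by
    intro i hi z hz
    by_contra hcon
    push Not at hcon
    obtain ⟨z', h1, ⟨j, hj, hzj⟩, h2⟩ := hT {z | ∃ k < n, x k = z} ⟨i, hi, z, hz, by simpa using hcon⟩
    have hA : (fun z' => z' ∉ {z | ∃ k < n, x k = z}) = Alive x n := by
      ext z
      simp [Alive]
    rw [hA] at h2
    have h3 := hy n
    rw [next_congr (halive n hn), hn0] at h3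
    rcases T.next_spec (Alive x n) with ⟨-, h4⟩ | ⟨w, h4, -⟩
    · exact h4 j hj z' hzj ⟨(congrFun hA z').mp h1, h2⟩
    · omega
  -- The sequence stays zero after its first zero, so counting its nonzero terms gives `n`.
  have hzero : ∀ k, n ≤ k → y k = 0 := by
    intro k hk
    rw [hy k]
    rcases T.next_spec fun z => ∀ k' < k, y k' ≠ z + 1 with ⟨h, -⟩ | ⟨z, -, h2, -, i, hi, hz⟩
    · exact h
    · obtain ⟨k', hk', rfl⟩ := hdead i hi z hz
      have h3 := h2 k' (by omega)
      have h4 := hn k' hk'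
      simp only [hx] at h3
      omega
  have hnV : n ≤ P := by
    refine le_trans ?_ hP
    rw [← Finset.card_range n]
    refine Finset.card_le_card_of_injOn x (fun k hk => (hstep' k (by simpa using hk)).2.2) ?_
    intro k hk k' hk' he
    have hk1 : k < n := by simpa using hk
    have hk2 : k' < n := by simpa using hk'
    rcases lt_trichotomy k k' with hlt | heq | hlt
    · exact absurd he ((hstep' k' hk2).1 k hlt)
    · exact heq
    · exact absurd he.symm ((hstep' k hk1).1 k' hlt)
  have hcount : ∑ k ∈ Finset.range P, (if y k ≠ 0 then 1 else 0) = n := by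
    rw [← Finset.sum_filter, ← Finset.card_eq_sum_ones]
    have : (Finset.range P).filter (fun k => y k ≠ 0) = Finset.range n := by
      ext k
      simp only [Finset.mem_filter, Finset.mem_range]
      exact ⟨fun h => by_contra fun hk => h.2 (hzero k (by omega)), fun h => ⟨by omega, hn k h⟩⟩
    rw [this, Finset.card_range]
  rw [hcount]
  exact ⟨fun k hk => (hstep' k hk).1, fun k hk => (hstep' k hk).2.1,
    fun k hk => (hmemV _).1 (hstep' k hk).2.2, hdead⟩

theorem rank_injOn (x : ℕ → ℕ) (n : ℕ) : Set.InjOn (T.rank x n) (Set.Iio T.m) := by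
  intro i hi j hj h
  have h1 : T.rank x n i % T.m = i := by
    rw [rank, Nat.add_comm, Nat.add_mul_mod_self_right, Nat.mod_eq_of_lt hi]
  have h2 : T.rank x n j % T.m = j := by
    rw [rank, Nat.add_comm, Nat.add_mul_mod_self_right, Nat.mod_eq_of_lt hj]
  rw [← h1, ← h2, h]

/-- Otherwise the nest point property puts the remaining scope of `j` inside that of `i`, and it
misses some `x l` with `l ≥ k`. As binary numbers, the bits of `i` from position `k` on dominate
those of `j` with a surplus `2 ^ l ≥ 2 ^ k`, which the bits below `k` cannot make up for. Then `j`
has the smaller rank. -/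
theorem IsOrder.chainOrder {x : ℕ → ℕ} {n : ℕ} (h : T.IsOrder x n) :
    ChainOrder T.m T.scope (T.rank x n) x n := by
  intro k hk i hi j hj hxi hxj hle z hz hza
  by_contra hzj
  rcases h.nest k hk i hi j hj hxi hxj with h1 | h1
  · exact hzj (h1 z hz hza)
  obtain ⟨l, hl, rfl⟩ := h.exhausts i hi z hz
  have hkl : k ≤ l := by
    by_contra hcon
    exact hza l (by omega) rfl
  -- Below `k` nothing is known about the scopes, so the full `2 ^ k'` is conceded there; the
  -- surplus is recorded at `l`.
  have key : ∀ k' ∈ Finset.range n, (if x k' ∈ T.scope j then 2 ^ k' else 0) +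
      (if l = k' then 2 ^ k' else 0) ≤
      (if x k' ∈ T.scope i then 2 ^ k' else 0) + (if k' < k then 2 ^ k' else 0) := by
    intro k' hk'
    by_cases hlt : k' < k
    · rw [if_neg (by omega : ¬ l = k'), if_pos hlt]
      split_ifs <;> simp
    · have hal : Alive x k (x k') := fun k'' hk'' => h.alive k' (Finset.mem_range.1 hk') k'' (by omega)
      by_cases hlk : l = k'
      · subst hlk
        rw [if_neg hzj, if_pos hz]
        simp
      · rw [if_neg hlk, if_neg hlt]
        by_cases hxj' : x k' ∈ T.scope j
        · rw [if_pos hxj', if_pos (h1 _ hxj' hal)]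
        · rw [if_neg hxj']
          exact Nat.zero_le _
  have hsum := Finset.sum_le_sum key
  rw [Finset.sum_add_distrib, Finset.sum_add_distrib, Finset.sum_ite_eq,
    if_pos (Finset.mem_range.2 hl), ← Finset.sum_filter (fun k' => k' < k)] at hsum
  have hfil : (Finset.range n).filter (fun k' => k' < k) = Finset.range k := by
    ext k'
    simp only [Finset.mem_filter, Finset.mem_range]
    omega
  rw [hfil] at hsum
  have hgeom : ∑ k' ∈ Finset.range k, 2 ^ k' < 2 ^ k := Nat.geomSum_lt le_rfl (by simp)
  have hpow : 2 ^ k ≤ 2 ^ l := Nat.pow_le_pow_right two_pos hkl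
  have hlt : (∑ k ∈ Finset.range n, if x k ∈ T.scope j then 2 ^ k else 0) + 1 ≤
      ∑ k ∈ Finset.range n, if x k ∈ T.scope i then 2 ^ k else 0 := by omega
  have := Nat.mul_le_mul_right T.m hlt
  rw [add_one_mul] at this
  unfold rank at hle
  omega

end Tables

/-! ### Lists of digits -/

/-- The digit at position `j` of `e` in base `b`. -/
def digit (b e j : ℕ) : ℕ := e / b ^ j % b

theorem sum_digits_lt {b : ℕ} {y : ℕ → ℕ} : ∀ {k : ℕ}, (∀ j < k, y j < b) →
    ∑ j ∈ Finset.range k, y j * b ^ j < b ^ k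
  | 0, _ => by simp
  | k + 1, h => by
    have h1 := sum_digits_lt (b := b) (y := y) (k := k) fun j hj => h j (by omega)
    have h2 := Nat.mul_le_mul_right (b ^ k) (h k (by omega) : y k + 1 ≤ b)
    rw [Finset.sum_range_succ, pow_succ]
    rw [Nat.succ_mul] at h2
    rw [mul_comm (b ^ k) b]
    omega

theorem digit_sum {b : ℕ} {y : ℕ → ℕ} {k j : ℕ} (h : ∀ j < k, y j < b) (hj : j < k) :
    digit b (∑ j ∈ Finset.range k, y j * b ^ j) j = y j := by
  have hb : 0 < b := (Nat.zero_le _).trans_lt (h j hj)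
  induction k with
  | zero => omega
  | succ k ih =>
    rw [Finset.sum_range_succ, digit]
    have h1 := sum_digits_lt (b := b) (y := y) (k := k) fun j hj => h j (by omega)
    rcases Nat.lt_succ_iff_lt_or_eq.1 hj with hj' | rfl
    · obtain ⟨d, rfl⟩ : ∃ d, k = j + 1 + d := ⟨k - (j + 1), by omega⟩
      have h2 : y (j + 1 + d) * b ^ (j + 1 + d) = b ^ j * (b * (y (j + 1 + d) * b ^ d)) := by ring
      rw [h2, Nat.add_mul_div_left _ _ (Nat.pow_pos hb), Nat.add_mul_mod_self_left]
      exact ih (fun j hj => h j (by omega)) hj'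
    · rw [Nat.add_mul_div_right _ _ (Nat.pow_pos hb), Nat.div_eq_of_lt h1, zero_add,
        Nat.mod_eq_of_lt (h j hj)]

end BetaCount

namespace BetaCount

/-! ### Reading the encoding of an instance -/

/-- The entry at position `p` of the input. -/
def rd (w : List ℕ) (p : ℕ) : ℕ := w.getD p 0

/-- The position of the code of the `i`-th constraint. -/
def off (w : List ℕ) : ℕ → ℕ
  -- The first two entries are the domain size and the number of constraints. A constraint with v
  -- variables and r rows takes v + 4 + r (v + 2) entries.
  | 0 => 2
  | i + 1 => off w i + (rd w (off w i) + 4 +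
      rd w (off w i + rd w (off w i) + 3) * (rd w (off w i) + 2))

/-- A common multiple of the denominators in the input, and a bound for its entries. -/
def base (w : List ℕ) : ℕ := ∏ p ∈ Finset.range w.length, max 1 (rd w p)

/-- The factor that separates the weights from those weights that replace zero. -/
def scale (w : List ℕ) : ℕ := base w ^ (3 * w.length) + 1

/-- The positive integer that replaces the weight `p / q`. -/
def posWeight (w : List ℕ) (p q : ℕ) : ℕ :=
  if p ≠ 0 then scale w * (p * (base w / q)) else 1

/-- The position of row `r` in the code of the `i`-th constraint. -/
def rowPos (w : List ℕ) (i r : ℕ) : ℕ :=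
  off w i + rd w (off w i) + 4 + r * (rd w (off w i) + 2)

/-- The tables that the input encodes, with positive integers as weights. -/
def codeTables (w : List ℕ) : Tables where
  N := rd w 0
  m := rd w 1
  P := w.length
  val := rd w
  nv i := rd w (off w i)
  nr i := rd w (off w i + rd w (off w i) + 3)
  var i t := rd w (off w i + 1 + t)
  cell i r t := rd w (rowPos w i r + t)
  wt i r := posWeight w (rd w (rowPos w i r + rd w (off w i)))
    (rd w (rowPos w i r + rd w (off w i) + 1))
  df i := posWeight w (rd w (off w i + rd w (off w i) + 1)) (rd w (off w i + rd w (off w i) + 2))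

theorem getD_flatMap {α : Type} (g : α → List ℕ) (L : ℕ) : ∀ (l : List α),
    (∀ a ∈ l, (g a).length = L) → ∀ (r : ℕ) (hr : r < l.length) (t : ℕ), t < L →
      (l.flatMap g).getD (r * L + t) 0 = (g l[r]).getD t 0
  | [], _, r, hr, _, _ => by simp at hr
  | a :: l, h, 0, _, t, ht => by
    rw [List.flatMap_cons, zero_mul, zero_add, List.getD_append]
    · rfl
    · rw [h a (by simp)]
      exact ht
  | a :: l, h, r + 1, hr, t, ht => by
    rw [List.flatMap_cons, List.getD_append_right, h a (by simp)]
    · rw [show (r + 1) * L + t - L = r * L + t by rw [add_one_mul]; omega]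
      simpa using getD_flatMap g L l (fun b hb => h b (by simp [hb])) r (by simpa using hr) t ht
    · rw [h a (by simp), add_one_mul]
      omega

theorem length_flatMap_const {α : Type} (g : α → List ℕ) (L : ℕ) (l : List α)
    (h : ∀ a ∈ l, (g a).length = L) : (l.flatMap g).length = l.length * L := by
  induction l with
  | nil => simp
  | cons a l ih =>
    rw [List.flatMap_cons, List.length_append, h a (by simp), ih fun b hb => h b (by simp [hb]),
      List.length_cons, add_one_mul, add_comm]

variable {n : ℕ}

/-- The code of a constraint is found at position `o` of the input, with the variables listed in
`xs` and the support listed in `as`. -/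
structure ReadsAt (w : List ℕ) (o : ℕ) (c : WeightedConstraint ℕ (Fin n)) (xs : List c.vars)
    (as : List c.supp) : Prop where
  xs_nodup : xs.Nodup
  mem_xs : ∀ x, x ∈ xs
  as_nodup : as.Nodup
  mem_as : ∀ a, a ∈ as
  nv : rd w o = xs.length
  nr : rd w (o + xs.length + 3) = as.length
  var : ∀ t (h : t < xs.length), rd w (o + 1 + t) = xs[t]
  dnum : rd w (o + xs.length + 1) = c.dflt.num
  dden : rd w (o + xs.length + 2) = c.dflt.den
  cell : ∀ r (hr : r < as.length) t (ht : t < xs.length),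
    rd w (o + xs.length + 4 + r * (xs.length + 2) + t) = (as[r].1 xs[t] : ℕ)
  wnum : ∀ r (hr : r < as.length),
    rd w (o + xs.length + 4 + r * (xs.length + 2) + xs.length) = (c.f as[r]).num
  wden : ∀ r (hr : r < as.length),
    rd w (o + xs.length + 4 + r * (xs.length + 2) + xs.length + 1) = (c.f as[r]).den

theorem exists_readsAt {c : WeightedConstraint ℕ (Fin n)} {code : List ℕ}
    (h : IsConstraintCode c code) : ∃ xs as, code.length =
        xs.length + 4 + as.length * (xs.length + 2) ∧
      ∀ (w : List ℕ) (o : ℕ), (∀ p < code.length, rd w (o + p) = code.getD p 0) →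
        ReadsAt w o c xs as := by
  obtain ⟨xs, as, ⟨hx1, hx2⟩, ⟨ha1, ha2⟩, hcode⟩ := h
  have hcoe : xs.map (fun x => (x : ℕ)) = xs.map Subtype.val := by simp
  rw [hcoe] at hcode
  subst hcode
  set g : c.supp → List ℕ := fun a =>
    xs.map (fun x => (a.1 x : ℕ)) ++ [(c.f a).num, (c.f a).den] with hg
  have hgl : ∀ a ∈ as, (g a).length = xs.length + 2 := by simp [hg]
  have hfl := length_flatMap_const g _ as hgl
  have hlen : ([xs.length] ++ xs.map Subtype.val ++ [c.dflt.num, c.dflt.den, as.length] ++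
      as.flatMap g).length = xs.length + 4 + as.length * (xs.length + 2) := by
    simp only [List.length_append, hfl, List.length_map, List.length_cons, List.length_nil]
    omega
  refine ⟨xs, as, hlen, fun w o hw => ?_⟩
  rw [hlen] at hw
  have hrow : ∀ r (hr : r < as.length) t, t < xs.length + 2 →
      rd w (o + xs.length + 4 + r * (xs.length + 2) + t) = (g as[r]).getD t 0 := by
    intro r hr t ht
    have h1 : (r + 1) * (xs.length + 2) ≤ as.length * (xs.length + 2) := Nat.mul_le_mul_right _ hr
    rw [add_one_mul] at h1
    rw [show o + xs.length + 4 + r * (xs.length + 2) + t =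
      o + (xs.length + 4 + (r * (xs.length + 2) + t)) by ring, hw _ (by omega),
      List.getD_append_right, ← getD_flatMap g _ as hgl r hr t ht]
    · congr 1
      simp only [List.length_append, List.length_map, List.length_cons, List.length_nil]
      omega
    · simp only [List.length_append, List.length_map, List.length_cons, List.length_nil]
      omega
  have hmid : ∀ t < 3, rd w (o + (xs.length + 1 + t)) =
      [c.dflt.num, c.dflt.den, as.length].getD t 0 := by
    intro t ht
    rw [hw _ (by omega), List.getD_append, List.getD_append_right]
    · congr 1
      simp only [List.length_append, List.length_map, List.length_cons, List.length_nil]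
      omega
    · simp only [List.length_append, List.length_map, List.length_cons, List.length_nil]
      omega
    · simp only [List.length_append, List.length_map, List.length_cons, List.length_nil]
      omega
  refine ⟨hx1, hx2, ha1, ha2, ?_, ?_, ?_, ?_, ?_, ?_, ?_, ?_⟩
  · have := hw 0 (by omega)
    simpa using this
  · have := hmid 2 (by omega)
    rw [← add_assoc, ← add_assoc] at this
    exact this
  · intro t ht
    rw [show o + 1 + t = o + (1 + t) by ring, hw _ (by omega), List.getD_append, List.getD_append,
      List.getD_append_right]
    · simp [ht]
    · simp
    · simp; omega
    · simp; omega
  · exact hmid 0 (by omega)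
  · exact hmid 1 (by omega)
  · intro r hr t ht
    rw [hrow r hr t (by omega), hg, List.getD_append _ _ _ _ (by simpa using ht)]
    simp [ht]
  · intro r hr
    rw [hrow r hr _ (by omega), hg, List.getD_append_right _ _ _ _ (by simp)]
    simp
  · intro r hr
    rw [add_assoc _ xs.length 1, hrow r hr _ (by omega), hg, List.getD_append_right _ _ _ _ (by simp)]
    simp

/-- The constraints in the list `cs` are found one after another in the input. -/
structure Reads (w : List ℕ) (cs : List (WeightedConstraint ℕ (Fin n))) : Prop where
  N_eq : rd w 0 = n
  m_eq : rd w 1 = cs.length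
  off_le : ∀ i ≤ cs.length, off w i ≤ w.length
  reads : ∀ (i : ℕ) (hi : i < cs.length), ∃ (xs : List cs[i].vars) (as : List cs[i].supp),
    ReadsAt w (off w i) cs[i] xs as

theorem off_succ_of_readsAt {w : List ℕ} {i : ℕ} {c : WeightedConstraint ℕ (Fin n)}
    {xs : List c.vars} {as : List c.supp} (h : ReadsAt w (off w i) c xs as) :
    off w (i + 1) = off w i + (xs.length + 4 + as.length * (xs.length + 2)) := by
  rw [off, h.nv, h.nr]

theorem reads_of_forall₂ {w : List ℕ} {cs : List (WeightedConstraint ℕ (Fin n))}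
    {codes : List (List ℕ)} (h : List.Forall₂ IsConstraintCode cs codes)
    (hw : w = [n, cs.length] ++ codes.flatten) : Reads w cs := by
  have hlen := h.length_eq
  have hget : ∀ (i : ℕ) (hi : i < cs.length), IsConstraintCode cs[i] (codes[i]'(by omega)) :=
    fun i hi => h.get hi (by omega)
  have hreads : ∀ (i : ℕ) (hi : i < cs.length), w.drop (off w i) = (codes.drop i).flatten →
      ∃ (xs : List cs[i].vars) (as : List cs[i].supp),
        (codes[i]'(by omega)).length = xs.length + 4 + as.length * (xs.length + 2) ∧
        ReadsAt w (off w i) cs[i] xs as := by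
    intro i hi hd
    obtain ⟨xs, as, h1, h2⟩ := exists_readsAt (hget i hi)
    refine ⟨xs, as, h1, h2 w (off w i) fun p hp => ?_⟩
    have h3 : rd w (off w i + p) = (w.drop (off w i)).getD p 0 := by
      simp [rd, List.getD_eq_getElem?_getD]
    rw [h3, hd, List.drop_eq_getElem_cons (by omega), List.flatten_cons, List.getD_append _ _ _ _ hp]
  -- Invariant of the reading process: from position `off w i` on, the input consists of the codes
  -- that have not been read.
  have hmain : ∀ i ≤ cs.length, off w i ≤ w.length ∧ w.drop (off w i) = (codes.drop i).flatten := by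
    intro i
    induction i with
    | zero =>
      intro _
      rw [off, hw]
      simp
    | succ i ih =>
      intro hi
      obtain ⟨h1, h2⟩ := ih (by omega)
      obtain ⟨xs, as, h3, h4⟩ := hreads i (by omega) h2
      have h5 := off_succ_of_readsAt h4
      rw [← h3] at h5
      have h6 := h2
      rw [List.drop_eq_getElem_cons (l := codes) (i := i) (by omega), List.flatten_cons] at h6
      constructor
      · have := congrArg List.length h6
        rw [List.length_drop, List.length_append] at this
        omega
      · rw [h5, ← List.drop_drop, h6, List.drop_left]
  refine ⟨by simp [hw, rd], by simp [hw, rd], fun i hi => (hmain i hi).1, fun i hi => ?_⟩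
  obtain ⟨xs, as, -, h⟩ := hreads i hi (hmain i hi.le).2
  exact ⟨xs, as, h⟩

theorem exists_reads {I : Finset (WeightedConstraint ℕ (Fin n))} {w : List ℕ}
    (h : IsInstanceCode I w) : ∃ cs : List (WeightedConstraint ℕ (Fin n)), cs.Nodup ∧
      (∀ c, c ∈ cs ↔ c ∈ I) ∧ Reads w cs := by
  obtain ⟨cs, codes, ⟨h1, h2⟩, h3, h4⟩ := h
  exact ⟨cs, h1, h2, reads_of_forall₂ h3 h4⟩

/-! ### Properties of the tables of an instance -/

theorem one_le_base (w : List ℕ) : 1 ≤ base w :=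
  Finset.one_le_prod' fun _ _ => le_max_left _ _

theorem max_dvd_base {w : List ℕ} {p : ℕ} (hp : p < w.length) : max 1 (rd w p) ∣ base w :=
  Finset.dvd_prod_of_mem _ (Finset.mem_range.2 hp)

theorem rd_le_base (w : List ℕ) (p : ℕ) : rd w p ≤ base w := by
  rcases lt_or_ge p w.length with hp | hp
  · exact (le_max_right _ _).trans (Nat.le_of_dvd (one_le_base w) (max_dvd_base hp))
  · rw [rd, List.getD_eq_default _ _ hp]
    exact Nat.zero_le _

theorem rd_dvd_base {w : List ℕ} {p : ℕ} (hp : p < w.length) (h0 : 0 < rd w p) :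
    rd w p ∣ base w := by
  have := max_dvd_base hp
  rwa [max_eq_right (by omega)] at this

theorem lt_length_of_rd_ne_zero {w : List ℕ} {p : ℕ} (h : rd w p ≠ 0) : p < w.length := by
  by_contra hp
  exact h (List.getD_eq_default _ _ (by omega))

theorem scale_pos (w : List ℕ) : 0 < scale w := Nat.succ_pos _

theorem posWeight_bounds {w : List ℕ} {p q : ℕ} (hp : p ≤ base w) (hq : 0 < q) (hqw : q ∣ base w) :
    0 < posWeight w p q ∧ posWeight w p q ≤ scale w * (base w * base w) := by
  have h1 := one_le_base w
  unfold posWeight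
  split_ifs with h
  · have h2 : 0 < base w / q := Nat.div_pos (Nat.le_of_dvd h1 hqw) hq
    exact ⟨Nat.mul_pos (scale_pos w) (Nat.mul_pos (Nat.pos_of_ne_zero h) h2),
      Nat.mul_le_mul_left _ (Nat.mul_le_mul hp (Nat.div_le_self _ _))⟩
  · exact ⟨one_pos, Nat.mul_pos (scale_pos w) (Nat.mul_pos h1 h1)⟩

section

variable {w : List ℕ} {cs : List (WeightedConstraint ℕ (Fin n))}

theorem ReadsAt.scope_eq {i : ℕ} {c : WeightedConstraint ℕ (Fin n)} {xs : List c.vars}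
    {as : List c.supp} (h : ReadsAt w (off w i) c xs as) : (codeTables w).scope i = c.vars := by
  ext z
  rw [Tables.mem_scope]
  change (∃ t < rd w (off w i), rd w (off w i + 1 + t) = z) ↔ _
  rw [h.nv]
  constructor
  · rintro ⟨t, ht, rfl⟩
    rw [h.var t ht]
    exact xs[t].2
  · intro hz
    obtain ⟨t, ht, he⟩ := List.getElem_of_mem (h.mem_xs ⟨z, hz⟩)
    exact ⟨t, ht, by rw [h.var t ht, he]⟩

theorem Reads.scope_eq (h : Reads w cs) {i : ℕ} (hi : i < cs.length) :
    (codeTables w).scope i = cs[i].vars := by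
  obtain ⟨xs, as, hr⟩ := h.reads i hi
  exact hr.scope_eq

theorem Reads.valid (h : Reads w cs) :
    (codeTables w).Valid (scale w * (base w * base w)) := by
  have hwt : ∀ i < rd w 1, ∀ r < rd w (off w i + rd w (off w i) + 3),
      0 < (codeTables w).wt i r ∧ (codeTables w).wt i r ≤ scale w * (base w * base w) := by
    intro i hi r hr
    rw [h.m_eq] at hi
    obtain ⟨xs, as, hx⟩ := h.reads i hi
    rw [hx.nv, hx.nr] at hr
    have h1 := hx.wden r hr
    have h2 : 0 < (cs[i].f as[r]).den := NNRat.den_pos _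
    -- A denominator is nonzero, hence it is read inside the input and divides `base w`; reading
    -- outside would return zero.
    refine posWeight_bounds (rd_le_base _ _) ?_ (rd_dvd_base (lt_length_of_rd_ne_zero ?_) ?_) <;>
    · rw [rowPos, hx.nv, h1]
      omega
  have hdf : ∀ i < rd w 1,
      0 < (codeTables w).df i ∧ (codeTables w).df i ≤ scale w * (base w * base w) := by
    intro i hi
    rw [h.m_eq] at hi
    obtain ⟨xs, as, hx⟩ := h.reads i hi
    have h1 := hx.dden
    have h2 : 0 < cs[i].dflt.den := NNRat.den_pos _
    refine posWeight_bounds (rd_le_base _ _) ?_ (rd_dvd_base (lt_length_of_rd_ne_zero ?_) ?_) <;>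
    · rw [hx.nv, h1]
      omega
  have hcell : ∀ i < rd w 1, ∀ r < rd w (off w i + rd w (off w i) + 3), ∀ t < rd w (off w i),
      rd w (rowPos w i r + t) < rd w 0 ∧ rowPos w i r + t < w.length := by
    intro i hi r hr t ht
    rw [h.m_eq] at hi
    obtain ⟨xs, as, hx⟩ := h.reads i hi
    rw [hx.nv, hx.nr] at hr
    rw [hx.nv] at ht
    constructor
    · rw [rowPos, hx.nv, hx.cell r hr t ht, h.N_eq]
      exact (as[r].1 xs[t]).2
    · have h1 := h.off_le (i + 1) hi
      rw [off_succ_of_readsAt hx] at h1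
      have h2 : (r + 1) * (xs.length + 2) ≤ as.length * (xs.length + 2) := Nat.mul_le_mul_right _ hr
      rw [add_one_mul] at h2
      rw [rowPos, hx.nv]
      omega
  refine ⟨?_, ?_, fun i hi r hr t ht => (hcell i hi r hr t ht).1,
    fun i hi r hr t ht => ⟨_, (hcell i hi r hr t ht).2, rfl⟩, fun i hi r hr => (hwt i hi r hr).1,
    fun i hi => (hdf i hi).1, fun i hi r hr => (hwt i hi r hr).2, fun i hi => (hdf i hi).2⟩
  · intro i hi t ht t' ht' he
    change i < rd w 1 at hi
    change t < rd w (off w i) at ht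
    change t' < rd w (off w i) at ht'
    change rd w (off w i + 1 + t) = rd w (off w i + 1 + t') at he
    rw [h.m_eq] at hi
    obtain ⟨xs, as, hx⟩ := h.reads i hi
    rw [hx.nv] at ht ht'
    rw [hx.var t ht, hx.var t' ht'] at he
    exact (List.Nodup.getElem_inj_iff hx.xs_nodup).1 (Subtype.ext he)
  · intro i hi r hr r' hr' he
    change i < rd w 1 at hi
    change r < rd w (off w i + rd w (off w i) + 3) at hr
    change r' < rd w (off w i + rd w (off w i) + 3) at hr'
    change ∀ t < rd w (off w i), rd w (rowPos w i r + t) = rd w (rowPos w i r' + t) at he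
    rw [h.m_eq] at hi
    obtain ⟨xs, as, hx⟩ := h.reads i hi
    rw [hx.nv, hx.nr] at hr hr'
    rw [hx.nv] at he
    refine (List.Nodup.getElem_inj_iff hx.as_nodup (hi := hr) (hj := hr')).1 (Subtype.ext (funext fun z => Fin.ext ?_))
    obtain ⟨t, ht, rfl⟩ := List.getElem_of_mem (hx.mem_xs z)
    have := he t ht
    rwa [rowPos, rowPos, hx.nv, hx.cell r hr t ht, hx.cell r' hr' t ht] at this

theorem two_add_le_off (w : List ℕ) : ∀ i, 2 + i ≤ off w i
  | 0 => le_rfl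
  | i + 1 => by
    have := two_add_le_off w i
    rw [off]
    omega

theorem Reads.m_le (h : Reads w cs) : rd w 1 ≤ w.length := by
  have h1 := h.off_le cs.length le_rfl
  have h2 := two_add_le_off w cs.length
  rw [h.m_eq]
  omega

theorem Reads.nv_le (h : Reads w cs) {i : ℕ} (hi : i < rd w 1) : rd w (off w i) ≤ w.length := by
  have h1 := h.off_le (i + 1) (by rw [h.m_eq] at hi; exact hi)
  rw [off] at h1
  omega

theorem Reads.nr_le (h : Reads w cs) {i : ℕ} (hi : i < rd w 1) :
    rd w (off w i + rd w (off w i) + 3) ≤ w.length := by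
  have h1 := h.off_le (i + 1) (by rw [h.m_eq] at hi; exact hi)
  rw [off] at h1
  have h2 := Nat.le_mul_of_pos_right (rd w (off w i + rd w (off w i) + 3))
    (by omega : 0 < rd w (off w i) + 2)
  omega

theorem Reads.card_scopes_le (h : Reads w cs) :
    ((Finset.range (codeTables w).m).biUnion (codeTables w).scope).card ≤ w.length := by
  have hsub : (Finset.range (codeTables w).m).biUnion (codeTables w).scope ⊆
      (Finset.range w.length).image (rd w) := by
    intro z hz
    obtain ⟨i, hi, hz⟩ := Finset.mem_biUnion.1 hz
    obtain ⟨t, ht, rfl⟩ := Tables.mem_scope.1 hz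
    have h1 := h.off_le (i + 1) (by
      have := Finset.mem_range.1 hi
      change i < rd w 1 at this
      rw [h.m_eq] at this
      exact this)
    rw [off] at h1
    change t < rd w (off w i) at ht
    exact Finset.mem_image.2 ⟨off w i + 1 + t, Finset.mem_range.2 (by omega), rfl⟩
  exact (Finset.card_le_card hsub).trans (Finset.card_image_le.trans (by simp))

end

end BetaCount

namespace BetaCount

open Function (update)

/-! ### `β`-acyclic hypergraphs have nest points -/

/-- The witness is the first vertex of the order outside `S`. All its predecessors are in `S`, so
its edges form a chain once these are removed, and removing the rest of `S` preserves a chain. -/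
theorem exists_nestPoint {H : Hypergraph ℕ} {xs : List ℕ} (h : H.IsBetaEliminationOrder xs)
    {S : Set ℕ} (hS : ∃ z ∈ H.vertexSet, z ∉ S) :
    ∃ z ∈ H.vertexSet, z ∉ S ∧ ∀ e ∈ H.edgeSet, ∀ f ∈ H.edgeSet, z ∈ e → z ∈ f →
      (∀ z' ∈ e, z' ∉ S → z' ∈ f) ∨ ∀ z' ∈ f, z' ∉ S → z' ∈ e := by
  induction h with
  | nil h0 =>
    obtain ⟨z, hz, -⟩ := hS
    rw [h0] at hz
    exact hz.elim
  | @cons H x xs hx _ ih =>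
    by_cases hxS : x ∈ S
    · obtain ⟨z, hz, hzS⟩ := hS
      obtain ⟨y, ⟨hy, hyx⟩, hyS, hy'⟩ := ih ⟨z, ⟨hz, fun hzx => hzS (hzx ▸ hxS)⟩, hzS⟩
      refine ⟨y, hy, hyS, fun e he f hf hye hyf => ?_⟩
      rcases hy' (e \ {x}) ⟨⟨y, hye, hyx⟩, e, he, rfl⟩ (f \ {x}) ⟨⟨y, hyf, hyx⟩, f, hf, rfl⟩
        ⟨hye, hyx⟩ ⟨hyf, hyx⟩ with h | h
      · exact .inl fun z' hz' hzS' => (h z' ⟨hz', fun hzx => hzS' (hzx ▸ hxS)⟩ hzS').1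
      · exact .inr fun z' hz' hzS' => (h z' ⟨hz', fun hzx => hzS' (hzx ▸ hxS)⟩ hzS').1
    · refine ⟨x, hx.1, hxS, fun e he f hf hxe hxf => ?_⟩
      by_cases hef : e = f
      · exact .inl fun z' hz' _ => hef ▸ hz'
      · rcases hx.2 ⟨he, hxe⟩ ⟨hf, hxf⟩ hef with h | h
        · exact .inl fun z' hz' _ => h hz'
        · exact .inr fun z' hz' _ => h hz'

variable {n : ℕ} {w : List ℕ} {cs : List (WeightedConstraint ℕ (Fin n))}
  {I : Finset (WeightedConstraint ℕ (Fin n))}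

theorem Reads.hasNestPoints (h : Reads w cs) (hI : ∀ c, c ∈ cs ↔ c ∈ I)
    (hβ : (instanceHypergraph I).BetaAcyclic) : (codeTables w).HasNestPoints := by
  rintro S ⟨i, hi, z, hz, hzS⟩
  obtain ⟨xs, hxs⟩ := hβ
  have hm : ∀ i, i < (codeTables w).m → i < cs.length := fun i hi => h.m_eq ▸ hi
  have hedge : ∀ i (hi : i < cs.length), ∀ z ∈ cs[i].vars,
      (↑cs[i].vars : Set ℕ) ∈ (instanceHypergraph I).edgeSet := fun i hi z hz =>
    ⟨⟨z, hz⟩, cs[i], (hI _).1 (List.getElem_mem hi), rfl⟩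
  have hz' : z ∈ (instanceHypergraph I).vertexSet := by
    rw [h.scope_eq (hm i hi)] at hz
    exact Finset.mem_coe.2 (vars_subset_instanceVars ((hI _).1 (List.getElem_mem (hm i hi))) hz)
  obtain ⟨y, hy, hyS, hy'⟩ := exists_nestPoint hxs ⟨z, hz', hzS⟩
  refine ⟨y, hyS, ?_, fun j hj j' hj' hyj hyj' => ?_⟩
  · obtain ⟨c, hc, hyc⟩ := Finset.mem_biUnion.1 (Finset.mem_coe.1 hy)
    obtain ⟨j, hj, rfl⟩ := List.getElem_of_mem ((hI c).2 hc)
    exact ⟨j, by change j < rd w 1; rw [h.m_eq]; exact hj, by rw [h.scope_eq hj]; exact hyc⟩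
  · rw [h.scope_eq (hm j hj)] at hyj ⊢
    rw [h.scope_eq (hm j' hj')] at hyj' ⊢
    exact hy' _ (hedge _ _ y hyj) _ (hedge _ _ y hyj') hyj hyj'

/-! ### Weights of an instance and their positive integer approximations -/

/-- If no factor vanishes, the modified product is exactly K^m times the original one. Otherwise a
factor 1 leaves at most (B K)^(m-1). The sum of these errors is below K^m because `s.card * B ^ m <
K`. The errors are compared after multiplication by K, which avoids the exponent m - 1. -/
theorem sum_div_eq {α : Type} (s : Finset α) (m K B : ℕ) (G : ℕ → α → ℕ) (hB : 1 ≤ B)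
    (hG : ∀ i < m, ∀ b, G i b ≤ B) (hK : s.card * B ^ m < K) :
    (∑ b ∈ s, ∏ i ∈ Finset.range m, if G i b = 0 then 1 else K * G i b) / K ^ m =
      ∑ b ∈ s, ∏ i ∈ Finset.range m, G i b := by
  have hK0 : 0 < K := (Nat.zero_le _).trans_lt hK
  have key : ∀ b, ∃ e, (∏ i ∈ Finset.range m, if G i b = 0 then 1 else K * G i b) =
      K ^ m * (∏ i ∈ Finset.range m, G i b) + e ∧ e * K ≤ B ^ m * K ^ m := by
    intro b
    by_cases h : ∀ i ∈ Finset.range m, G i b ≠ 0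
    · refine ⟨0, ?_, by simp⟩
      rw [Finset.prod_congr rfl fun i hi => if_neg (h i hi), Finset.prod_mul_distrib]
      simp
    · push Not at h
      obtain ⟨i, hi, hi0⟩ := h
      have hz : ∏ i ∈ Finset.range m, G i b = 0 := Finset.prod_eq_zero hi hi0
      refine ⟨_, by rw [hz, mul_zero, zero_add], ?_⟩
      rw [← Finset.mul_prod_erase _ _ hi, if_pos hi0, one_mul]
      have h1 : (∏ x ∈ (Finset.range m).erase i, if G x b = 0 then 1 else K * G x b) ≤
          (B * K) ^ ((Finset.range m).erase i).card := by
        refine Finset.prod_le_pow_card _ _ _ fun j hj => ?_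
        have hj' := Finset.mem_range.1 (Finset.mem_of_mem_erase hj)
        split_ifs
        · exact Nat.mul_pos hB hK0
        · rw [mul_comm]
          exact Nat.mul_le_mul_right _ (hG j hj' b)
      rw [Finset.card_erase_of_mem hi, Finset.card_range] at h1
      obtain ⟨m', rfl⟩ : ∃ m', m = m' + 1 := ⟨m - 1, by have := Finset.mem_range.1 hi; omega⟩
      calc _ ≤ (B * K) ^ m' * K := Nat.mul_le_mul_right _ h1
        _ = B ^ m' * K ^ (m' + 1) := by ring
        _ ≤ _ := Nat.mul_le_mul_right _ (Nat.pow_le_pow_right hB (Nat.le_succ _))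
  choose e he1 he2 using key
  have hE : ∑ b ∈ s, e b < K ^ m := by
    have h1 : (∑ b ∈ s, e b) * K ≤ s.card * B ^ m * K ^ m := by
      rw [Finset.sum_mul, mul_assoc]
      simpa using Finset.sum_le_card_nsmul s (fun b => e b * K) _ fun b _ => he2 b
    have h2 : s.card * B ^ m * K ^ m < K ^ m * K := by
      rw [mul_comm (K ^ m)]
      exact Nat.mul_lt_mul_of_pos_right hK (Nat.pow_pos hK0)
    exact lt_of_mul_lt_mul_right (h1.trans_lt h2) (Nat.zero_le _)
  rw [Finset.sum_congr rfl fun b _ => he1 b, Finset.sum_add_distrib, ← Finset.mul_sum,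
    Nat.mul_add_div (Nat.pow_pos hK0), Nat.div_eq_of_lt hE, add_zero]

/-- The assignment of all natural numbers that extends an assignment of the variables by zero. -/
def extend {V : Finset ℕ} (b : V → Fin n) (z : ℕ) : ℕ := if h : z ∈ V then b ⟨z, h⟩ else 0

theorem extend_of_mem {V : Finset ℕ} (b : V → Fin n) {z : ℕ} (h : z ∈ V) :
    extend b z = b ⟨z, h⟩ := dif_pos h

/-- The integer that is obtained by clearing denominators in a weight. -/
def clear (w : List ℕ) (q : ℚ≥0) : ℕ := q.num * (base w / q.den)

theorem Reads.weight_eq (h : Reads w cs) {i : ℕ} (hi : i < cs.length) {V : Finset ℕ}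
    (hV : cs[i].vars ⊆ V) (b : V → Fin n) :
    (codeTables w).weight i (extend b) =
        (if clear w (cs[i].val fun z => b ⟨z, hV z.2⟩) = 0 then 1 else
          scale w * clear w (cs[i].val fun z => b ⟨z, hV z.2⟩)) ∧
      clear w (cs[i].val fun z => b ⟨z, hV z.2⟩) ≤ base w * base w ∧
      (clear w (cs[i].val fun z => b ⟨z, hV z.2⟩) : ℚ≥0) =
        base w * cs[i].val fun z => b ⟨z, hV z.2⟩ := by
  classical
  obtain ⟨xs, as, hx⟩ := h.reads i hi
  -- Here `p` and `q` are the positions of the numerator and denominator, in the matching row or in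
  -- the default entry.
  have key : ∃ p q, rd w p = (cs[i].val fun z => b ⟨z, hV z.2⟩).num ∧
      rd w q = (cs[i].val fun z => b ⟨z, hV z.2⟩).den ∧
      (codeTables w).weight i (extend b) = posWeight w (rd w p) (rd w q) := by
    have hcell : ∀ r (hr : r < as.length), (∀ t < (codeTables w).nv i,
        (codeTables w).cell i r t = extend b ((codeTables w).var i t)) ↔
          (as[r].1 = fun z : cs[i].vars => b ⟨z, hV z.2⟩) := by
      intro r hr
      change (∀ t < rd w (off w i), rd w (rowPos w i r + t) =
        extend b (rd w (off w i + 1 + t))) ↔ _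
      rw [hx.nv]
      have h1 : ∀ t (ht : t < xs.length), rd w (rowPos w i r + t) =
          extend b (rd w (off w i + 1 + t)) ↔ as[r].1 xs[t] = b ⟨xs[t], hV xs[t].2⟩ := by
        intro t ht
        rw [rowPos, hx.nv, hx.cell r hr t ht, hx.var t ht, extend_of_mem _ (hV xs[t].2), Fin.ext_iff]
      constructor
      · intro h2
        funext z
        obtain ⟨t, ht, rfl⟩ := List.getElem_of_mem (hx.mem_xs z)
        exact (h1 t ht).1 (h2 t ht)
      · intro h2 t ht
        exact (h1 t ht).2 (congrFun h2 _)
    have hi' : i < (codeTables w).m := by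
      change i < rd w 1
      rwa [h.m_eq]
    have hnr : (codeTables w).nr i = as.length := by
      change rd w (off w i + rd w (off w i) + 3) = _
      rw [hx.nv, hx.nr]
    by_cases hs : (fun z : cs[i].vars => b ⟨z, hV z.2⟩) ∈ cs[i].supp
    · obtain ⟨r, hr, her⟩ := List.getElem_of_mem (hx.mem_as ⟨_, hs⟩)
      have hval : (cs[i].val fun z => b ⟨z, hV z.2⟩) = cs[i].f as[r] := by
        rw [WeightedConstraint.val, dif_pos hs, her]
      refine ⟨rowPos w i r + rd w (off w i), rowPos w i r + rd w (off w i) + 1, ?_, ?_, ?_⟩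
      · rw [hval, rowPos, hx.nv, hx.wnum r hr]
      · rw [hval, rowPos, hx.nv, hx.wden r hr]
      · exact h.valid.weight_row hi' (hnr ▸ hr) ((hcell r hr).2 (by rw [her]))
    · have hval : (cs[i].val fun z => b ⟨z, hV z.2⟩) = cs[i].dflt := by
        rw [WeightedConstraint.val, dif_neg hs]
      refine ⟨off w i + rd w (off w i) + 1, off w i + rd w (off w i) + 2, ?_, ?_, ?_⟩
      · rw [hval, hx.nv, hx.dnum]
      · rw [hval, hx.nv, hx.dden]
      · refine Tables.weight_default fun r hr => ?_
        rw [hnr] at hr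
        by_contra hcon
        push Not at hcon
        exact hs ((hcell r hr).1 hcon ▸ as[r].2)
  obtain ⟨p, q, hp, hq, hw⟩ := key
  generalize (cs[i].val fun z => b ⟨z, hV z.2⟩) = u at *
  have hq0 : rd w q ≠ 0 := by rw [hq]; exact u.den_ne_zero
  have hdvd : rd w q ∣ base w := rd_dvd_base (lt_length_of_rd_ne_zero hq0) (Nat.pos_of_ne_zero hq0)
  have hdiv : 0 < base w / u.den := by
    rw [← hq]
    exact Nat.div_pos (Nat.le_of_dvd (one_le_base w) hdvd) (Nat.pos_of_ne_zero hq0)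
  refine ⟨?_, ?_, ?_⟩
  · rw [hw, hp, hq, posWeight, clear]
    by_cases hu : u.num = 0
    · simp [hu]
    · rw [if_pos hu, if_neg (Nat.mul_ne_zero hu hdiv.ne')]
  · exact Nat.mul_le_mul (hp ▸ rd_le_base w p) (Nat.div_le_self _ _)
  · have hdvd' : u.den ∣ base w := hq ▸ hdvd
    rw [clear, Nat.cast_mul, Nat.cast_div hdvd' (Nat.cast_ne_zero.2 u.den_ne_zero)]
    conv_rhs => rw [← NNRat.num_div_den u]
    rw [mul_div_assoc', mul_div_assoc', mul_comm]

/-- The family `e` is characterized by its values on and off the eliminated variables, not by a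
formula; this lets the induction split off the last coordinate of the tuple. -/
theorem total_eq_sum {N : ℕ} {x : ℕ → ℕ} (g : (ℕ → ℕ) → ℚ≥0) : ∀ (k : ℕ)
    (_ : ∀ k' < k, Alive x k' (x k')) (a : ℕ → ℕ) (e : (Fin k → Fin N) → ℕ → ℕ)
    (_ : ∀ b (j : Fin k), e b (x j) = b j) (_ : ∀ b z, Alive x k z → e b z = a z),
    total N x k g a = ∑ b, g (e b)
  | 0, _, a, e, _, h2 => by
    have : ∀ b, e b = a := fun b => funext fun z => h2 b z fun k' hk' => absurd hk' (Nat.not_lt_zero _)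
    simp [total, this]
  | k + 1, hx, a, e, h1, h2 => by
    rw [total_succ, ← Fin.sum_univ_eq_sum_range (fun d => total N x k g (update a (x k) d)),
      ← (Fin.snocEquiv fun _ => Fin N).sum_comp, Fintype.sum_prod_type]
    refine Finset.sum_congr rfl fun d _ => ?_
    refine total_eq_sum g k (fun k' hk' => hx k' (by omega)) _
      (fun b => e (Fin.snocEquiv (fun _ => Fin N) (d, b))) (fun b j => ?_) fun b z hz => ?_
    · have := h1 (Fin.snocEquiv (fun _ => Fin N) (d, b)) j.castSucc
      rw [Fin.val_castSucc] at this
      rw [this]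
      simp [Fin.snocEquiv]
    · by_cases hzk : z = x k
      · subst hzk
        have := h1 (Fin.snocEquiv (fun _ => Fin N) (d, b)) (Fin.last k)
        rw [Fin.val_last] at this
        rw [this, Function.update_self]
        simp [Fin.snocEquiv]
      · rw [Function.update_of_ne hzk]
        exact h2 _ z (hz.succ hzk)

theorem total_eq_sum_extend {x : ℕ → ℕ} {k : ℕ} {V : Finset ℕ}
    (hx : ∀ k' < k, Alive x k' (x k')) (hV : ∀ z, z ∈ V ↔ ∃ j < k, x j = z) (g : (ℕ → ℕ) → ℚ≥0) :
    total n x k g (fun _ => 0) = ∑ b : V → Fin n, g (extend b) := by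
  have hbij : Function.Bijective fun j : Fin k => (⟨x j, (hV _).2 ⟨j, j.2, rfl⟩⟩ : V) := by
    constructor
    · intro j j' he
      have he' : x j = x j' := congrArg Subtype.val he
      rcases lt_trichotomy (j : ℕ) j' with hlt | heq | hlt
      · exact absurd he' (hx j' j'.2 j hlt)
      · exact Fin.ext heq
      · exact absurd he'.symm (hx j j.2 j' hlt)
    · rintro ⟨z, hz⟩
      obtain ⟨j, hj, rfl⟩ := (hV z).1 hz
      exact ⟨⟨j, hj⟩, rfl⟩
  set σ := Equiv.ofBijective _ hbij with hσ
  rw [← (Equiv.arrowCongr σ (Equiv.refl (Fin n))).sum_comp]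
  refine total_eq_sum g k hx _ _ (fun b j => ?_) fun b z hz => ?_
  · rw [extend_of_mem _ ((hV _).2 ⟨j, j.2, rfl⟩)]
    have : (⟨x j, (hV _).2 ⟨j, j.2, rfl⟩⟩ : V) = σ j := rfl
    simp [this]
  · refine dif_neg fun hzV => ?_
    obtain ⟨j, hj, rfl⟩ := (hV z).1 hzV
    exact hz j hj rfl

theorem list_prod_eq (hnd : cs.Nodup) (hI : ∀ c, c ∈ cs ↔ c ∈ I)
    (b : instanceVars I → Fin n) (g : ℕ → ℚ≥0)
    (hg : ∀ i (hi : i < cs.length), g i = cs[i].val fun z =>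
      b ⟨z, vars_subset_instanceVars ((hI _).1 (List.getElem_mem hi)) z.2⟩) :
    (∏ c : {c // c ∈ I}, c.1.val fun z => b ⟨z.1, vars_subset_instanceVars c.2 z.2⟩) =
      ∏ i ∈ Finset.range cs.length, g i := by
  rw [← Fin.prod_univ_eq_prod_range g]
  symm
  refine Fintype.prod_bijective (fun i : Fin cs.length =>
    (⟨cs[i], (hI _).1 (List.getElem_mem i.2)⟩ : {c // c ∈ I})) ⟨fun i j he => ?_, ?_⟩ _ _
    fun i => hg i i.2
  · exact Fin.ext ((List.Nodup.getElem_inj_iff hnd).1 (congrArg Subtype.val he))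
  · rintro ⟨c, hc⟩
    obtain ⟨i, hi, rfl⟩ := List.getElem_of_mem ((hI c).2 hc)
    exact ⟨⟨i, hi⟩, rfl⟩

/-- The partition function from the sum over the positive integer weights. -/
theorem Reads.partitionFunction_eq (h : Reads w cs) (hnd : cs.Nodup) (hI : ∀ c, c ∈ cs ↔ c ∈ I)
    {x : ℕ → ℕ} {k : ℕ} (hx : (codeTables w).IsOrder x k) (hk : k ≤ w.length) :
    partitionFunction I = (⌊total (rd w 0) x k (fun a => ∏ i ∈ Finset.range (rd w 1),
      ((codeTables w).weight i a : ℚ≥0)) (fun _ => 0) / (scale w : ℚ≥0) ^ rd w 1⌋₊ : ℚ≥0) /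
        (base w : ℚ≥0) ^ rd w 1 := by
  have hV : ∀ z, z ∈ instanceVars I ↔ ∃ j < k, x j = z := by
    intro z
    constructor
    · intro hz
      obtain ⟨c, hc, hzc⟩ := Finset.mem_biUnion.1 hz
      obtain ⟨i, hi, rfl⟩ := List.getElem_of_mem ((hI c).2 hc)
      exact hx.exhausts i (by change i < rd w 1; rwa [h.m_eq]) z (by rwa [h.scope_eq hi])
    · rintro ⟨j, hj, rfl⟩
      obtain ⟨i, hi, hz⟩ := hx.mem j hj
      change i < rd w 1 at hi
      rw [h.m_eq] at hi
      rw [h.scope_eq hi] at hz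
      exact vars_subset_instanceVars ((hI _).1 (List.getElem_mem hi)) hz
  have hsub : ∀ i (hi : i < cs.length), cs[i].vars ⊆ instanceVars I := fun i hi =>
    vars_subset_instanceVars ((hI _).1 (List.getElem_mem hi))
  set G : ℕ → (instanceVars I → Fin n) → ℕ := fun i b =>
    if hi : i < cs.length then clear w (cs[i].val fun z => b ⟨z, hsub i hi z.2⟩) else 0 with hG
  have hGi : ∀ i (hi : i < cs.length) b,
      G i b = clear w (cs[i].val fun z => b ⟨z, hsub i hi z.2⟩) := fun i hi b => dif_pos hi
  -- Source of the exponent `3 * w.length` in `scale`: at most one length for the number of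
  -- variables, the domain size being at most `base w`, and two for the power of `base w * base w`.
  have hcard : Fintype.card (instanceVars I → Fin n) * (base w * base w) ^ rd w 1 < scale w := by
    have h1 : (instanceVars I).card ≤ k := by
      rw [← Finset.card_range k]
      refine Finset.card_le_card_of_surjOn x fun z hz => ?_
      obtain ⟨j, hj, rfl⟩ := (hV z).1 (Finset.mem_coe.1 hz)
      exact ⟨j, by simpa using hj, rfl⟩
    rw [Fintype.card_fun, Fintype.card_fin, Fintype.card_coe, scale, Nat.lt_succ_iff]
    have h2 : n ≤ base w := h.N_eq ▸ rd_le_base w 0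
    have h3 := h.m_le
    calc _ ≤ base w ^ (instanceVars I).card * (base w * base w) ^ rd w 1 :=
          Nat.mul_le_mul_right _ (Nat.pow_le_pow_left h2 _)
      _ = base w ^ ((instanceVars I).card + 2 * rd w 1) := by rw [pow_add, pow_mul, sq]
      _ ≤ _ := Nat.pow_le_pow_right (one_le_base w) (by omega)
  have hmain := sum_div_eq (Finset.univ : Finset (instanceVars I → Fin n)) (rd w 1) (scale w)
    (base w * base w) G (Nat.mul_pos (one_le_base w) (one_le_base w)) (fun i hi b => by
      rw [h.m_eq] at hi
      rw [hGi i hi]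
      exact (h.weight_eq hi (hsub i hi) b).2.1) hcard
  have htot : total (rd w 0) x k (fun a => ∏ i ∈ Finset.range (rd w 1),
      ((codeTables w).weight i a : ℚ≥0)) (fun _ => 0) =
      ((∑ b : instanceVars I → Fin n, ∏ i ∈ Finset.range (rd w 1),
        if G i b = 0 then 1 else scale w * G i b : ℕ) : ℚ≥0) := by
    rw [h.N_eq, total_eq_sum_extend hx.alive hV, Nat.cast_sum]
    refine Finset.sum_congr rfl fun b _ => ?_
    rw [Nat.cast_prod]
    refine Finset.prod_congr rfl fun i hi => ?_
    have hi' : i < cs.length := by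
      rw [← h.m_eq]
      exact Finset.mem_range.1 hi
    rw [(h.weight_eq hi' (hsub i hi') b).1, hGi i hi']
  rw [htot, ← Nat.cast_pow, Nat.floor_div_eq_div, hmain, Nat.cast_sum, Finset.sum_div,
    partitionFunction]
  refine Finset.sum_congr rfl fun b _ => ?_
  rw [list_prod_eq hnd hI b (fun i => G i b / base w), h.m_eq, Finset.prod_div_distrib, Nat.cast_prod]
  · simp
  · intro i hi
    have hb : (base w : ℚ≥0) ≠ 0 := Nat.cast_ne_zero.2 (Nat.pos_iff_ne_zero.1 (one_le_base w))
    rw [hGi i hi, (h.weight_eq hi (hsub i hi) b).2.2, mul_div_cancel_left₀ _ hb]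

end BetaCount

namespace BetaCount

open Function (update)

/-! ### The algorithm: tables and elimination order -/

/-- The facts about the input on which the resource bounds depend. -/
structure GoodCode (w : List ℕ) : Prop where
  valid : (codeTables w).Valid (scale w * (base w * base w))
  nest : (codeTables w).HasNestPoints
  off_le : ∀ i ≤ rd w 1, off w i ≤ w.length
  m_le : rd w 1 ≤ w.length
  nv_le : ∀ i < rd w 1, rd w (off w i) ≤ w.length
  nr_le : ∀ i < rd w 1, rd w (off w i + rd w (off w i) + 3) ≤ w.length
  card_le : ((Finset.range (codeTables w).m).biUnion (codeTables w).scope).card ≤ w.length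

theorem Reads.goodCode {n : ℕ} {w : List ℕ} {cs : List (WeightedConstraint ℕ (Fin n))}
    {I : Finset (WeightedConstraint ℕ (Fin n))} (h : Reads w cs) (hI : ∀ c, c ∈ cs ↔ c ∈ I)
    (hβ : (instanceHypergraph I).BetaAcyclic) : GoodCode w :=
  ⟨h.valid, h.hasNestPoints hI hβ, fun i hi => h.off_le i (h.m_eq ▸ hi), h.m_le,
    fun _ hi => h.nv_le hi, fun _ hi => h.nr_le hi, h.card_scopes_le⟩

/-- The tables of the input that is attached to `x`. -/
abbrev tb {X : Type} [HasCode X] (x : X) : Tables := codeTables (HasCode.code x)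

/-- The common setting of all computations: the input is the code of an instance, and its length is
available. -/
structure Setting {X : Type} [HasCode X] (D : Set X) (gs : List (X → ℕ)) : Prop where
  good : ∀ x ∈ D, GoodCode (HasCode.code x)
  len : Comp D gs fun x => (HasCode.code x).length

/-- A variable `z` has not been eliminated, if the digits of `E` list the first `k` eliminated
variables. -/
def DigitAlive (w : List ℕ) (E k z : ℕ) : Prop := ∀ k' < k, digit (base w + 2) E k' ≠ z + 1

/-- The list of the first `k` eliminated variables, as digits. -/
noncomputable def orderCode (w : List ℕ) : ℕ → ℕ
  | 0 => 0
  | k + 1 => orderCode w k +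
      (codeTables w).next (DigitAlive w (orderCode w k) k) * (base w + 2) ^ k

/-- One plus the `k`-th eliminated variable, zero if all variables have been eliminated. -/
noncomputable def orderSeq (w : List ℕ) (k : ℕ) : ℕ :=
  (codeTables w).next (DigitAlive w (orderCode w k) k)

/-- The elimination order. -/
noncomputable def order (w : List ℕ) (k : ℕ) : ℕ := orderSeq w k - 1

/-- The number of variables. -/
noncomputable def numVars (w : List ℕ) : ℕ :=
  ∑ k ∈ Finset.range w.length, if orderSeq w k ≠ 0 then 1 else 0

/-- Variables are entries of the input, hence at most `base w`; increased by one, they are digits in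
base `base w + 2`. -/
theorem orderSeq_lt (w : List ℕ) (k : ℕ) : orderSeq w k < base w + 2 := by
  rcases (codeTables w).next_spec (DigitAlive w (orderCode w k) k) with
    ⟨h, -⟩ | ⟨z, h, -, -, i, -, hz⟩
  · rw [orderSeq, h]
    omega
  · obtain ⟨t, -, rfl⟩ := Tables.mem_scope.1 hz
    have : (codeTables w).var i t ≤ base w := rd_le_base w _
    rw [orderSeq, h]
    omega

theorem orderCode_eq (w : List ℕ) (k : ℕ) :
    orderCode w k = ∑ j ∈ Finset.range k, orderSeq w j * (base w + 2) ^ j := by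
  induction k with
  | zero => rfl
  | succ k ih => rw [Finset.sum_range_succ, ← ih, orderCode, orderSeq]

theorem digitAlive_iff (w : List ℕ) (k z : ℕ) :
    DigitAlive w (orderCode w k) k z ↔ ∀ k' < k, orderSeq w k' ≠ z + 1 :=
  forall₂_congr fun k' hk' => by
    rw [orderCode_eq, digit_sum (fun j _ => orderSeq_lt w j) hk']

theorem GoodCode.isOrder {w : List ℕ} (h : GoodCode w) :
    (codeTables w).IsOrder (order w) (numVars w) :=
  Tables.isOrder_of_next h.nest (fun k => Tables.next_congr (digitAlive_iff w k)) h.card_le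

theorem numVars_le (w : List ℕ) : numVars w ≤ w.length := by
  refine (Finset.sum_le_card_nsmul _ _ 1 fun k _ => ?_).trans (by simp)
  split_ifs <;> omega

/-! ### Computability of the tables, the elimination order and the ranking. -/

section

variable {X : Type} [HasCode X] {D D' : Set X} {gs : List (X → ℕ)}

theorem Setting.lift (S : Setting D gs) {n : X → ℕ} {b : X × ℕ → ℕ} :
    Setting (roundDomain D n) (loopEnv gs b) :=
  ⟨fun y hy => S.good y.1 hy.1, S.len.lift⟩

theorem Setting.subset (S : Setting D gs) (h : D' ⊆ D) : Setting D' gs :=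
  ⟨fun x hx => S.good x (h hx), S.len.subset h⟩

theorem PolyBdd.of_le_length {f : X → ℕ} (h : ∀ x ∈ D, f x ≤ (HasCode.code x).length) :
    PolyBdd D f :=
  PolyBdd.bitLength.mono fun x hx => (h x hx).trans (length_le_bitLength _)

theorem lenBdd (D : Set X) : PolyBdd D fun x => (HasCode.code x).length :=
  .of_le_length fun _ _ => le_rfl

variable {fi fr ft fz fk fE fd fp fq : X → ℕ}

theorem Comp.rd (h : Comp D gs ft) : Comp D gs fun x => rd (HasCode.code x) (ft x) := h.getD

theorem Setting.mComp (_ : Setting D gs) : Comp D gs fun x => (tb x).m := (Comp.const 1).rd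

theorem Setting.mBdd (S : Setting D gs) : PolyBdd D fun x => (tb x).m :=
  .of_le_length fun x hx => (S.good x hx).m_le

/-- The guard is essential: only the positions of actual constraints are bounded by the length of
the input. It is passed on to everything read through `off`. -/
theorem Setting.off (S : Setting D gs) (hi : Comp D gs fi) (hlt : ∀ x ∈ D, fi x < (tb x).m) :
    Comp D gs fun x => off (HasCode.code x) (fi x) := by
  refine Comp.loop (F := fun x k => BetaCount.off (HasCode.code x) k) hi
    (S.mBdd.mono fun x hx => (hlt x hx).le) (.const 2) (PolyBdd.sizeBdd (.of_le_length fun y hy => ?_))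
    fun ha => ?_
  · exact (S.good y.1 hy.1).off_le y.2 (hy.2.trans (hlt y.1 hy.1).le)
  · exact ha.add ((ha.rd.add (.const 4)).add
      (((ha.add ha.rd).add (.const 3)).rd.mul (ha.rd.add (.const 2))))

theorem Setting.nv (S : Setting D gs) (hi : Comp D gs fi) (hlt : ∀ x ∈ D, fi x < (tb x).m) :
    Comp D gs fun x => (tb x).nv (fi x) := (S.off hi hlt).rd

theorem Setting.nvBdd (S : Setting D gs) (hlt : ∀ x ∈ D, fi x < (tb x).m) :
    PolyBdd D fun x => (tb x).nv (fi x) :=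
  .of_le_length fun x hx => (S.good x hx).nv_le _ (hlt x hx)

theorem Setting.nr (S : Setting D gs) (hi : Comp D gs fi) (hlt : ∀ x ∈ D, fi x < (tb x).m) :
    Comp D gs fun x => (tb x).nr (fi x) :=
  (((S.off hi hlt).add (S.nv hi hlt)).add (.const 3)).rd

theorem Setting.nrBdd (S : Setting D gs) (hlt : ∀ x ∈ D, fi x < (tb x).m) :
    PolyBdd D fun x => (tb x).nr (fi x) :=
  .of_le_length fun x hx => (S.good x hx).nr_le _ (hlt x hx)

theorem Setting.var (S : Setting D gs) (hi : Comp D gs fi) (hlt : ∀ x ∈ D, fi x < (tb x).m)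
    (ht : Comp D gs ft) : Comp D gs fun x => (tb x).var (fi x) (ft x) :=
  (((S.off hi hlt).add (.const 1)).add ht).rd

theorem Setting.rowPos (S : Setting D gs) (hi : Comp D gs fi) (hlt : ∀ x ∈ D, fi x < (tb x).m)
    (hr : Comp D gs fr) : Comp D gs fun x => rowPos (HasCode.code x) (fi x) (fr x) :=
  (((S.off hi hlt).add (S.nv hi hlt)).add (.const 4)).add (hr.mul ((S.nv hi hlt).add (.const 2)))

theorem Setting.cell (S : Setting D gs) (hi : Comp D gs fi) (hlt : ∀ x ∈ D, fi x < (tb x).m)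
    (hr : Comp D gs fr) (ht : Comp D gs ft) :
    Comp D gs fun x => (tb x).cell (fi x) (fr x) (ft x) :=
  ((S.rowPos hi hlt hr).add ht).rd

theorem Setting.base (S : Setting D gs) : Comp D gs fun x => base (HasCode.code x) := by
  refine Comp.rangeProd (F := fun x p => max 1 (BetaCount.rd (HasCode.code x) p)) S.len (lenBdd D) ?_
  have hc : Comp (roundDomain D fun x => (HasCode.code x).length) (roundEnv gs) fun y => y.2 :=
    .counter (lenBdd D)
  refine (Comp.ite' (CompPred.le (.const 1) hc.rd) hc.rd (.const 1)).congr fun y _ => ?_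
  split_ifs with h
  · exact (max_eq_right h).symm
  · exact (max_eq_left (not_le.1 h).le).symm

theorem Setting.scale (S : Setting D gs) : Comp D gs fun x => scale (HasCode.code x) :=
  (S.base.pow ((Comp.const 3).mul S.len) ((PolyBdd.const 3).mul (lenBdd D))).add (.const 1)

theorem Setting.posWeight (S : Setting D gs) (hp : Comp D gs fp) (hq : Comp D gs fq) :
    Comp D gs fun x => posWeight (HasCode.code x) (fp x) (fq x) :=
  .ite' (.ne hp (.const 0)) (S.scale.mul (hp.mul (S.base.div hq))) (.const 1)

theorem Setting.wt (S : Setting D gs) (hi : Comp D gs fi) (hlt : ∀ x ∈ D, fi x < (tb x).m)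
    (hr : Comp D gs fr) : Comp D gs fun x => (tb x).wt (fi x) (fr x) :=
  S.posWeight ((S.rowPos hi hlt hr).add (S.nv hi hlt)).rd
    (((S.rowPos hi hlt hr).add (S.nv hi hlt)).add (.const 1)).rd

theorem Setting.df (S : Setting D gs) (hi : Comp D gs fi) (hlt : ∀ x ∈ D, fi x < (tb x).m) :
    Comp D gs fun x => (tb x).df (fi x) :=
  S.posWeight (((S.off hi hlt).add (S.nv hi hlt)).add (.const 1)).rd
    (((S.off hi hlt).add (S.nv hi hlt)).add (.const 2)).rd

theorem Setting.memScope (S : Setting D gs) (hi : Comp D gs fi) (hlt : ∀ x ∈ D, fi x < (tb x).m)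
    (hz : Comp D gs fz) : CompPred D gs fun x => fz x ∈ (tb x).scope (fi x) := by
  refine CompPred.congr (P := fun x => ∃ t < (tb x).nv (fi x), (tb x).var (fi x) t = fz x) ?_
    fun x _ => Tables.mem_scope.symm
  refine CompPred.exists_lt (P := fun x t => (tb x).var (fi x) t = fz x) (S.nv hi hlt) (S.nvBdd hlt) ?_
  exact .eq (S.lift.var hi.lift (fun y hy => hlt y.1 hy.1) (.counter (S.nvBdd hlt))) hz.lift

theorem Setting.row (S : Setting D gs) (hi : Comp D gs fi) (hlt : ∀ x ∈ D, fi x < (tb x).m)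
    (hr : Comp D gs fr) (hz : Comp D gs fz) :
    Comp D gs fun x => (tb x).row (fi x) (fr x) (fz x) := by
  refine Comp.rangeSum (F := fun x t => if (tb x).var (fi x) t = fz x then
    (tb x).cell (fi x) (fr x) t else 0) (S.nv hi hlt) (S.nvBdd hlt) ?_
  have hc := Comp.counter (gs := gs) (S.nvBdd hlt) (b := fun y => y.2)
  have hlt' : ∀ y ∈ roundDomain D (fun x => (tb x).nv (fi x)), fi y.1 < (tb y).m :=
    fun y hy => hlt y.1 hy.1
  exact .ite' (.eq (S.lift.var hi.lift hlt' hc) hz.lift) (S.lift.cell hi.lift hlt' hr.lift hc)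
    (.const 0)

theorem Setting.digitAlive (S : Setting D gs) (hE : Comp D gs fE) (hk : Comp D gs fk)
    (hkb : PolyBdd D fk) (hz : Comp D gs fz) :
    CompPred D gs fun x => DigitAlive (HasCode.code x) (fE x) (fk x) (fz x) := by
  refine CompPred.forall_lt (P := fun x k' =>
    digit (BetaCount.base (HasCode.code x) + 2) (fE x) k' ≠ fz x + 1) hk hkb ?_
  have hb : Comp (roundDomain D fk) (roundEnv gs) fun y => BetaCount.base (HasCode.code y) + 2 :=
    S.lift.base.add (.const 2)
  have hc := Comp.counter (gs := gs) hkb (b := fun y => y.2)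
  refine .ne ((hE.lift.div (hb.pow hc ?_)).mod hb) (hz.lift.add (.const 1))
  exact (hkb.lift fun y hy => hy.1).mono fun y hy => hy.2.le

/-- The variables of `fi x` in the restriction belong to the scope of `ft x`. -/
theorem Setting.restrictSubset (S : Setting D gs) (hE : Comp D gs fE) (hk : Comp D gs fk)
    (hkb : PolyBdd D fk) (hi : Comp D gs fi) (hilt : ∀ x ∈ D, fi x < (tb x).m) (ht : Comp D gs ft)
    (htlt : ∀ x ∈ D, ft x < (tb x).m) :
    CompPred D gs fun x => ∀ z' ∈ (tb x).scope (fi x),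
      DigitAlive (HasCode.code x) (fE x) (fk x) z' → z' ∈ (tb x).scope (ft x) := by
  refine CompPred.congr (P := fun x => ∀ s < (tb x).nv (fi x),
    DigitAlive (HasCode.code x) (fE x) (fk x) ((tb x).var (fi x) s) →
      (tb x).var (fi x) s ∈ (tb x).scope (ft x)) ?_ fun x _ => ?_
  · refine CompPred.forall_lt (P := fun x s =>
      DigitAlive (HasCode.code x) (fE x) (fk x) ((tb x).var (fi x) s) →
        (tb x).var (fi x) s ∈ (tb x).scope (ft x)) (S.nv hi hilt) (S.nvBdd hilt) ?_
    have hv := (S.lift (b := fun y => y.2)).var hi.lift (fun y hy => hilt y.1 hy.1)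
      (.counter (S.nvBdd hilt))
    exact .imp (S.lift.digitAlive hE.lift hk.lift (hkb.lift fun y hy => hy.1) hv)
      (S.lift.memScope ht.lift (fun y hy => htlt y.1 hy.1) hv)
  · constructor
    · intro h z' hz'
      obtain ⟨s, hs, rfl⟩ := Tables.mem_scope.1 hz'
      exact h s hs
    · exact fun h s hs => h _ (Tables.mem_scope.2 ⟨s, hs, rfl⟩)

theorem Setting.isNest (S : Setting D gs) (hE : Comp D gs fE) (hk : Comp D gs fk)
    (hkb : PolyBdd D fk) (hz : Comp D gs fz) :
    CompPred D gs fun x => (tb x).IsNest (DigitAlive (HasCode.code x) (fE x) (fk x)) (fz x) := by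
  refine CompPred.forall_lt (P := fun x i => ∀ j < (tb x).m, fz x ∈ (tb x).scope i →
    fz x ∈ (tb x).scope j → (∀ z' ∈ (tb x).scope i,
      DigitAlive (HasCode.code x) (fE x) (fk x) z' → z' ∈ (tb x).scope j) ∨
    ∀ z' ∈ (tb x).scope j, DigitAlive (HasCode.code x) (fE x) (fk x) z' → z' ∈ (tb x).scope i)
    S.mComp S.mBdd ?_
  refine CompPred.forall_lt (P := fun (y : X × ℕ) j => fz y.1 ∈ (tb y).scope y.2 →
    fz y.1 ∈ (tb y).scope j → (∀ z' ∈ (tb y).scope y.2,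
      DigitAlive (HasCode.code y) (fE y.1) (fk y.1) z' → z' ∈ (tb y).scope j) ∨
    ∀ z' ∈ (tb y).scope j, DigitAlive (HasCode.code y) (fE y.1) (fk y.1) z' →
      z' ∈ (tb y).scope y.2) S.lift.mComp
      (S.lift (b := fun y => y.2)).mBdd ?_
  have S2 := (S.lift (n := fun x => (tb x).m) (b := fun y => y.2)).lift (n := fun y => (tb y).m)
    (b := fun y => y.2)
  have h1 := (Comp.counter (gs := gs) S.mBdd (b := fun y => y.2)).lift (n := fun y => (tb y).m)
    (b := fun y => y.2)
  have h2 := Comp.counter (S.lift (n := fun x => (tb x).m) (b := fun y => y.2)).mBdd (b := fun y => y.2)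
    (gs := roundEnv gs)
  have hkb2 : PolyBdd (roundDomain (roundDomain D fun x => (tb x).m) fun y => (tb y).m)
      fun y => fk y.1.1 :=
    (hkb.lift fun y (hy : y ∈ roundDomain D fun x => (tb x).m) => hy.1).lift fun y hy => hy.1
  exact .imp (S2.memScope h1 (fun y hy => hy.1.2) hz.lift.lift)
    (.imp (S2.memScope h2 (fun y hy => hy.2) hz.lift.lift)
      (.or (S2.restrictSubset hE.lift.lift hk.lift.lift hkb2 h1 (fun y hy => hy.1.2) h2
        fun y hy => hy.2) (S2.restrictSubset hE.lift.lift hk.lift.lift hkb2 h2 (fun y hy => hy.2) h1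
        fun y hy => hy.1.2)))

theorem Setting.next (S : Setting D gs) (hE : Comp D gs fE) (hk : Comp D gs fk)
    (hkb : PolyBdd D fk) :
    Comp D gs fun x => (tb x).next (DigitAlive (HasCode.code x) (fE x) (fk x)) := by
  classical
  refine Comp.rangeSup (F := fun x i => (Finset.range ((tb x).nv i)).sup fun t =>
    if DigitAlive (HasCode.code x) (fE x) (fk x) ((tb x).var i t) ∧
      (tb x).IsNest (DigitAlive (HasCode.code x) (fE x) (fk x)) ((tb x).var i t) then
        (tb x).var i t + 1 else 0) S.mComp S.mBdd ?_
  have hc := Comp.counter (gs := gs) S.mBdd (b := fun y => y.2)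
  refine Comp.rangeSup (F := fun (y : X × ℕ) t =>
    if DigitAlive (HasCode.code y) (fE y.1) (fk y.1) ((tb y).var y.2 t) ∧
      (tb y).IsNest (DigitAlive (HasCode.code y) (fE y.1) (fk y.1)) ((tb y).var y.2 t) then
        (tb y).var y.2 t + 1 else 0) (S.lift.nv hc fun y hy => hy.2) 
    ((S.lift (b := fun y => y.2)).nvBdd fun y hy => hy.2) ?_
  have S2 := (S.lift (n := fun x => (tb x).m) (b := fun y => y.2)).lift
    (n := fun y => (tb y).nv y.2) (b := fun y => y.2)
  have hv := S2.var hc.lift (fun y hy => hy.1.2)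
    (.counter ((S.lift (b := fun y => y.2)).nvBdd fun y hy => hy.2))
  have hkb2 : PolyBdd (roundDomain (roundDomain D fun x => (tb x).m) fun y => (tb y).nv y.2)
      fun y => fk y.1.1 :=
    (hkb.lift fun y (hy : y ∈ roundDomain D fun x => (tb x).m) => hy.1).lift fun y hy => hy.1
  exact .ite' (.and (S2.digitAlive hE.lift.lift hk.lift.lift hkb2 hv)
    (S2.isNest hE.lift.lift hk.lift.lift hkb2 hv)) (hv.add (.const 1)) (.const 0)

theorem Setting.orderCode (S : Setting D gs) (hk : Comp D gs fk)
    (hkl : ∀ x ∈ D, fk x ≤ (HasCode.code x).length) :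
    Comp D gs fun x => orderCode (HasCode.code x) (fk x) := by
  have hkb : PolyBdd D fk := .of_le_length hkl
  have hb : Comp D gs fun x => BetaCount.base (HasCode.code x) + 2 := S.base.add (.const 2)
  refine Comp.loop (F := fun x k => BetaCount.orderCode (HasCode.code x) k) hk hkb (.const 0) ?_
    fun ha => ?_
  · have h1 : PolyBdd {y : X × ℕ | y.1 ∈ D ∧ y.2 ≤ fk y.1} fun y => y.2 :=
      (hkb.lift fun y hy => hy.1).mono fun y hy => hy.2
    refine SizeBdd.mono ((hb.1.lift fun y hy => hy.1).pow h1) fun y hy => ?_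
    rw [orderCode_eq]
    exact (sum_digits_lt fun j _ => orderSeq_lt _ j).le
  · have hc := Comp.counter (gs := gs) hkb (b := fun y => BetaCount.orderCode (HasCode.code y.1) y.2)
    have hcb : PolyBdd (roundDomain D fk) fun y => y.2 :=
      (hkb.lift fun y hy => hy.1).mono fun y hy => hy.2.le
    exact ha.add ((S.lift.next ha hc hcb).mul (hb.lift.pow hc hcb))

theorem Setting.orderSeq (S : Setting D gs) (hk : Comp D gs fk)
    (hkl : ∀ x ∈ D, fk x ≤ (HasCode.code x).length) :
    Comp D gs fun x => orderSeq (HasCode.code x) (fk x) :=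
  S.next (S.orderCode hk hkl) hk (.of_le_length hkl)

theorem Setting.order (S : Setting D gs) (hk : Comp D gs fk)
    (hkl : ∀ x ∈ D, fk x ≤ (HasCode.code x).length) :
    Comp D gs fun x => order (HasCode.code x) (fk x) :=
  (S.orderSeq hk hkl).sub (.const 1)

theorem Setting.numVars (S : Setting D gs) : Comp D gs fun x => numVars (HasCode.code x) := by
  refine Comp.rangeSum (F := fun x k => if BetaCount.orderSeq (HasCode.code x) k ≠ 0 then 1 else 0)
    S.len (lenBdd D) ?_
  exact .ite' (.ne (S.lift.orderSeq (.counter (lenBdd D)) fun y hy => hy.2.le) (.const 0))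
    (.const 1) (.const 0)

theorem numVarsBdd (D : Set X) : PolyBdd D fun x => numVars (HasCode.code x) :=
  .of_le_length fun _ _ => numVars_le _

/-- The rank of a constraint for the elimination order. -/
noncomputable abbrev codeRank (w : List ℕ) : ℕ → ℕ := (codeTables w).rank (order w) (numVars w)

theorem Setting.codeRank (S : Setting D gs) (hi : Comp D gs fi) (hlt : ∀ x ∈ D, fi x < (tb x).m) :
    Comp D gs fun x => BetaCount.codeRank (HasCode.code x) (fi x) := by
  refine (Comp.mul ?_ S.mComp).add hi
  refine Comp.rangeSum (F := fun x k => if BetaCount.order (HasCode.code x) k ∈ (tb x).scope (fi x)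
    then 2 ^ k else 0) S.numVars (numVarsBdd D) ?_
  have hc := Comp.counter (gs := gs) (numVarsBdd D) (b := fun y => y.2)
  have hkl : ∀ y ∈ roundDomain D (fun x => BetaCount.numVars (HasCode.code x)),
      y.2 ≤ (HasCode.code y).length := fun y hy => hy.2.le.trans (numVars_le _)
  exact .ite' (S.lift.memScope hi.lift (fun y hy => hlt y.1 hy.1) (S.lift.order hc hkl))
    ((Comp.const 2).pow hc (.of_le_length hkl)) (.const 0)

theorem Setting.alive (S : Setting D gs) (hk : Comp D gs fk)
    (hkl : ∀ x ∈ D, fk x ≤ (HasCode.code x).length) (hz : Comp D gs fz) :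
    CompPred D gs fun x => Alive (BetaCount.order (HasCode.code x)) (fk x) (fz x) := by
  refine CompPred.forall_lt (P := fun x k' => BetaCount.order (HasCode.code x) k' ≠ fz x) hk
    (.of_le_length hkl) ?_
  exact .ne (S.lift.order (.counter (.of_le_length hkl)) fun y hy => hy.2.le.trans (hkl y.1 hy.1))
    hz.lift

end

end BetaCount

namespace BetaCount

open Function (update)

/-! ### Packed tables -/

/-- A strict bound for the numerators and denominators that occur in the tables. -/
noncomputable def entryBound (w : List ℕ) : ℕ :=
  (rd w 0 + 1) ^ w.length * (scale w * (base w * base w)) ^ w.length + 1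

/-- A table of rational numbers, packed into a natural number. -/
noncomputable def pack (w : List ℕ) (u : ℕ → ℕ → ℚ≥0) : ℕ :=
  ∑ i ∈ Finset.range (codeTables w).m, (∑ r ∈ Finset.range ((codeTables w).nr i),
    ((u i r).num + (u i r).den * entryBound w) * (entryBound w * entryBound w) ^ r) *
      ((entryBound w * entryBound w) ^ w.length) ^ i

/-- The pair that encodes the entry of a packed table. -/
noncomputable def packedPair (w : List ℕ) (e i r : ℕ) : ℕ :=
  digit (entryBound w * entryBound w) (digit ((entryBound w * entryBound w) ^ w.length) e i) r

/-- The entry of a packed table. -/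
noncomputable def unpack (w : List ℕ) (e i r : ℕ) : ℚ≥0 :=
  (packedPair w e i r % entryBound w : ℕ) / (packedPair w e i r / entryBound w : ℕ)

/-- The entries of a table are below the bound. -/
def IsSmall (w : List ℕ) (u : ℕ → ℕ → ℚ≥0) : Prop :=
  ∀ i < (codeTables w).m, ∀ r < (codeTables w).nr i,
    (u i r).num < entryBound w ∧ (u i r).den < entryBound w

theorem add_mul_lt_mul_self {b p q : ℕ} (hp : p < b) (hq : q < b) : p + q * b < b * b := by
  have := Nat.mul_le_mul_right b (Nat.succ_le_of_lt hq)
  rw [Nat.succ_mul] at this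
  omega

section Pack

variable {w : List ℕ} {u : ℕ → ℕ → ℚ≥0}

theorem IsSmall.row_lt (h : GoodCode w) (hu : IsSmall w u) {i : ℕ} (hi : i < (codeTables w).m) :
    ∑ r ∈ Finset.range ((codeTables w).nr i), ((u i r).num + (u i r).den * entryBound w) *
      (entryBound w * entryBound w) ^ r < (entryBound w * entryBound w) ^ w.length :=
  (sum_digits_lt fun r hr => add_mul_lt_mul_self (hu i hi r hr).1 (hu i hi r hr).2).trans_le
    (Nat.pow_le_pow_right (Nat.mul_pos (Nat.succ_pos _) (Nat.succ_pos _)) (h.nr_le i hi))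

theorem IsSmall.pack_lt (h : GoodCode w) (hu : IsSmall w u) :
    pack w u < ((entryBound w * entryBound w) ^ w.length) ^ w.length :=
  (sum_digits_lt fun _ hi => hu.row_lt h hi).trans_le
    (Nat.pow_le_pow_right (Nat.pow_pos (Nat.mul_pos (Nat.succ_pos _) (Nat.succ_pos _))) h.m_le)

theorem IsSmall.packedPair_pack (h : GoodCode w) (hu : IsSmall w u) {i r : ℕ}
    (hi : i < (codeTables w).m) (hr : r < (codeTables w).nr i) :
    packedPair w (pack w u) i r = (u i r).num + (u i r).den * entryBound w := by
  rw [packedPair, pack, digit_sum (fun _ hi => hu.row_lt h hi) hi,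
    digit_sum (fun r hr => add_mul_lt_mul_self (hu i hi r hr).1 (hu i hi r hr).2) hr]

theorem IsSmall.unpack_pack (h : GoodCode w) (hu : IsSmall w u) {i r : ℕ}
    (hi : i < (codeTables w).m) (hr : r < (codeTables w).nr i) :
    packedPair w (pack w u) i r / entryBound w ≠ 0 ∧ unpack w (pack w u) i r = u i r := by
  have h1 := (hu i hi r hr).1
  have h2 : ((u i r).num + (u i r).den * entryBound w) / entryBound w = (u i r).den := by
    rw [Nat.add_mul_div_right _ _ ((Nat.zero_le _).trans_lt h1), Nat.div_eq_of_lt h1, zero_add]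
  refine ⟨?_, ?_⟩
  · rw [hu.packedPair_pack h hi hr, h2]
    exact (u i r).den_ne_zero
  · rw [unpack, hu.packedPair_pack h hi hr, h2, Nat.add_mul_mod_self_right, Nat.mod_eq_of_lt h1,
      NNRat.num_div_den]

end Pack

/-- The tables after the elimination of `k` variables. -/
noncomputable abbrev codeTable (w : List ℕ) : ℕ → ℕ → ℕ → ℚ≥0 :=
  (codeTables w).table (codeRank w) (order w)

/-- All tables of the run have entries below one bound that depends on the input only, so digits of
a fixed width suffice in every step. -/
theorem GoodCode.isSmall {w : List ℕ} (h : GoodCode w) {k : ℕ} (hk : k ≤ numVars w) :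
    IsSmall w (codeTable w k) := by
  intro i hi r hr
  have h1 := h.valid.table_num_den_le (Tables.rank_injOn _ _) h.isOrder.chainOrder
    h.isOrder.alive hk hi hr
  have h2 : ((codeTables w).N + 1) ^ k * (scale w * (base w * base w)) ^ (codeTables w).m <
      entryBound w := by
    refine Nat.lt_succ_of_le (Nat.mul_le_mul (Nat.pow_le_pow_right (Nat.succ_pos _)
      (hk.trans (numVars_le w))) (Nat.pow_le_pow_right ?_ h.m_le))
    exact Nat.mul_pos (scale_pos w) (Nat.mul_pos (one_le_base w) (one_le_base w))
  exact ⟨h1.1.trans_lt h2, h1.2.trans_lt h2⟩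

/-! ### The algorithm: dynamic programming -/

section

variable {X : Type} [HasCode X] {D D' : Set X} {gs : List (X → ℕ)}

variable {fi fj fr ft fz fd fk : X → ℕ}

theorem Setting.entryBound (S : Setting D gs) : Comp D gs fun x => entryBound (HasCode.code x) :=
  ((((Comp.const 0).rd.add (.const 1)).pow S.len (lenBdd D)).mul
    ((S.scale.mul (S.base.mul S.base)).pow S.len (lenBdd D))).add (.const 1)

/-- Packing brings the entries to lowest terms. Any growth of the unreduced fractions within one
elimination step is thereby undone before the next step. -/
theorem Setting.pack (S : Setting D gs) {u : X → ℕ → ℕ → ℚ≥0}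
    (hu : CompQ (roundDomain (roundDomain D fun x => (tb x).m) fun y => (tb y).nr y.2)
      (roundEnv (roundEnv gs)) fun y => u y.1.1 y.1.2 y.2) :
    Comp D gs fun x => pack (HasCode.code x) (u x) := by
  have S1 := S.lift (n := fun x => (tb x).m) (b := fun y => y.2)
  have hc := Comp.counter (gs := gs) S.mBdd (b := fun y => y.2)
  have hcb : PolyBdd (roundDomain D fun x => (tb x).m) fun y => y.2 :=
    .of_le_length fun y hy => hy.2.le.trans (S.good _ hy.1).m_le
  have hrb := S1.nrBdd (fi := fun y => y.2) fun y hy => hy.2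
  have S2 := S1.lift (n := fun y => (tb y).nr y.2) (b := fun y => y.2)
  refine Comp.rangeSum S.mComp S.mBdd (.mul ?_
    (((S1.entryBound.mul S1.entryBound).pow S1.len (lenBdd _)).pow hc hcb))
  refine Comp.rangeSum (F := fun (y : X × ℕ) r => ((u y.1 y.2 r).num +
    (u y.1 y.2 r).den * BetaCount.entryBound (HasCode.code y)) *
      (BetaCount.entryBound (HasCode.code y) * BetaCount.entryBound (HasCode.code y)) ^ r)
    (S1.nr hc fun y hy => hy.2) hrb ?_
  refine .mul ((Comp.num hu).add ((Comp.den hu).mul S2.entryBound))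
    ((S2.entryBound.mul S2.entryBound).pow (.counter hrb) ?_)
  exact .of_le_length fun y hy => hy.2.le.trans ((S1.good _ hy.1).nr_le _ hy.1.2)

/-- The setting of the computations with the tables after the elimination of `fk x` variables. -/
structure TableSetting (D : Set X) (gs : List (X → ℕ)) (fk : X → ℕ) : Prop extends
    Setting D gs where
  count : Comp D gs fk
  le_numVars : ∀ x ∈ D, fk x ≤ numVars (HasCode.code x)
  packed : Comp D gs fun x => BetaCount.pack (HasCode.code x) (codeTable (HasCode.code x) (fk x))

theorem TableSetting.lift (S : TableSetting D gs fk) {n : X → ℕ} {b : X × ℕ → ℕ} :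
    TableSetting (roundDomain D n) (loopEnv gs b) fun y => fk y.1 :=
  ⟨S.toSetting.lift, S.count.lift, fun y hy => S.le_numVars y.1 hy.1, S.packed.lift⟩

theorem TableSetting.subset (S : TableSetting D gs fk) (h : D' ⊆ D) : TableSetting D' gs fk :=
  ⟨S.toSetting.subset h, S.count.subset h, fun x hx => S.le_numVars x (h hx), S.packed.subset h⟩

theorem TableSetting.le_length (S : TableSetting D gs fk) :
    ∀ x ∈ D, fk x ≤ (HasCode.code x).length :=
  fun x hx => (S.le_numVars x hx).trans (numVars_le _)

theorem TableSetting.entry (S : TableSetting D gs fk) (hi : Comp D gs fi)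
    (hlt : ∀ x ∈ D, fi x < (tb x).m) (hr : Comp D gs fr) (hrlt : ∀ x ∈ D, fr x < (tb x).nr (fi x)) :
    CompQ D gs fun x => codeTable (HasCode.code x) (fk x) (fi x) (fr x) := by
  have hb := S.entryBound
  have hb2 := hb.mul hb
  have hB := hb2.pow S.len (lenBdd D)
  have hp : Comp D gs fun x => packedPair (HasCode.code x)
      (BetaCount.pack (HasCode.code x) (codeTable (HasCode.code x) (fk x))) (fi x) (fr x) :=
    (((S.packed.div (hB.pow hi (.of_le_length fun x hx =>
      (hlt x hx).le.trans (S.good x hx).m_le))).mod hB).div (hb2.pow hr (.of_le_length fun x hx =>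
      (hrlt x hx).le.trans ((S.good x hx).nr_le _ (hlt x hx))))).mod hb2
  refine ⟨_, _, hp.mod hb, hp.div hb, fun x hx => ?_⟩
  have h := ((S.good x hx).isSmall (S.le_numVars x hx)).unpack_pack (S.good x hx) (hlt x hx)
    (hrlt x hx)
  exact ⟨h.1, h.2.symm⟩

/-- The index of the row of `fj x` that agrees with row `fr x` of `fi x`, modified at `fz x`. -/
theorem Setting.findRow (S : Setting D gs) (hk : Comp D gs fk)
    (hkl : ∀ x ∈ D, fk x ≤ (HasCode.code x).length)
    (hj : Comp D gs fj) (hjlt : ∀ x ∈ D, fj x < (tb x).m) (hi : Comp D gs fi)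
    (hilt : ∀ x ∈ D, fi x < (tb x).m) (hr : Comp D gs fr) (hz : Comp D gs fz) (hd : Comp D gs fd) :
    Comp D gs fun x => (tb x).findRow (Alive (BetaCount.order (HasCode.code x)) (fk x)) (fj x)
      (update ((tb x).row (fi x) (fr x)) (fz x) (fd x)) := by
  classical
  have S1 := S.lift (n := fun x => (tb x).nr (fj x)) (b := fun y => y.2)
  have S2 := S1.lift (n := fun y => (tb y).nv (fj y.1)) (b := fun y => y.2)
  have hc := Comp.counter (gs := gs) (S.nrBdd hjlt) (b := fun y => y.2)
  have hjlt1 : ∀ y ∈ roundDomain D fun x => (tb x).nr (fj x), fj y.1 < (tb y).m :=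
    fun y hy => hjlt _ hy.1
  have hvb := S1.nvBdd hjlt1
  have hc2 := Comp.counter (gs := roundEnv gs) hvb (b := fun y => y.2)
  have hv := S2.var hj.lift.lift (fun y hy => hjlt1 _ hy.1) hc2
  have hcell := S2.cell hj.lift.lift (fun y hy => hjlt1 _ hy.1) hc.lift hc2
  have hrow := S2.row hi.lift.lift (fun y hy => hilt _ hy.1.1) hr.lift.lift hv
  have ha := S2.alive hk.lift.lift (fun y hy => hkl _ hy.1.1) hv
  have hP : CompPred (roundDomain D fun x => (tb x).nr (fj x)) (roundEnv gs) fun y =>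
      ∀ t < (tb y).nv (fj y.1), Alive (BetaCount.order (HasCode.code y.1)) (fk y.1)
        ((tb y).var (fj y.1) t) → (tb y).cell (fj y.1) y.2 t =
          update ((tb y).row (fi y.1) (fr y.1)) (fz y.1) (fd y.1) ((tb y).var (fj y.1) t) := by
    refine CompPred.forall_lt (P := fun (y : X × ℕ) t =>
      Alive (BetaCount.order (HasCode.code y.1)) (fk y.1) ((tb y).var (fj y.1) t) →
        (tb y).cell (fj y.1) y.2 t =
          update ((tb y).row (fi y.1) (fr y.1)) (fz y.1) (fd y.1) ((tb y).var (fj y.1) t))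
      (S1.nv hj.lift hjlt1) hvb (ha.imp (.eq hcell ?_))
    refine (Comp.ite' (.eq hv hz.lift.lift) hd.lift.lift hrow).congr fun y _ => ?_
    exact (Function.update_apply _ _ _ _).symm
  exact Comp.rangeSup (F := fun x r => if ∀ t < (tb x).nv (fj x),
    Alive (BetaCount.order (HasCode.code x)) (fk x) ((tb x).var (fj x) t) →
      (tb x).cell (fj x) r t = update ((tb x).row (fi x) (fr x)) (fz x) (fd x)
        ((tb x).var (fj x) t) then r + 1 else 0) (S.nr hj hjlt) (S.nrBdd hjlt)
    (.ite' hP (hc.add (.const 1)) (.const 0))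

theorem TableSetting.look (S : TableSetting D gs fk)
    (hj : Comp D gs fj) (hjlt : ∀ x ∈ D, fj x < (tb x).m) (hi : Comp D gs fi)
    (hilt : ∀ x ∈ D, fi x < (tb x).m) (hr : Comp D gs fr) (hz : Comp D gs fz) (hd : Comp D gs fd) :
    CompQ D gs fun x => (tb x).look (codeTable (HasCode.code x) (fk x))
      (Alive (BetaCount.order (HasCode.code x)) (fk x)) (fj x)
      (update ((tb x).row (fi x) (fr x)) (fz x) (fd x)) := by
  have hf := S.findRow S.count S.le_length hj hjlt hi hilt hr hz hd
  -- The packed table is read only where a row has been found, so that the row index is valid.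
  refine CompQ.ite (.eq hf (.const 0)) ((CompQ.natCast (S.df hj hjlt)).subset
    Set.inter_subset_left) ?_
  refine (S.subset Set.inter_subset_left).entry (hj.subset Set.inter_subset_left)
    (fun x hx => hjlt x hx.1) ((hf.sub (.const 1)).subset Set.inter_subset_left) fun x hx => ?_
  rcases (tb x).findRow_spec (Alive (BetaCount.order (HasCode.code x)) (fk x)) (fj x)
    (update ((tb x).row (fi x) (fr x)) (fz x) (fd x)) with ⟨h, -⟩ | ⟨r, hr, h, -⟩
  · exact absurd h hx.2
  · rw [h]
    exact hr

theorem TableSetting.chainProd (S : TableSetting D gs fk) (hi : Comp D gs fi)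
    (hilt : ∀ x ∈ D, fi x < (tb x).m) (hr : Comp D gs fr) (hz : Comp D gs fz) (ht : Comp D gs ft)
    (hd : Comp D gs fd) :
    CompQ D gs fun x => ∏ j ∈ Finset.range (tb x).m,
      if fz x ∈ (tb x).scope j ∧ BetaCount.codeRank (HasCode.code x) j < ft x then
        (tb x).look (codeTable (HasCode.code x) (fk x))
          (Alive (BetaCount.order (HasCode.code x)) (fk x)) j
          (update ((tb x).row (fi x) (fr x)) (fz x) (fd x)) else 1 := by
  refine CompQ.rangeProd (F := fun x j =>
      if fz x ∈ (tb x).scope j ∧ BetaCount.codeRank (HasCode.code x) j < ft x then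
        (tb x).look (codeTable (HasCode.code x) (fk x))
          (Alive (BetaCount.order (HasCode.code x)) (fk x)) j
          (update ((tb x).row (fi x) (fr x)) (fz x) (fd x)) else 1) S.mComp S.mBdd ?_
  have S1 := S.lift (n := fun x => (tb x).m) (b := fun y => y.2)
  have hc := Comp.counter (gs := gs) S.mBdd (b := fun y => y.2)
  exact .ite' (.and (S1.memScope hc (fun y hy => hy.2) hz.lift)
    (.lt (S1.codeRank hc fun y hy => hy.2) ht.lift))
    (S1.look hc (fun y hy => hy.2) hi.lift (fun y hy => hilt _ hy.1) hr.lift hz.lift hd.lift)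
    ((CompQ.natCast (.const 1)).congr fun _ _ => Nat.cast_one)

theorem Setting.newVal (_ : Setting D gs) (hp : Comp D gs ft)
    (hlt : ∀ x ∈ D, ft x ≤ (HasCode.code x).length) :
    CompPred D gs fun x => (tb x).NewVal (ft x) := by
  refine .and (.lt hp.rd (Comp.const 0).rd) ?_
  exact CompPred.forall_lt (P := fun x p' => rd (HasCode.code x) p' ≠ rd (HasCode.code x) (ft x)) hp
    (.of_le_length hlt) (.ne (Comp.counter (.of_le_length hlt)).rd hp.rd.lift)

theorem Setting.numVals (S : Setting D gs) : Comp D gs fun x => (tb x).numVals := by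
  classical
  exact Comp.rangeSum (F := fun x p => if (tb x).NewVal p then 1 else 0) S.len (lenBdd D)
    (.ite' (S.lift.newVal (.counter (lenBdd D)) fun y hy => hy.2.le) (.const 1) (.const 0))

theorem TableSetting.tableSum (S : TableSetting D gs fk) (hi : Comp D gs fi)
    (hilt : ∀ x ∈ D, fi x < (tb x).m) (hr : Comp D gs fr) (hz : Comp D gs fz) (ht : Comp D gs ft) :
    CompQ D gs fun x => (tb x).tableSum (BetaCount.codeRank (HasCode.code x))
      (codeTable (HasCode.code x) (fk x)) (Alive (BetaCount.order (HasCode.code x)) (fk x)) (fz x)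
      (ft x) ((tb x).row (fi x) (fr x)) := by
  classical
  have hN : Comp D gs fun x => (tb x).N := (Comp.const 0).rd
  have hp := Comp.counter (gs := gs) (lenBdd D) (b := fun y => y.2)
  refine .add ?_ (.mul (.natCast (hN.sub S.numVals)) (S.chainProd hi hilt hr hz ht hN))
  refine CompQ.rangeSum (F := fun x p => if (tb x).NewVal p then _ else 0) S.len (lenBdd D) ?_
  refine .ite' (S.lift.toSetting.newVal hp fun y hy => hy.2.le) ?_
    ((CompQ.natCast (.const 0)).congr fun _ _ => Nat.cast_zero)
  exact S.lift.chainProd hi.lift (fun y hy => hilt _ hy.1) hr.lift hz.lift ht.lift hp.rd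

theorem TableSetting.entry_succ (S : TableSetting D gs fk) (hi : Comp D gs fi)
    (hilt : ∀ x ∈ D, fi x < (tb x).m) (hr : Comp D gs fr)
    (hrlt : ∀ x ∈ D, fr x < (tb x).nr (fi x)) :
    CompQ D gs fun x => codeTable (HasCode.code x) (fk x + 1) (fi x) (fr x) := by
  have hz := S.order S.count S.le_length
  have hκ := S.codeRank hi hilt
  exact .ite' (S.memScope hi hilt hz) (.div (S.tableSum hi hilt hr hz (hκ.add (.const 1)))
    (S.tableSum hi hilt hr hz hκ)) (S.entry hi hilt hr hrlt)

theorem Setting.packed (S : Setting D gs) : Comp D gs fun x =>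
    BetaCount.pack (HasCode.code x)
      (codeTable (HasCode.code x) (BetaCount.numVars (HasCode.code x))) := by
  have hm := Comp.counter (gs := gs) S.mBdd (b := fun y => y.2)
  refine Comp.loop (F := fun x k => BetaCount.pack (HasCode.code x) (codeTable (HasCode.code x) k))
    S.numVars (numVarsBdd D) (S.pack (u := fun x => codeTable (HasCode.code x) 0) ?_) ?_
    fun ha => ?_
  · have S1 := S.lift (n := fun x => (tb x).m) (b := fun y => y.2)
    exact .natCast ((S1.lift (b := fun y => y.2)).wt hm.lift (fun y hy => hy.1.2)
      (.counter (S1.nrBdd fun y hy => hy.2)))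
  -- The bound for the accumulator, uniform in the number of eliminated variables, comes from
  -- `IsSmall.pack_lt`.
  · have hb := S.entryBound.1
    refine SizeBdd.mono ((((hb.mul hb).pow (lenBdd D)).pow (lenBdd D)).lift fun y hy => hy.1)
      fun y hy => ?_
    exact (((S.good _ hy.1).isSmall hy.2).pack_lt (S.good _ hy.1)).le
  · have S1 : TableSetting (roundDomain D fun x => BetaCount.numVars (HasCode.code x))
        (loopEnv gs fun y => BetaCount.pack (HasCode.code y.1) (codeTable (HasCode.code y.1) y.2))
        fun y => y.2 := ⟨S.lift, .counter (numVarsBdd D), fun y hy => hy.2.le, ha⟩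
    refine S1.pack (u := fun y => codeTable (HasCode.code y.1) (y.2 + 1)) ?_
    have S2 := S1.lift (n := fun y => (tb y).m) (b := fun y => y.2)
    have hm2 := Comp.counter (gs := loopEnv gs fun y =>
      BetaCount.pack (HasCode.code y.1) (codeTable (HasCode.code y.1) y.2))
        S1.mBdd (b := fun y => y.2)
    exact (S2.lift (n := fun y => (tb y).nr y.2) (b := fun y => y.2)).entry_succ hm2.lift
      (fun y hy => hy.1.2) (.counter (S2.nrBdd fun y hy => hy.2)) fun y hy => hy.2

/-- The value that the algorithm computes. -/
noncomputable def result (w : List ℕ) : ℚ≥0 :=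
  (⌊total (rd w 0) (order w) (numVars w) (fun a => ∏ i ∈ Finset.range (rd w 1),
    ((codeTables w).weight i a : ℚ≥0)) (fun _ => 0) / (scale w : ℚ≥0) ^ rd w 1⌋₊ : ℚ≥0) /
      (base w : ℚ≥0) ^ rd w 1

/-- No variable of any scope is alive at the end, so the lookup does not depend on the assignment.
The one written here has the form that `TableSetting.look` can compute. -/
theorem GoodCode.total_eq {w : List ℕ} (h : GoodCode w) :
    total (rd w 0) (order w) (numVars w) (fun a => ∏ i ∈ Finset.range (rd w 1),
      ((codeTables w).weight i a : ℚ≥0)) (fun _ => 0) =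
    ((rd w 0 ^ numVars w : ℕ) : ℚ≥0) * ∏ i ∈ Finset.range (rd w 1),
      (codeTables w).look (codeTable w (numVars w)) (Alive (order w) (numVars w)) i
        (update ((codeTables w).row i 0) 0 0) := by
  refine (h.valid.total_eq (Tables.rank_injOn _ _) h.isOrder.chainOrder h.isOrder.alive _).trans ?_
  rw [Nat.cast_pow]
  refine congrArg₂ _ rfl (Finset.prod_congr rfl fun i hi => ?_)
  unfold Tables.look
  rw [Tables.findRow_congr fun z hz hza => ?_]
  obtain ⟨k, hk, rfl⟩ := h.isOrder.exhausts i (Finset.mem_range.1 hi) z hz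
  exact absurd rfl (hza k hk)

theorem Setting.result (S : Setting D gs) : CompQ D gs fun x => result (HasCode.code x) := by
  have hpow : ∀ {f : X → ℕ}, Comp D gs f → CompQ D gs fun x => (f x : ℚ≥0) ^ (tb x).m := fun hf =>
    (CompQ.natCast (hf.pow S.mComp S.mBdd)).congr fun x _ => Nat.cast_pow _ _
  have S1 : TableSetting D gs fun x => BetaCount.numVars (HasCode.code x) :=
    ⟨S, S.numVars, fun _ _ => le_rfl, S.packed⟩
  refine .div (.natCast (.floor (.div ?_ (hpow S.scale)))) (hpow S.base)
  have hc := Comp.counter (gs := gs) S.mBdd (b := fun y => y.2)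
  refine CompQ.congr (.mul (.natCast ((Comp.const 0).rd.pow S.numVars (numVarsBdd D)))
    (.rangeProd S.mComp S.mBdd (S1.lift.look hc (fun y hy => hy.2) hc (fun y hy => hy.2) (.const 0)
      (.const 0) (.const 0)))) fun x hx => (S.good x hx).total_eq.symm

end

instance : HasCode (List ℕ) := ⟨id⟩

/-- A pair of computable functions of the input is computed by a program. -/
theorem exists_program {D : Set (List ℕ)} {f g : List ℕ → ℕ} (hf : Comp D [List.length] f)
    (hg : Comp D [List.length] g) : ∃ (p : Ram.Program) (q : Polynomial ℕ), ∀ w ∈ D,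
      ∃ (t : ℕ) (s : Ram.State), Ram.Exec (q.eval (bitLength w)) p (Ram.init w) t s ∧
        t ≤ q.eval (bitLength w) ∧ s.reg 0 = f w ∧ s.reg 1 = g w := by
  -- Register 0 initially holds the length, which both programs need. The results go to registers 1
  -- and 2 and are moved down at the end.
  obtain ⟨p₁, q₁, h₁⟩ := hf.2 (fun _ => 0) 1 (by simp)
  obtain ⟨p₂, q₂, h₂⟩ := hg.2 (fun _ => 0) 2 (by simp)
  obtain ⟨q₃, h₃⟩ := hf.1
  obtain ⟨q₄, h₄⟩ := hg.1
  refine ⟨.seq p₁ (.seq p₂ (.seq (.setReg 0 (.reg 1)) (.setReg 1 (.reg 2)))), q₁ + q₂ + q₃ + q₄ + 4,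
    fun w hw => ?_⟩
  obtain ⟨t₁, s₁, e₁, c₁, m₁, k₁, r₁⟩ := h₁ w hw (Ram.init w) rfl (by simp [Ram.init])
  obtain ⟨t₂, s₂, e₂, c₂, m₂, k₂, r₂⟩ := h₂ w hw s₁ m₁ (by
    intro i hi
    obtain rfl : i = 0 := by simpa using hi
    exact k₁ 0 (by omega))
  have h₃' := h₃ w hw
  have h₄' := h₄ w hw
  have r₁' : s₂.reg 1 = f w := (k₂ 1 (by omega)).trans r₁
  set B := (q₁ + q₂ + q₃ + q₄ + 4).eval (bitLength w) with hB
  simp only [Polynomial.eval_add, Polynomial.eval_ofNat] at hB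
  change t₁ ≤ q₁.eval (bitLength w) at c₁
  change t₂ ≤ q₂.eval (bitLength w) at c₂
  change (f w).size ≤ q₃.eval (bitLength w) at h₃'
  change (g w).size ≤ q₄.eval (bitLength w) at h₄'
  obtain ⟨s₃, e₃, -, k₃, r₃⟩ := exec_setReg (B := B) (d := 0) (e := .reg 1) (s := s₂) r₁' (by omega)
  have r₂' : s₃.reg 2 = g w := (k₃ 2 (by omega)).trans r₂
  obtain ⟨s₄, e₄, -, k₄, r₄⟩ := exec_setReg (B := B) (d := 1) (e := .reg 2) (s := s₃) r₂' (by omega)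
  refine ⟨_, s₄, .seq (exec_mono ?_ e₁) (.seq (exec_mono ?_ e₂) (.seq e₃ e₄)), ?_,
    (k₄ 0 (by omega)).trans r₃, r₄⟩
  · change q₁.eval (bitLength w) ≤ B
    omega
  · change q₂.eval (bitLength w) ≤ B
    omega
  · simp only [Ram.Expr.cost, r₁', r₂']
    omega

end BetaCount

/-- There is an algorithm (a program of a random access machine with logarithmic cost) that
computes, in time polynomial in the length of the encoding and with all stored numbers of
polynomial bit size, the partition function of every `β`-acyclic instance of weighted counting for
constraint satisfaction with default values. -/
theorem mainTheorem1 :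
    ∃ (p : Ram.Program) (q : Polynomial ℕ),
      ∀ (n : ℕ) (I : Finset (WeightedConstraint ℕ (Fin n))),
        (instanceHypergraph I).BetaAcyclic →
        ∀ code : List ℕ, IsInstanceCode I code →
          ∃ (t : ℕ) (s : Ram.State),
            Ram.Exec (q.eval (bitLength code)) p (Ram.init code) t s ∧
            t ≤ q.eval (bitLength code) ∧
            s.reg 0 = (partitionFunction I).num ∧
            s.reg 1 = (partitionFunction I).den := by
  -- The program is built for the set of all good codes, before any instance is given; β-acyclicity
  -- enters only in showing that a code is good.
  have S : BetaCount.Setting {w : List ℕ | BetaCount.GoodCode w} [List.length] :=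
    ⟨fun _ hw => hw, .getElem (gs := [List.length]) 0 (by simp) (BetaCount.lenBdd _).sizeBdd⟩
  obtain ⟨p, q, h⟩ := BetaCount.exists_program (BetaCount.Comp.num S.result)
    (BetaCount.Comp.den S.result)
  refine ⟨p, q, fun n I hI w hw => ?_⟩
  obtain ⟨cs, hnd, hmem, hr⟩ := BetaCount.exists_reads hw
  have hgood := hr.goodCode hmem hI
  rw [hr.partitionFunction_eq hnd hmem hgood.isOrder (BetaCount.numVars_le w)]
  exact h w hgood
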